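/- Let $X$ be a connected $C^\infty$ Riemannian manifold of dimension $d$ that is a Riemannian symmetric space of the noncompact type or, more generally, is homogeneous (the diffeomorphisms of $X$ preserving the metric tensor act transitively) or has bounded geometry (definition below). Let $\mu$ be the Riemannian measure, $B(x,\rho)$ the open balls of the Riemannian distance, and $\operatorname{inj}(X)$ the injectivity radius. For $r>0$, a countable (finite or infinite) well-ordered family of points $\{x_k\}$ is called an $r$-lattice if the balls $B(x_k,r/4)$ are pairwise disjoint and the balls $B(x_k,r/2)$ cover $X$; with it one associates the sets $$U_k=B(x_k,r/2)\setminus\Big(\bigcup_{j<k}U_j\cup\bigcup_{i\ne k}B(x_i,r/4)\Big)$$ and, for every $\psi_k\in C_0^\infty(U_k)$ with $0\le\psi_k\le1$, $\psi_k\not\equiv0$, the weighted average $$\Psi_k(F)=\Big(\int_{U_k}\psi_k\,d\mu\Big)^{-1}\int_{U_k}F\,\psi_k\,d\mu .$$ A geodesic coordinate system on $B(y,\rho)$ is the inverse of a diffeomorphism $\exp_y\circ L$ from the ball of radius $\rho$ about $0$ in $\mathbb R^d$ onto $B(y,\rho)$, where $L:\mathbb R^d\to T_yX$ is a linear isometry;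 $\operatorname{inj}(X)$ is the supremum of the $\rho$ such that all balls of radius at most $\rho$ have geodesic coordinates. Bounded geometry means that $X$ is complete, $\operatorname{inj}(X)>0$, and for all $0<r<\operatorname{inj}(X)$ and $k\in\mathbb N$ the partial derivatives of order at most $k$ of all transition maps between geodesic coordinate systems on balls of radius $r$ are bounded by a constant $C(r,k)$. Let $m\in\mathbb N$, $m>d/2$, and $0<\lambda<\operatorname{inj}(X)$. Then there are constants $C>0$ and $r_0>0$, depending only on $X$, $m$ and $\lambda$, such that the following holds. Let $\{y_\nu\}$ be a $\lambda$-lattice (no order is needed here), fix geodesic coordinates $\theta_\nu^{-1}=(\exp_{y_\nu}\circ L_\nu)^{-1}$ on each $B(y_\nu,\lambda)$, and let $\{\varphi_\nu\}$ be a smooth partition of unity on $X$ with $\varphi_\nu\in C_0^\infty(B(y_\nu,\lambda/2))$ whose derivatives of each order in these coordinates are bounded uniformly in $\nu$. Let $H^m(X)$ be the completion of $C_0^\infty(X)$, realised in $L_2(X)$, in the norm $$\Big(\sum_\nu\sum_{1\le|\alpha|\le m}\|\partial^\alpha(\varphi_\nu f)\|^2_{L_2(B(y_\nu,\lambda/2))}\Big)^{1/2},$$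 with $\partial^\alpha(\varphi_\nu f)$ computed in the coordinates $\theta_\nu^{-1}$. Then for every complex-valued $f\in H^m(X)$ and every $\nu$, the weak derivatives $\partial^\alpha(\varphi_\nu f)$, $1\le|\alpha|\le m$, in the coordinates $\theta_\nu^{-1}$ exist on $B(y_\nu,\lambda)$ and are square-integrable there with respect to $\mu$, and for every $r$-lattice $\{x_k\}$ with $0<r<r_0$, every $k$ and every associated functional $\Psi_k$, $$\|\varphi_\nu f-\Psi_k(\varphi_\nu f)\|^2_{L_2(U_k)}\le C\sum_{1\le|\alpha|\le m}r^{2|\alpha|}\,\|\partial^\alpha(\varphi_\nu f)\|^2_{L_2(B(x_k,r))},$$ where $\partial^\alpha(\varphi_\nu f)$ is extended by $0$ outside $B(y_\nu,\lambda)$ and all $L_2$-norms are taken with respect to $\mu$. -/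

import Mathlib

open Set Metric MeasureTheory Bundle Filter
open scoped Manifold ContDiff Topology ENNReal

noncomputable section

namespace LocalPoincare

/-- The model space `ℝ^d` with its Euclidean norm. -/
abbrev E (d : ℕ) : Type := EuclideanSpace ℝ (Fin d)

/-- The `i`-th vector of the standard basis of `ℝ^d`. -/
def basisVec {d : ℕ} (i : Fin d) : E d := EuclideanSpace.single i (1 : ℝ)

section Euclidean

variable {d : ℕ} {F : Type*} [NormedAddCommGroup F] [NormedSpace ℝ F]

/-- The first order partial derivative `∂_i u`. -/
def partialDeriv (i : Fin d) (u : E d → F) : E d → F :=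
  fun v => fderiv ℝ u v (basisVec i)

/-- The partial derivative `∂^α u = ∂_1^{α_1} ⋯ ∂_d^{α_d} u` for a multi-index `α`. -/
def multiDeriv (α : Fin d → ℕ) (u : E d → F) : E d → F :=
  (List.finRange d).foldr (fun i w => (partialDeriv i)^[α i] w) u

/-- The order `|α| = α_1 + ⋯ + α_d` of a multi-index. -/
def order (α : Fin d → ℕ) : ℕ := ∑ i, α i

variable (d) in
/-- The finite set of multi-indices `α` with `1 ≤ |α| ≤ m`. -/
def multiIndices (m : ℕ) : Finset (Fin d → ℕ) :=
  (Finset.Icc 1 m).biUnion fun j => Finset.piAntidiag Finset.univ j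

theorem mem_multiIndices {m : ℕ} {α : Fin d → ℕ} :
    α ∈ multiIndices d m ↔ 1 ≤ order α ∧ order α ≤ m := by
  simp [multiIndices, order]

/-- `w` is the weak (distributional) partial derivative `∂^α u` on the open set `Ω ⊆ ℝ^d`. -/
structure IsWeakDeriv (Ω : Set (E d)) (α : Fin d → ℕ) (u w : E d → ℂ) : Prop where
  locallyIntegrable_left : LocallyIntegrableOn u Ω volume
  locallyIntegrable_right : LocallyIntegrableOn w Ω volume
  integral_eq : ∀ η : E d → ℝ, ContDiff ℝ ∞ η → HasCompactSupport η → tsupport η ⊆ Ω →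
    ∫ v in Ω, multiDeriv α η v • u v = (-1 : ℝ) ^ order α • ∫ v in Ω, η v • w v

end Euclidean

section Lattice

variable {X : Type*} [MetricSpace X] {ι : Type*}

/-- The points `x_i` form an `r`-lattice: the balls `B(x_i, r/4)` are disjoint and the balls
`B(x_i, r/2)` cover the space. -/
structure IsLattice (r : ℝ) (x : ι → X) : Prop where
  disjoint : Pairwise fun i j => Disjoint (ball (x i) (r / 4)) (ball (x j) (r / 4))
  cover : ⋃ i, ball (x i) (r / 2) = univ

/-- The sets `U_k`, defined recursively; see `cell_eq`. -/
def cell [LinearOrder ι] [WellFoundedLT ι] (r : ℝ) (x : ι → X) : ι → Set X :=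
  IsWellFounded.fix (fun i j : ι => i < j) fun k U =>
    ball (x k) (r / 2) \ ((⋃ (j : ι) (hj : j < k), U j hj) ∪
      ⋃ (i : ι) (_ : i ≠ k), ball (x i) (r / 4))

theorem cell_eq [LinearOrder ι] [WellFoundedLT ι] (r : ℝ) (x : ι → X) (k : ι) :
    cell r x k = ball (x k) (r / 2) \ ((⋃ (j : ι) (_ : j < k), cell r x j) ∪
      ⋃ (i : ι) (_ : i ≠ k), ball (x i) (r / 4)) :=
  IsWellFounded.fix_eq _ _ k

end Lattice

section Riemannian

variable {d : ℕ} {X : Type*} [MetricSpace X] [ChartedSpace (E d) X]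
  [RiemannianBundle (fun p : X => TangentSpace (𝓡 d) p)]

/-- The coordinate vector field `∂_i` of the chart `e`, at the point with coordinates `v`. -/
def coordVec (e : OpenPartialHomeomorph X (E d)) (v : E d) (i : Fin d) :
    TangentSpace (𝓡 d) (e.symm v) :=
  mfderiv (𝓡 d) (𝓡 d) e.symm v (basisVec i)

/-- The components `g_{ij} = g(∂_i, ∂_j)` of the metric tensor in the chart `e`. -/
def metricMatrix (e : OpenPartialHomeomorph X (E d)) (v : E d) : Matrix (Fin d) (Fin d) ℝ :=
  Matrix.of fun i j => inner ℝ (coordVec e v i) (coordVec e v j)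

/-- The Christoffel symbols
`Γ^k_{ij} = (1/2) ∑_l g^{kl} (∂_i g_{jl} + ∂_j g_{il} - ∂_l g_{ij})` in the chart `e`. -/
def christoffel (e : OpenPartialHomeomorph X (E d)) (v : E d) (k i j : Fin d) : ℝ :=
  (1 / 2 : ℝ) * ∑ l, (metricMatrix e v)⁻¹ k l *
    (partialDeriv i (fun w => metricMatrix e w j l) v
      + partialDeriv j (fun w => metricMatrix e w i l) v
      - partialDeriv l (fun w => metricMatrix e w i j) v)

/-- `γ` is a (smooth) geodesic on the open set of times `J`: in every chart its coordinates satisfy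
`c_k'' + ∑_{i,j} Γ^k_{ij}(c) c_i' c_j' = 0`. -/
def IsGeodesicOn (γ : ℝ → X) (J : Set ℝ) : Prop :=
  ContMDiffOn 𝓘(ℝ, ℝ) (𝓡 d) ∞ γ J ∧
    ∀ e ∈ IsManifold.maximalAtlas (𝓡 d) ∞ X, ∀ t ∈ J, γ t ∈ e.source → ∀ k : Fin d,
      deriv (deriv fun s => e (γ s) k) t +
        ∑ i, ∑ j, christoffel e (e (γ t)) k i j *
          deriv (fun s => e (γ s) i) t * deriv (fun s => e (γ s) j) t = 0

variable (d) in
/-- A geodesic coordinate system on the ball `B(y, ρ)`: a smooth chart from `B(y, ρ)` onto the ball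
of radius `ρ` about `0` in `ℝ^d` whose inverse `θ` has the form `exp_y ∘ L` with
`L : ℝ^d → T_y X` a linear isometry (the choice of an orthonormal basis of `T_y X`). That is,
`θ(0) = y`, the differential `L` of `θ` at `0` is isometric, and each curve `t ↦ θ(tv)` is a
geodesic (its initial velocity is then `L v`). -/
structure GeodesicChart (y : X) (ρ : ℝ) where
  chart : OpenPartialHomeomorph X (E d)
  smooth : chart ∈ IsManifold.maximalAtlas (𝓡 d) ∞ X
  source_eq : chart.source = ball y ρ
  target_eq : chart.target = ball 0 ρ
  map_center : chart y = 0
  orthonormal : metricMatrix chart 0 = 1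
  geodesic : ∀ v : E d,
    IsGeodesicOn (d := d) (fun t : ℝ => chart.symm (t • v)) {t : ℝ | ‖t • v‖ < ρ}

variable (d X) in
/-- The injectivity radius: the supremum of all `ρ > 0` such that every ball of radius at most `ρ`
carries geodesic coordinates. -/
def injRadius : ℝ≥0∞ :=
  ⨆ (ρ : ℝ) (_ : ∀ s : ℝ, 0 < s → s ≤ ρ → ∀ y : X, Nonempty (GeodesicChart d y s)),
    ENNReal.ofReal ρ

variable (d X) in
/-- Bounded geometry: completeness, positive injectivity radius, and, for every radius
`r < inj(X)`, bounds of every order for the transition maps between geodesic coordinate systems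
on balls of radius `r`. (Connectedness is assumed separately.) -/
structure HasBoundedGeometry : Prop where
  complete : CompleteSpace X
  injRadius_pos : 0 < injRadius d X
  transition_bound : ∀ r : ℝ, 0 < r → ENNReal.ofReal r < injRadius d X → ∀ k : ℕ,
    ∃ C : ℝ, ∀ (x y : X) (θx : GeodesicChart d x r) (θy : GeodesicChart d y r),
      ∀ v ∈ ball (0 : E d) r, θy.chart.symm v ∈ ball x r →
        ∀ α : Fin d → ℕ, order α ≤ k →
          ‖multiDeriv α (fun w => θx.chart (θy.chart.symm w)) v‖ ≤ C

variable (d X) in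
/-- The Riemannian manifold `X` is homogeneous: the diffeomorphisms of `X` that preserve the metric
tensor act transitively on `X`. -/
def IsHomogeneous : Prop :=
  ∀ x y : X, ∃ Φ : Diffeomorph (𝓡 d) (𝓡 d) X X ∞, Φ x = y ∧
    ∀ (p : X) (v w : TangentSpace (𝓡 d) p),
      inner ℝ (mfderiv (𝓡 d) (𝓡 d) Φ p v) (mfderiv (𝓡 d) (𝓡 d) Φ p w) = inner ℝ v w

variable [MeasurableSpace X]

/-- The measure `√|det g_{ij}| dx` on the domain of the chart `e`, as a measure on `X`. -/
def chartMeasure (e : OpenPartialHomeomorph X (E d)) : Measure X :=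
  Measure.map e.symm ((volume.restrict e.target).withDensity
    fun v => ENNReal.ofReal (Real.sqrt |(metricMatrix e v).det|))

variable (d X) in
/-- The Riemannian measure `μ`: the measure that is `√|det g_{ij}| dx` in every chart. The chart
measures agree on overlaps, so that gluing them amounts to taking their supremum. -/
def riemMeasure : Measure X :=
  ⨆ e ∈ IsManifold.maximalAtlas (𝓡 d) ∞ X, chartMeasure (d := d) e

/-- The weighted average `Ψ(F) = (∫_U ψ dμ)⁻¹ ∫_U F ψ dμ`. -/
def weightedAvg (μ : Measure X) (U : Set X) (ψ : X → ℝ) (F : X → ℂ) : ℂ :=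
  (∫ p in U, ψ p ∂μ)⁻¹ • ∫ p in U, ψ p • F p ∂μ

variable {κ : Type} {y : κ → X} {lam : ℝ}

/-- The standing requirements on the partition of unity `φ_ν` in the definition of the Sobolev
spaces: it is smooth, with `φ_ν ∈ C_0^∞(B(y_ν, λ/2))`, and every derivative of `φ_ν` in the
geodesic coordinates `θ_ν` about `y_ν` is bounded uniformly in `ν`. -/
structure IsAdmissible (θ : ∀ ν, GeodesicChart d (y ν) lam)
    (φ : SmoothPartitionOfUnity κ (𝓡 d) X univ) : Prop where
  hasCompactSupport : ∀ ν, HasCompactSupport (φ ν)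
  subordinate : ∀ ν, tsupport (φ ν) ⊆ ball (y ν) (lam / 2)
  bounded : ∀ k : ℕ, ∃ C : ℝ, ∀ (ν : κ) (α : Fin d → ℕ), order α ≤ k →
    ∀ v ∈ ball (0 : E d) lam, |multiDeriv α (fun w => φ ν ((θ ν).chart.symm w)) v| ≤ C

/-- `φ_ν f` in the geodesic coordinates `θ_ν` about `y_ν`. -/
def localized (θ : ∀ ν, GeodesicChart d (y ν) lam) (φ : SmoothPartitionOfUnity κ (𝓡 d) X univ)
    (ν : κ) (f : X → ℂ) : E d → ℂ :=
  fun v => φ ν ((θ ν).chart.symm v) • f ((θ ν).chart.symm v)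

/-- The square of the Sobolev norm of a smooth function,
`∑_ν ∑_{1 ≤ |α| ≤ m} ‖∂^α (φ_ν F)‖²_{L_2(B(y_ν, λ/2))}`, the derivatives being computed in the
geodesic coordinates `θ_ν`. -/
def sobolevNormSq (m : ℕ) (θ : ∀ ν, GeodesicChart d (y ν) lam)
    (φ : SmoothPartitionOfUnity κ (𝓡 d) X univ) (F : X → ℂ) : ℝ≥0∞ :=
  ∑' ν, ∑ α ∈ multiIndices d m, ∫⁻ p in ball (y ν) (lam / 2),
    ‖multiDeriv α (localized θ φ ν F) ((θ ν).chart p)‖ₑ ^ 2 ∂(riemMeasure d X)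

/-- `f ∈ H^m(X)`, the completion of `C_0^∞(X)` in the Sobolev norm, realised inside `L_2(X)`:
`f` is the `L_2`-limit of a sequence in `C_0^∞(X)` which is Cauchy in the Sobolev norm. -/
def MemSobolev (m : ℕ) (θ : ∀ ν, GeodesicChart d (y ν) lam)
    (φ : SmoothPartitionOfUnity κ (𝓡 d) X univ) (f : X → ℂ) : Prop :=
  MemLp f 2 (riemMeasure d X) ∧ ∃ F : ℕ → X → ℂ,
    (∀ n, ContMDiff (𝓡 d) 𝓘(ℝ, ℂ) ∞ (F n) ∧ HasCompactSupport (F n)) ∧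
    Tendsto (fun n => eLpNorm (F n - f) 2 (riemMeasure d X)) atTop (𝓝 0) ∧
    ∀ ε : ℝ≥0∞, 0 < ε → ∃ N : ℕ, ∀ p ≥ N, ∀ q ≥ N, sobolevNormSq m θ φ (F p - F q) < ε

end Riemannian

end LocalPoincare

end

/-! The condition m > d/2 places the estimate in the range where `H^m` controls oscillation
pointwise, so no cancellation in the average is needed. If |g(p) - g(q)|² ≤ T/r^d for almost all p,
q in B(x_k, r/2), then g differs from any weighted average over U_k by at most (T/r^d)^{1/2}. Since
μ(U_k) is at most a constant times r^d, integrating the square over U_k gives a constant times T. It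
remains to prove the oscillation bound with T a multiple of ∑ r^{2|α|} ‖∂^α g‖² over B(x_k, r).

On a Euclidean ball of radius ρ this is `exists_oscillation_bound`. The value u(x) is expanded by
Taylor's formula about a variable point y of the ball, to order m. The terms of lower order and the
remainder are then squared and integrated over y. In the remainder the homothety centred at x loses
a power of its ratio, which the Taylor weight compensates exactly when d < 2m
(`lintegral_taylor_remainder_le`).

The passage to X needs one constant Λ for which all geodesic coordinates of radius λ distort lengths
by at most Λ (`IsElliptic`). In bounded geometry, coordinates at a point are compared with the
coordinates centred at that point, whose differential there is isometric. In the homogeneous case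
all coordinates are moved to one point, where they agree with fixed larger coordinates up to a
linear isometry, and compactness applies. Ellipticity compares distances and measures. The chart
image of a Riemannian ball need not be a Euclidean ball, so the oscillation bound is applied on
small Euclidean balls and propagated along chains of points
(`exists_oscillation_bound_of_isElliptic`). Completeness ensures that those small balls lie in the
range of the chart.

Finally φ_ν f is an `L_2`-limit of smooth functions φ_ν F_n whose coordinate derivatives are Cauchy
in `L_2` (`MemSobolev.exists_approximation`). The limits of the derivatives are the weak
derivatives, and the oscillation bound survives almost everywhere along a subsequence. -/

namespace LocalPoincare

/-! ### Calculus of multi-index derivatives of smooth functions -/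

section PartialDerivatives

variable {d : ℕ} {F : Type*} [NormedAddCommGroup F] [NormedSpace ℝ F]

theorem contDiff_partialDeriv {u : E d → F} (hu : ContDiff ℝ ∞ u) (i : Fin d) :
    ContDiff ℝ ∞ (partialDeriv i u) :=
  (hu.fderiv_right (m := ∞) le_rfl).clm_apply contDiff_const

theorem contDiff_partialDeriv_iterate {u : E d → F} (hu : ContDiff ℝ ∞ u) (i : Fin d) (n : ℕ) :
    ContDiff ℝ ∞ ((partialDeriv i)^[n] u) := by
  induction n generalizing u with
  | zero => exact hu
  | succ n ih => exact ih (contDiff_partialDeriv hu i)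

theorem partialDeriv_comm {u : E d → F} (hu : ContDiff ℝ ∞ u) (i j : Fin d) :
    partialDeriv i (partialDeriv j u) = partialDeriv j (partialDeriv i u) := by
  have hd : Differentiable ℝ (fderiv ℝ u) :=
    (hu.fderiv_right (m := ∞) le_rfl).differentiable (by simp)
  have key : ∀ (a b : Fin d) (v : E d), partialDeriv a (partialDeriv b u) v
      = fderiv ℝ (fderiv ℝ u) v (basisVec a) (basisVec b) := by
    intro a b v
    have := ((hd v).hasFDerivAt.clm_apply (hasFDerivAt_const (basisVec b) v)).fderiv
    change fderiv ℝ (fun y => fderiv ℝ u y (basisVec b)) v (basisVec a) = _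
    rw [this]
    simp
  funext v
  rw [key, key]
  exact (hu.contDiffAt.isSymmSndFDerivAt (by simp; exact WithTop.coe_le_coe.2 le_top)) _ _

theorem partialDeriv_iterate_comm {u : E d → F} (hu : ContDiff ℝ ∞ u) (i j : Fin d) (n : ℕ) :
    (partialDeriv j)^[n] (partialDeriv i u) = partialDeriv i ((partialDeriv j)^[n] u) := by
  induction n generalizing u with
  | zero => rfl
  | succ n ih =>
    rw [Function.iterate_succ_apply, Function.iterate_succ_apply,
      ← ih (contDiff_partialDeriv hu j), partialDeriv_comm hu]

/-- The partial derivatives `∂^α` in the directions that occur in the list `l`. -/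
noncomputable def listDeriv (l : List (Fin d)) (α : Fin d → ℕ) (u : E d → F) : E d → F :=
  l.foldr (fun i w => (partialDeriv i)^[α i] w) u

theorem contDiff_listDeriv {u : E d → F} (hu : ContDiff ℝ ∞ u) (l : List (Fin d))
    (α : Fin d → ℕ) : ContDiff ℝ ∞ (listDeriv l α u) := by
  induction l with
  | nil => exact hu
  | cons j l ih => exact contDiff_partialDeriv_iterate ih j _

theorem contDiff_multiDeriv {u : E d → F} (hu : ContDiff ℝ ∞ u) (α : Fin d → ℕ) :
    ContDiff ℝ ∞ (multiDeriv α u) :=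
  contDiff_listDeriv hu _ α

theorem listDeriv_partialDeriv {u : E d → F} (hu : ContDiff ℝ ∞ u) (l : List (Fin d))
    (α : Fin d → ℕ) (i : Fin d) :
    listDeriv l α (partialDeriv i u) = partialDeriv i (listDeriv l α u) := by
  induction l with
  | nil => rfl
  | cons j l ih =>
    change (partialDeriv j)^[α j] (listDeriv l α (partialDeriv i u)) = _
    rw [ih, partialDeriv_iterate_comm (contDiff_listDeriv hu l α)]
    rfl

theorem listDeriv_congr_index (l : List (Fin d)) {α β : Fin d → ℕ} (h : ∀ i ∈ l, α i = β i)
    (u : E d → F) : listDeriv l α u = listDeriv l β u := by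
  induction l with
  | nil => rfl
  | cons j l ih =>
    change (partialDeriv j)^[α j] (listDeriv l α u) = (partialDeriv j)^[β j] (listDeriv l β u)
    rw [ih fun i hi => h i (List.mem_cons_of_mem _ hi), h j List.mem_cons_self]

/-- `multiDeriv` is a fold over the list of directions, so inductions run over arbitrary lists.
Absence of repetitions makes the increment of `α` act exactly once; the extra derivative then
commutes outwards past the other directions. -/
theorem listDeriv_add_single {u : E d → F} (hu : ContDiff ℝ ∞ u) {l : List (Fin d)}
    (hl : l.Nodup) (α : Fin d → ℕ) {i : Fin d} (hi : i ∈ l) :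
    listDeriv l (α + Pi.single i 1) u = partialDeriv i (listDeriv l α u) := by
  induction l with
  | nil => simp at hi
  | cons j l ih =>
    rw [List.nodup_cons] at hl
    change (partialDeriv j)^[(α + Pi.single i 1 : Fin d → ℕ) j]
      (listDeriv l (α + Pi.single i 1) u) = partialDeriv i ((partialDeriv j)^[α j] _)
    by_cases hij : i = j
    · subst hij
      rw [listDeriv_congr_index l (β := α), Pi.add_apply, Pi.single_eq_same,
        Function.iterate_succ_apply']
      · rfl
      intro k hk
      have : k ≠ i := fun h => hl.1 (h ▸ hk)
      simp [this]
    · rw [ih hl.2 ((List.mem_cons.1 hi).resolve_left hij), Pi.add_apply,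
        Pi.single_eq_of_ne (Ne.symm hij), add_zero,
        partialDeriv_iterate_comm (contDiff_listDeriv hu l α)]
      rfl

theorem multiDeriv_add_single {u : E d → F} (hu : ContDiff ℝ ∞ u) (α : Fin d → ℕ) (i : Fin d) :
    multiDeriv (α + Pi.single i 1) u = partialDeriv i (multiDeriv α u) :=
  listDeriv_add_single hu (List.nodup_finRange d) α (List.mem_finRange i)

theorem multiDeriv_partialDeriv {u : E d → F} (hu : ContDiff ℝ ∞ u) (α : Fin d → ℕ)
    (i : Fin d) : multiDeriv α (partialDeriv i u) = multiDeriv (α + Pi.single i 1) u := by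
  rw [multiDeriv_add_single hu]
  exact listDeriv_partialDeriv hu _ α i

theorem listDeriv_zero (l : List (Fin d)) (u : E d → F) : listDeriv l 0 u = u := by
  induction l with
  | nil => rfl
  | cons j l ih => exact ih

theorem multiDeriv_zero (u : E d → F) : multiDeriv 0 u = u := listDeriv_zero _ u

theorem listDeriv_single {l : List (Fin d)} (hl : l.Nodup) {i : Fin d} (hi : i ∈ l)
    (u : E d → F) : listDeriv l (Pi.single i 1) u = partialDeriv i u := by
  induction l with
  | nil => simp at hi
  | cons j l ih =>
    rw [List.nodup_cons] at hl
    change (partialDeriv j)^[(Pi.single i 1 : Fin d → ℕ) j] (listDeriv l (Pi.single i 1) u) = _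
    by_cases hij : i = j
    · subst hij
      rw [listDeriv_congr_index l (β := 0), listDeriv_zero, Pi.single_eq_same,
        Function.iterate_one]
      intro k hk
      have : k ≠ i := fun h => hl.1 (h ▸ hk)
      simp [this]
    · rw [ih hl.2 ((List.mem_cons.1 hi).resolve_left hij), Pi.single_eq_of_ne (Ne.symm hij)]
      rfl

theorem multiDeriv_single (i : Fin d) (u : E d → F) :
    multiDeriv (Pi.single i 1) u = partialDeriv i u :=
  listDeriv_single (List.nodup_finRange d) (List.mem_finRange i) u

theorem order_single (i : Fin d) : order (Pi.single i 1 : Fin d → ℕ) = 1 := by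
  simp [order]

theorem partialDeriv_congr {u w : E d → F} {v : E d} (h : u =ᶠ[𝓝 v] w) (i : Fin d) :
    partialDeriv i u =ᶠ[𝓝 v] partialDeriv i w := by
  filter_upwards [h.fderiv (𝕜 := ℝ)] with z hz
  simp only [partialDeriv, hz]

theorem partialDeriv_iterate_congr {u w : E d → F} {v : E d} (h : u =ᶠ[𝓝 v] w) (i : Fin d)
    (n : ℕ) : (partialDeriv i)^[n] u =ᶠ[𝓝 v] (partialDeriv i)^[n] w := by
  induction n generalizing u w with
  | zero => exact h
  | succ n ih => exact ih (partialDeriv_congr h i)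

theorem multiDeriv_congr {u w : E d → F} {v : E d} (h : u =ᶠ[𝓝 v] w) (α : Fin d → ℕ) :
    multiDeriv α u =ᶠ[𝓝 v] multiDeriv α w := by
  have : ∀ l : List (Fin d), listDeriv l α u =ᶠ[𝓝 v] listDeriv l α w := by
    intro l
    induction l with
    | nil => exact h
    | cons j l ih => exact partialDeriv_iterate_congr ih j _
  exact this _

theorem partialDeriv_sub {u w : E d → F} (hu : ContDiff ℝ ∞ u) (hw : ContDiff ℝ ∞ w)
    (i : Fin d) : partialDeriv i (u - w) = partialDeriv i u - partialDeriv i w := by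
  funext v
  simp only [partialDeriv, Pi.sub_apply]
  rw [fderiv_sub (hu.differentiable (by simp) v) (hw.differentiable (by simp) v)]
  rfl

theorem partialDeriv_iterate_sub {u w : E d → F} (hu : ContDiff ℝ ∞ u) (hw : ContDiff ℝ ∞ w)
    (i : Fin d) (n : ℕ) :
    (partialDeriv i)^[n] (u - w) = (partialDeriv i)^[n] u - (partialDeriv i)^[n] w := by
  induction n generalizing u w with
  | zero => rfl
  | succ n ih =>
    simp only [Function.iterate_succ_apply]
    rw [partialDeriv_sub hu hw, ih (contDiff_partialDeriv hu i) (contDiff_partialDeriv hw i)]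

theorem multiDeriv_sub {u w : E d → F} (hu : ContDiff ℝ ∞ u) (hw : ContDiff ℝ ∞ w)
    (α : Fin d → ℕ) : multiDeriv α (u - w) = multiDeriv α u - multiDeriv α w := by
  have : ∀ l : List (Fin d), listDeriv l α (u - w) = listDeriv l α u - listDeriv l α w := by
    intro l
    induction l with
    | nil => rfl
    | cons j l ih =>
      change (partialDeriv j)^[α j] (listDeriv l α (u - w)) = _
      rw [ih, partialDeriv_iterate_sub (contDiff_listDeriv hu l α) (contDiff_listDeriv hw l α)]
      rfl
  exact this _

theorem tsupport_partialDeriv_subset (u : E d → F) (i : Fin d) :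
    tsupport (partialDeriv i u) ⊆ tsupport u := by
  refine (closure_mono ?_).trans (tsupport_fderiv_subset ℝ (f := u))
  intro v hv h
  apply hv
  simp only [partialDeriv]
  rw [h]
  rfl

theorem tsupport_partialDeriv_iterate_subset (u : E d → F) (i : Fin d) (n : ℕ) :
    tsupport ((partialDeriv i)^[n] u) ⊆ tsupport u := by
  induction n generalizing u with
  | zero => exact subset_rfl
  | succ n ih => exact (ih _).trans (tsupport_partialDeriv_subset u i)

theorem tsupport_listDeriv_subset (l : List (Fin d)) (α : Fin d → ℕ) (u : E d → F) :
    tsupport (listDeriv l α u) ⊆ tsupport u := by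
  induction l with
  | nil => exact subset_rfl
  | cons j l ih => exact (tsupport_partialDeriv_iterate_subset _ j _).trans ih

theorem tsupport_multiDeriv_subset (α : Fin d → ℕ) (u : E d → F) :
    tsupport (multiDeriv α u) ⊆ tsupport u :=
  tsupport_listDeriv_subset _ α u

theorem hasCompactSupport_multiDeriv {u : E d → F} (hu : HasCompactSupport u) (α : Fin d → ℕ) :
    HasCompactSupport (multiDeriv α u) :=
  IsCompact.of_isClosed_subset hu (isClosed_tsupport _) (tsupport_multiDeriv_subset α u)

/-! ### Integration by parts -/

theorem integral_partialDeriv_smul {η : E d → ℝ} {u : E d → F} (hη : ContDiff ℝ ∞ η)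
    (hη' : HasCompactSupport η) (hu : ContDiff ℝ ∞ u) (i : Fin d) :
    ∫ v, partialDeriv i η v • u v = - ∫ v, η v • partialDeriv i u v := by
  have hi : ∀ {a : E d → ℝ} {b : E d → F}, ContDiff ℝ ∞ a → HasCompactSupport a →
      ContDiff ℝ ∞ b → Integrable (fun v => a v • b v) := fun ha ha' hb =>
    (ha.continuous.smul hb.continuous).integrable_of_hasCompactSupport ha'.smul_right
  have hη1 := contDiff_partialDeriv hη i
  have hcs : HasCompactSupport (partialDeriv i η) :=
    IsCompact.of_isClosed_subset hη' (isClosed_tsupport _) (tsupport_partialDeriv_subset η i)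
  have h := integral_bilinear_hasLineDerivAt_right_eq_neg_left_of_integrable
    (μ := (volume : Measure (E d))) (f := η) (f' := partialDeriv i η) (g := u)
    (g' := partialDeriv i u) (v := basisVec i) (B := ContinuousLinearMap.lsmul ℝ ℝ)
    (hi hη1 hcs hu) (hi hη hη' (contDiff_partialDeriv hu i)) (hi hη hη' hu)
    (fun x _ => ((hη.differentiable (by simp) x).hasFDerivAt.hasLineDerivAt _))
    (fun x _ => ((hu.differentiable (by simp) x).hasFDerivAt.hasLineDerivAt _))
  simp only [ContinuousLinearMap.lsmul_apply] at h
  rw [h, neg_neg]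

theorem integral_partialDeriv_iterate_smul {η : E d → ℝ} {u : E d → F} (hη : ContDiff ℝ ∞ η)
    (hη' : HasCompactSupport η) (hu : ContDiff ℝ ∞ u) (i : Fin d) (n : ℕ) :
    ∫ v, (partialDeriv i)^[n] η v • u v
      = (-1 : ℝ) ^ n • ∫ v, η v • (partialDeriv i)^[n] u v := by
  induction n generalizing u with
  | zero => simp
  | succ n ih =>
    have hcs : HasCompactSupport ((partialDeriv i)^[n] η) :=
      IsCompact.of_isClosed_subset hη' (isClosed_tsupport _)
        (tsupport_partialDeriv_iterate_subset η i n)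
    rw [Function.iterate_succ_apply', integral_partialDeriv_smul
      (contDiff_partialDeriv_iterate hη i n) hcs hu, ih (contDiff_partialDeriv hu i),
      pow_succ, mul_neg_one, neg_smul]
    rfl

theorem listDeriv_partialDeriv_iterate {u : E d → F} (hu : ContDiff ℝ ∞ u) (l : List (Fin d))
    (α : Fin d → ℕ) (i : Fin d) (n : ℕ) :
    listDeriv l α ((partialDeriv i)^[n] u) = (partialDeriv i)^[n] (listDeriv l α u) := by
  induction n generalizing u with
  | zero => rfl
  | succ n ih =>
    rw [Function.iterate_succ_apply, ih (contDiff_partialDeriv hu i), listDeriv_partialDeriv hu]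
    rfl

theorem integral_multiDeriv_smul {η : E d → ℝ} {u : E d → F} (hη : ContDiff ℝ ∞ η)
    (hη' : HasCompactSupport η) (hu : ContDiff ℝ ∞ u) (α : Fin d → ℕ) :
    ∫ v, multiDeriv α η v • u v = (-1 : ℝ) ^ order α • ∫ v, η v • multiDeriv α u v := by
  -- The function `u` stays general: each direction of the list moves its derivatives from `η` to
  -- `u`, and the induction hypothesis is applied to the differentiated `u`.
  have key : ∀ (l : List (Fin d)) (u : E d → F), ContDiff ℝ ∞ u →
      ∫ v, listDeriv l α η v • u v
        = (-1 : ℝ) ^ (l.map α).sum • ∫ v, η v • listDeriv l α u v := by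
    intro l
    induction l with
    | nil => intro u _; simp [listDeriv]
    | cons j l ih =>
      intro u hu
      have hcs : HasCompactSupport (listDeriv l α η) :=
        IsCompact.of_isClosed_subset hη' (isClosed_tsupport _) (tsupport_listDeriv_subset l α η)
      have h1 := integral_partialDeriv_iterate_smul (contDiff_listDeriv hη l α) hcs hu j (α j)
      change ∫ v, (partialDeriv j)^[α j] (listDeriv l α η) v • u v = _
      rw [h1, ih _ (contDiff_partialDeriv_iterate hu j _), listDeriv_partialDeriv_iterate hu,
        smul_smul, List.map_cons, List.sum_cons, pow_add]
      rfl
  have := key (List.finRange d) u hu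
  rw [← List.ofFn_eq_map, List.sum_ofFn] at this
  exact this

end PartialDerivatives

/-! ### Elementary inequalities for squares in `ℝ≥0∞` -/

section Auxiliary

theorem ennreal_sq_sum_le {ι : Type*} (s : Finset ι) (f : ι → ℝ≥0∞) :
    (∑ i ∈ s, f i) ^ 2 ≤ s.card * ∑ i ∈ s, f i ^ 2 := by
  have h := ENNReal.rpow_sum_le_const_mul_sum_rpow s f (p := 2) (by norm_num)
  norm_num at h
  exact_mod_cast h

theorem ennreal_add_sq_le (a b : ℝ≥0∞) : (a + b) ^ 2 ≤ 2 * (a ^ 2 + b ^ 2) := by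
  simpa using ennreal_sq_sum_le Finset.univ ![a, b]

theorem lintegral_sq_le {α : Type*} [MeasurableSpace α] (μ : Measure α) [IsProbabilityMeasure μ]
    {f : α → ℝ≥0∞} (hf : AEMeasurable f μ) : (∫⁻ a, f a ∂μ) ^ 2 ≤ ∫⁻ a, f a ^ 2 ∂μ := by
  have h := ENNReal.lintegral_mul_le_Lp_mul_Lq μ Real.HolderConjugate.two_two hf
    (aemeasurable_const (b := (1 : ℝ≥0∞)))
  simp only [Pi.mul_apply, mul_one, ENNReal.one_rpow, lintegral_const, measure_univ] at h
  calc (∫⁻ a, f a ∂μ) ^ 2 ≤ ((∫⁻ a, f a ^ (2 : ℝ) ∂μ) ^ (1 / 2 : ℝ)) ^ 2 := by gcongr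
    _ = ∫⁻ a, f a ^ 2 ∂μ := by
      rw [← ENNReal.rpow_natCast, ← ENNReal.rpow_mul]
      norm_num

theorem enorm_sq_le_of_norm_sq_le {F : Type*} [NormedAddCommGroup F] {x : F} {a : ℝ}
    (h : ‖x‖ ^ 2 ≤ a) : ‖x‖ₑ ^ 2 ≤ ENNReal.ofReal a := by
  rw [← ofReal_norm, ← ENNReal.ofReal_pow (norm_nonneg _)]
  exact ENNReal.ofReal_le_ofReal h

theorem enorm_sq_eq_ofReal {F : Type*} [NormedAddCommGroup F] (x : F) :
    ‖x‖ₑ ^ 2 = ENNReal.ofReal (‖x‖ ^ 2) := by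
  rw [← ofReal_norm, ← ENNReal.ofReal_pow (norm_nonneg _)]

end Auxiliary

/-! ### Taylor's formula about a moving point -/

section Taylor

variable {d : ℕ} {F : Type*} [NormedAddCommGroup F] [NormedSpace ℝ F]

/-- The directional derivative `D_w u`. -/
noncomputable def dirDeriv (w : E d) (u : E d → F) : E d → F := fun z => fderiv ℝ u z w

/-- The sum of the `‖∂^α u‖²` over the multi-indices of order `j`. -/
noncomputable def sqSum (j : ℕ) (u : E d → F) (z : E d) : ℝ :=
  ∑ α ∈ Finset.piAntidiag (Finset.univ : Finset (Fin d)) j, ‖multiDeriv α u z‖ ^ 2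

theorem sum_smul_basisVec (w : E d) : ∑ i, w i • basisVec i = w := by
  have := (EuclideanSpace.basisFun (Fin d) ℝ).sum_repr w
  simpa [basisVec] using this

theorem dirDeriv_eq_sum (w : E d) (u : E d → F) (z : E d) :
    dirDeriv w u z = ∑ i, w i • partialDeriv i u z := by
  conv_lhs => rw [dirDeriv, ← sum_smul_basisVec w]
  simp [partialDeriv]

theorem contDiff_dirDeriv {u : E d → F} (hu : ContDiff ℝ ∞ u) (w : E d) :
    ContDiff ℝ ∞ (dirDeriv w u) :=
  (hu.fderiv_right (m := ∞) le_rfl).clm_apply contDiff_const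

theorem contDiff_dirDeriv_iterate {u : E d → F} (hu : ContDiff ℝ ∞ u) (w : E d) (n : ℕ) :
    ContDiff ℝ ∞ ((dirDeriv w)^[n] u) := by
  induction n generalizing u with
  | zero => exact hu
  | succ n ih => exact ih (contDiff_dirDeriv hu w)

theorem dirDeriv_partialDeriv_comm {u : E d → F} (hu : ContDiff ℝ ∞ u) (w : E d) (i : Fin d) :
    dirDeriv w (partialDeriv i u) = partialDeriv i (dirDeriv w u) := by
  have hd : Differentiable ℝ (fderiv ℝ u) :=
    (hu.fderiv_right (m := ∞) le_rfl).differentiable (by simp)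
  have key : ∀ (a b v : E d), dirDeriv a (dirDeriv b u) v
      = fderiv ℝ (fderiv ℝ u) v a b := by
    intro a b v
    have := ((hd v).hasFDerivAt.clm_apply (hasFDerivAt_const b v)).fderiv
    change fderiv ℝ (fun y => fderiv ℝ u y b) v a = _
    rw [this]
    simp
  funext v
  change dirDeriv w (dirDeriv (basisVec i) u) v = dirDeriv (basisVec i) (dirDeriv w u) v
  rw [key, key]
  exact (hu.contDiffAt.isSymmSndFDerivAt (by simp; exact WithTop.coe_le_coe.2 le_top)) _ _

theorem dirDeriv_iterate_partialDeriv {u : E d → F} (hu : ContDiff ℝ ∞ u) (w : E d) (i : Fin d)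
    (n : ℕ) : (dirDeriv w)^[n] (partialDeriv i u) = partialDeriv i ((dirDeriv w)^[n] u) := by
  induction n generalizing u with
  | zero => rfl
  | succ n ih =>
    rw [Function.iterate_succ_apply, Function.iterate_succ_apply, ← ih (contDiff_dirDeriv hu w),
      dirDeriv_partialDeriv_comm hu]

theorem sqSum_nonneg (j : ℕ) (u : E d → F) (z : E d) : 0 ≤ sqSum j u z :=
  Finset.sum_nonneg fun _ _ => by positivity

/-- Raising the `i`-th entry of a multi-index by one is injective, so the left side is a sub-sum of
the right side. -/
theorem sqSum_partialDeriv_le {u : E d → F} (hu : ContDiff ℝ ∞ u) (j : ℕ) (i : Fin d)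
    (z : E d) : sqSum j (partialDeriv i u) z ≤ sqSum (j + 1) u z := by
  classical
  unfold sqSum
  calc ∑ α ∈ Finset.piAntidiag Finset.univ j, ‖multiDeriv α (partialDeriv i u) z‖ ^ 2
      = ∑ α ∈ Finset.piAntidiag Finset.univ j, ‖multiDeriv (α + Pi.single i 1) u z‖ ^ 2 :=
        Finset.sum_congr rfl fun α _ => by rw [multiDeriv_partialDeriv hu]
    _ = ∑ β ∈ (Finset.piAntidiag Finset.univ j).image (fun α : Fin d → ℕ => α + Pi.single i 1),
          ‖multiDeriv β u z‖ ^ 2 := by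
        rw [Finset.sum_image]
        intro a _ b _ h
        exact add_right_cancel h
    _ ≤ _ := by
        refine Finset.sum_le_sum_of_subset_of_nonneg ?_ fun _ _ _ => by positivity
        intro β hβ
        obtain ⟨α, hα, rfl⟩ := Finset.mem_image.1 hβ
        simp only [Finset.mem_piAntidiag] at hα ⊢
        refine ⟨?_, by simp⟩
        simp [Finset.sum_add_distrib, hα.1]

/-- By Cauchy–Schwarz over the coordinates of `w`, each directional derivative costs a factor ‖w‖².
Bounding each of the `d` partial derivatives by the full sum of the next order costs the factor `d`.
-/
theorem norm_dirDeriv_iterate_sq_le {u : E d → F} (hu : ContDiff ℝ ∞ u) (w : E d) (j : ℕ)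
    (z : E d) : ‖(dirDeriv w)^[j] u z‖ ^ 2 ≤ (d : ℝ) ^ j * ‖w‖ ^ (2 * j) * sqSum j u z := by
  induction j generalizing u with
  | zero => simp [sqSum, multiDeriv_zero]
  | succ j ih =>
    rw [Function.iterate_succ_apply', dirDeriv_eq_sum]
    calc ‖∑ i, w i • partialDeriv i ((dirDeriv w)^[j] u) z‖ ^ 2
        ≤ (∑ i, |w i| * ‖(dirDeriv w)^[j] (partialDeriv i u) z‖) ^ 2 := by
          gcongr
          refine (norm_sum_le _ _).trans (Finset.sum_le_sum fun i _ => ?_)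
          rw [norm_smul, dirDeriv_iterate_partialDeriv hu, Real.norm_eq_abs]
      _ ≤ (∑ i, |w i| ^ 2) * ∑ i, ‖(dirDeriv w)^[j] (partialDeriv i u) z‖ ^ 2 :=
          Finset.sum_mul_sq_le_sq_mul_sq _ _ _
      _ ≤ ‖w‖ ^ 2 * ∑ _i : Fin d, (d : ℝ) ^ j * ‖w‖ ^ (2 * j) * sqSum (j + 1) u z := by
          rw [EuclideanSpace.norm_sq_eq]
          simp only [Real.norm_eq_abs]
          gcongr with i
          refine (ih (contDiff_partialDeriv hu i)).trans ?_
          gcongr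
          exact sqSum_partialDeriv_le hu j i z
      _ = _ := by
          simp only [Finset.sum_const, Finset.card_univ, Fintype.card_fin, nsmul_eq_mul]
          ring

theorem hasDerivAt_dirDeriv_iterate {u : E d → F} (hu : ContDiff ℝ ∞ u) (x w : E d) (j : ℕ)
    (t : ℝ) : HasDerivAt (fun t : ℝ => (dirDeriv w)^[j] u (x + t ^ 2 • w))
      ((2 * t) • (dirDeriv w)^[j + 1] u (x + t ^ 2 • w)) t := by
  have h1 : HasDerivAt (fun t : ℝ => x + t ^ 2 • w) ((2 * t) • w) t := by
    have := ((hasDerivAt_pow 2 t).smul_const w).const_add x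
    simpa using this
  have h2 := (((contDiff_dirDeriv_iterate hu w j).differentiable (by simp)
    (x + t ^ 2 • w)).hasFDerivAt).comp_hasDerivAt t h1
  rw [Function.iterate_succ_apply']
  refine HasDerivAt.congr_deriv (f := fun t : ℝ => (dirDeriv w)^[j] u (x + t ^ 2 • w)) h2 ?_
  simp [dirDeriv]

/-- Taylor's polynomial at the moving point `x + t² w`, evaluated at `x`. -/
noncomputable def taylorCurve (u : E d → F) (x w : E d) (m : ℕ) (t : ℝ) : F :=
  ∑ j ∈ Finset.range m,
    ((-1 : ℝ) ^ j / (j.factorial : ℝ) * t ^ (2 * j)) • (dirDeriv w)^[j] u (x + t ^ 2 • w)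

/-- The sum telescopes. Differentiating the power in the summand of index j cancels the derivative
of the curve in the summand of index j - 1, so only the derivative of order `n + 1` from the last
summand survives. -/
theorem hasDerivAt_taylorCurve {u : E d → F} (hu : ContDiff ℝ ∞ u) (x w : E d) (n : ℕ) (t : ℝ) :
    HasDerivAt (taylorCurve u x w (n + 1))
      (((-1 : ℝ) ^ n / (n.factorial : ℝ) * (2 * t ^ (2 * n + 1))) •
        (dirDeriv w)^[n + 1] u (x + t ^ 2 • w)) t := by
  induction n with
  | zero =>
    have := hasDerivAt_dirDeriv_iterate hu x w 0 t
    have h : taylorCurve u x w (0 + 1) = fun t : ℝ => u (x + t ^ 2 • w) := by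
      funext s
      simp [taylorCurve]
    rw [h]
    simpa using this
  | succ n ih =>
    have h1 : HasDerivAt (fun t : ℝ => ((-1 : ℝ) ^ (n + 1) / ((n + 1).factorial : ℝ) *
        t ^ (2 * (n + 1)))) ((-1 : ℝ) ^ (n + 1) / ((n + 1).factorial : ℝ) *
          ((2 * (n + 1) : ℕ) * t ^ (2 * (n + 1) - 1))) t :=
      (hasDerivAt_pow _ t).const_mul _
    have h2 := ih.add (h1.smul (hasDerivAt_dirDeriv_iterate hu x w (n + 1) t))
    have h3 : taylorCurve u x w (n + 1 + 1) = taylorCurve u x w (n + 1) + fun t : ℝ =>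
        ((-1 : ℝ) ^ (n + 1) / ((n + 1).factorial : ℝ) * t ^ (2 * (n + 1))) •
          (dirDeriv w)^[n + 1] u (x + t ^ 2 • w) := by
      funext s
      simp only [taylorCurve, Pi.add_apply]
      rw [Finset.sum_range_succ]
    rw [h3]
    refine h2.congr_deriv ?_
    have h4 : (2 * (n + 1) : ℕ) - 1 = 2 * n + 1 := by omega
    have h5 : ((-1 : ℝ) ^ (n + 1) / ((n + 1).factorial : ℝ) *
          ((2 * (n + 1) : ℕ) * t ^ (2 * (n + 1) - 1)))
        = -((-1 : ℝ) ^ n / (n.factorial : ℝ) * (2 * t ^ (2 * n + 1))) := by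
      rw [h4, Nat.factorial_succ]
      push_cast
      field_simp
      ring
    rw [h5, smul_smul, neg_smul]
    have h6 : (-1 : ℝ) ^ (n + 1) / ((n + 1).factorial : ℝ) * t ^ (2 * (n + 1)) * (2 * t)
        = (-1 : ℝ) ^ (n + 1) / ((n + 1).factorial : ℝ) * (2 * t ^ (2 * (n + 1) + 1)) := by ring
    rw [h6]
    abel

/-- This is the fundamental theorem of calculus for `taylorCurve` on [0, 1]: at 0 the curve equals
`u x`, at 1 it is Taylor's polynomial about `y`. The coefficients ±1/j! have absolute value at most
1 and are dropped. -/
theorem enorm_sub_le_taylor [CompleteSpace F] {u : E d → F} (hu : ContDiff ℝ ∞ u) (x y : E d)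
    (n : ℕ) : ‖u x - u y‖ₑ ≤ ∑ j ∈ Finset.Icc 1 n, ‖(dirDeriv (y - x))^[j] u y‖ₑ +
      ∫⁻ t in Ioc (0 : ℝ) 1, ENNReal.ofReal (2 * t ^ (2 * n + 1)) *
        ‖(dirDeriv (y - x))^[n + 1] u (x + t ^ 2 • (y - x))‖ₑ := by
  set w := y - x with hw
  have hc : Continuous fun t : ℝ => ((-1 : ℝ) ^ n / (n.factorial : ℝ) * (2 * t ^ (2 * n + 1))) •
        (dirDeriv w)^[n + 1] u (x + t ^ 2 • w) := by
    have := (contDiff_dirDeriv_iterate hu w (n + 1)).continuous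
    fun_prop
  have hftc := intervalIntegral.integral_eq_sub_of_hasDerivAt
    (fun t _ => hasDerivAt_taylorCurve hu x w n t) (hc.intervalIntegrable 0 1)
  have h0 : taylorCurve u x w (n + 1) 0 = u x := by
    rw [taylorCurve, Finset.sum_range_succ']
    simp
  have hxw : x + w = y := by rw [hw]; abel
  have h1 : taylorCurve u x w (n + 1) 1 = u y + ∑ j ∈ Finset.Icc 1 n,
      ((-1 : ℝ) ^ j / (j.factorial : ℝ)) • (dirDeriv w)^[j] u y := by
    rw [taylorCurve, Finset.sum_range_succ', add_comm, ← Finset.Ico_add_one_right_eq_Icc,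
      Finset.sum_Ico_eq_sum_range]
    simp [hxw, add_comm]
  have hfac : ∀ j : ℕ, ‖((-1 : ℝ) ^ j / (j.factorial : ℝ))‖ ≤ 1 := by
    intro j
    rw [norm_div, norm_pow, norm_neg, norm_one, one_pow]
    have : (1 : ℝ) ≤ j.factorial := by exact_mod_cast j.factorial_pos
    rw [Real.norm_of_nonneg (by positivity)]
    exact div_le_one_of_le₀ this (by positivity)
  have hfac' : ∀ j : ℕ, ‖((-1 : ℝ) ^ j / (j.factorial : ℝ))‖ₑ ≤ 1 := by
    intro j
    rw [← ofReal_norm]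
    exact ENNReal.ofReal_le_one.2 (hfac j)
  have hmain : u x - u y = ∑ j ∈ Finset.Icc 1 n,
      ((-1 : ℝ) ^ j / (j.factorial : ℝ)) • (dirDeriv w)^[j] u y -
      ∫ t in (0 : ℝ)..1, ((-1 : ℝ) ^ n / (n.factorial : ℝ) * (2 * t ^ (2 * n + 1))) •
        (dirDeriv w)^[n + 1] u (x + t ^ 2 • w) := by
    rw [hftc, h0, h1]
    abel
  rw [hmain]
  refine (enorm_sub_le).trans (add_le_add ?_ ?_)
  · refine (enorm_sum_le _ _).trans (Finset.sum_le_sum fun j _ => ?_)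
    rw [enorm_smul]
    exact mul_le_of_le_one_left' (hfac' j)
  · rw [intervalIntegral.integral_of_le zero_le_one]
    refine (enorm_integral_le_lintegral_enorm _).trans ?_
    refine setLIntegral_mono' measurableSet_Ioc fun t ht => ?_
    rw [enorm_smul, enorm_mul]
    gcongr
    rw [← Real.enorm_of_nonneg (by have := ht.1; positivity)]
    exact mul_le_of_le_one_left' (hfac' n)

end Taylor

/-! ### Oscillation of smooth functions on Euclidean balls -/

section Oscillation

variable {d : ℕ} {F : Type*} [NormedAddCommGroup F] [NormedSpace ℝ F]

/-- For 0 < s ≤ 1 the homothety of ratio `s` centred at a point of the ball maps the ball into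
itself by convexity, and it scales volume by s^d. -/
theorem setLIntegral_ball_comp_homothety_le {g : E d → ℝ≥0∞} (hg : Measurable g) {v₀ x : E d}
    {ρ s : ℝ} (hx : x ∈ ball v₀ ρ) (hs : 0 < s) (hs1 : s ≤ 1) :
    ENNReal.ofReal (s ^ d) * ∫⁻ y in ball v₀ ρ, g (x + s • (y - x))
      ≤ ∫⁻ z in ball v₀ ρ, g z := by
  set h : E d → ℝ≥0∞ := (ball v₀ ρ).indicator g with hh
  have hmeas : Measurable h := hg.indicator measurableSet_ball
  have h1 : ∫⁻ y in ball v₀ ρ, g (x + s • (y - x)) ≤ ∫⁻ y, h (x + s • (y - x)) := by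
    rw [← lintegral_indicator measurableSet_ball]
    refine lintegral_mono fun y => ?_
    by_cases hy : y ∈ ball v₀ ρ
    swap
    · simp [hy]
    rw [Set.indicator_of_mem hy, hh, Set.indicator_of_mem]
    exact (convex_ball v₀ ρ).add_smul_sub_mem hx hy ⟨hs.le, hs1⟩
  have h2 : ∫⁻ y, h (x + s • (y - x)) = ∫⁻ y, h (s • y) := by
    rw [lintegral_sub_right_eq_self (fun y => h (x + s • y)) x]
    have := lintegral_add_left_eq_self (μ := (volume : Measure (E d)))
      (fun y => h (s • y)) (s⁻¹ • x)
    rw [← this]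
    refine lintegral_congr fun y => ?_
    rw [smul_add, smul_inv_smul₀ hs.ne']
  have h3 : ∫⁻ y, h (s • y) = ENNReal.ofReal ((s ^ d)⁻¹) * ∫⁻ z, h z := by
    have := Measure.map_addHaar_smul (volume : Measure (E d)) hs.ne'
    rw [finrank_euclideanSpace_fin, abs_of_pos (by positivity)] at this
    rw [← lintegral_map (f := h) (g := fun y => s • y) hmeas (measurable_const_smul s), this,
      lintegral_smul_measure, smul_eq_mul]
  calc ENNReal.ofReal (s ^ d) * ∫⁻ y in ball v₀ ρ, g (x + s • (y - x))
      ≤ ENNReal.ofReal (s ^ d) * (ENNReal.ofReal ((s ^ d)⁻¹) * ∫⁻ z, h z) := by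
        gcongr
        exact h1.trans (h2.trans h3).le
    _ = ∫⁻ z in ball v₀ ρ, g z := by
        rw [← mul_assoc, ← ENNReal.ofReal_mul (by positivity),
          mul_inv_cancel₀ (by positivity), ENNReal.ofReal_one, one_mul, hh,
          lintegral_indicator measurableSet_ball]

theorem continuous_sqSum {u : E d → F} (hu : ContDiff ℝ ∞ u) (j : ℕ) :
    Continuous (sqSum j u) :=
  continuous_finsetSum _ fun α _ => ((contDiff_multiDeriv hu α).continuous.norm).pow 2

/-- The bound ‖w‖ ≤ 2ρ turns d^j ‖w‖^{2j} into (4d)^j ρ^{2j}. The base is enlarged to 4d + 1, which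
is at least 1, so that one exponent `N` serves all orders j. -/
theorem enorm_dirDeriv_iterate_sq_le {u : E d → F} (hu : ContDiff ℝ ∞ u) {w : E d} {ρ : ℝ}
    (hw : ‖w‖ ≤ 2 * ρ) {j N : ℕ} (hj : j ≤ N) (z : E d) :
    ‖(dirDeriv w)^[j] u z‖ₑ ^ 2 ≤
      ENNReal.ofReal ((4 * d + 1) ^ N) * ENNReal.ofReal (ρ ^ (2 * j)) *
        ENNReal.ofReal (sqSum j u z) := by
  have hρ : 0 ≤ ρ := by linarith [norm_nonneg w]
  rw [← ENNReal.ofReal_mul (by positivity), ← ENNReal.ofReal_mul (by positivity)]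
  refine enorm_sq_le_of_norm_sq_le ((norm_dirDeriv_iterate_sq_le hu w j z).trans ?_)
  refine mul_le_mul_of_nonneg_right ?_ (sqSum_nonneg j u z)
  calc (d : ℝ) ^ j * ‖w‖ ^ (2 * j) ≤ (d : ℝ) ^ j * (2 * ρ) ^ (2 * j) := by gcongr
    _ = (4 * d) ^ j * ρ ^ (2 * j) := by
      rw [mul_pow, pow_mul, pow_mul, mul_pow]; norm_num; ring
    _ ≤ (4 * d + 1) ^ j * ρ ^ (2 * j) := by gcongr; linarith
    _ ≤ (4 * d + 1) ^ N * ρ ^ (2 * j) := by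
      gcongr
      linarith [(Nat.cast_nonneg d : (0 : ℝ) ≤ d)]

/-- The heart of the Euclidean estimate. Cauchy–Schwarz in t and Fubini leave, for each t, an
integral over y along the homothety of ratio t². Undoing it costs t^{-2d}, while the squared weight
is 4 t^{4n+2}, and 2d ≤ 4n + 2 is precisely d < 2(n + 1). With the parameter s = t² the same
argument would meet s^{2n - d}, which is not integrable when d = 2n + 1; this is the reason for the
quadratic parametrisation. -/
theorem lintegral_taylor_remainder_le {u : E d → F} (hu : ContDiff ℝ ∞ u) {n : ℕ}
    (hn : d < 2 * (n + 1)) {v₀ x : E d} {ρ : ℝ} (hx : x ∈ ball v₀ ρ) :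
    ∫⁻ y in ball v₀ ρ, (∫⁻ t in Ioc (0 : ℝ) 1, ENNReal.ofReal (2 * t ^ (2 * n + 1)) *
        ‖(dirDeriv (y - x))^[n + 1] u (x + t ^ 2 • (y - x))‖ₑ) ^ 2
      ≤ 4 * ENNReal.ofReal ((4 * d + 1) ^ (n + 1)) * (ENNReal.ofReal (ρ ^ (2 * (n + 1))) *
        ∫⁻ z in ball v₀ ρ, ENNReal.ofReal (sqSum (n + 1) u z)) := by
  set c := ENNReal.ofReal ((4 * d + 1) ^ (n + 1)) with hc
  set r := ENNReal.ofReal (ρ ^ (2 * (n + 1))) with hr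
  have hG : Continuous (sqSum (n + 1) u) := continuous_sqSum hu _
  have : IsProbabilityMeasure (volume.restrict (Ioc (0 : ℝ) 1)) := ⟨by simp⟩
  calc _ ≤ ∫⁻ y in ball v₀ ρ, ∫⁻ t in Ioc (0 : ℝ) 1,
          ENNReal.ofReal (4 * t ^ (4 * n + 2)) * (c * r *
            ENNReal.ofReal (sqSum (n + 1) u (x + t ^ 2 • (y - x)))) := by
        refine setLIntegral_mono' measurableSet_ball fun y hy => ?_
        have hyx : ‖y - x‖ ≤ 2 * ρ := by
          rw [← dist_eq_norm]
          have h1 := mem_ball.1 hy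
          have h2 := mem_ball'.1 hx
          linarith [dist_triangle y v₀ x]
        refine (lintegral_sq_le _ ?_).trans ?_
        · have hcont := (contDiff_dirDeriv_iterate hu (y - x) (n + 1)).continuous
          have h1 : Measurable fun t : ℝ => ENNReal.ofReal (2 * t ^ (2 * n + 1)) := by fun_prop
          have h2 : Continuous fun t : ℝ =>
            (dirDeriv (y - x))^[n + 1] u (x + t ^ 2 • (y - x)) := by fun_prop
          exact (h1.mul h2.enorm.measurable).aemeasurable
        · refine setLIntegral_mono' measurableSet_Ioc fun t ht => ?_
          rw [mul_pow, ← ENNReal.ofReal_pow (by have := ht.1; positivity)]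
          refine mul_le_mul' (le_of_eq ?_) (enorm_dirDeriv_iterate_sq_le hu hyx le_rfl _)
          congr 1
          ring
    _ = ∫⁻ t in Ioc (0 : ℝ) 1, ∫⁻ y in ball v₀ ρ,
          ENNReal.ofReal (4 * t ^ (4 * n + 2)) * (c * r *
            ENNReal.ofReal (sqSum (n + 1) u (x + t ^ 2 • (y - x)))) := by
        refine lintegral_lintegral_swap (Measurable.aemeasurable ?_)
        have h1 : Measurable fun p : E d × ℝ => ENNReal.ofReal (4 * p.2 ^ (4 * n + 2)) := by
          fun_prop
        refine h1.mul (Measurable.const_mul ?_ _)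
        exact (Continuous.measurable (by fun_prop : Continuous fun p : E d × ℝ =>
          sqSum (n + 1) u (x + p.2 ^ 2 • (p.1 - x)))).ennreal_ofReal
    _ ≤ ∫⁻ t in Ioc (0 : ℝ) 1, 4 * c * (r *
          ∫⁻ z in ball v₀ ρ, ENNReal.ofReal (sqSum (n + 1) u z)) := by
        refine setLIntegral_mono' measurableSet_Ioc fun t ht => ?_
        have ht0 := ht.1
        rw [lintegral_const_mul' _ _ ENNReal.ofReal_ne_top, lintegral_const_mul' _ _
          (ENNReal.mul_ne_top ENNReal.ofReal_ne_top ENNReal.ofReal_ne_top)]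
        have hh := setLIntegral_ball_comp_homothety_le
          (g := fun z => ENNReal.ofReal (sqSum (n + 1) u z)) hG.measurable.ennreal_ofReal hx
          (pow_pos ht0 2) (pow_le_one₀ ht0.le ht.2)
        calc _ = 4 * c * r * (ENNReal.ofReal (t ^ (4 * n + 2)) *
              ∫⁻ y in ball v₀ ρ, ENNReal.ofReal (sqSum (n + 1) u (x + t ^ 2 • (y - x)))) := by
              rw [ENNReal.ofReal_mul (by norm_num)]
              norm_num
              ring
          _ ≤ 4 * c * r * (ENNReal.ofReal ((t ^ 2) ^ d) *
              ∫⁻ y in ball v₀ ρ, ENNReal.ofReal (sqSum (n + 1) u (x + t ^ 2 • (y - x)))) := by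
              gcongr
              rw [← pow_mul]
              exact pow_le_pow_of_le_one ht0.le ht.2 (by omega)
          _ ≤ 4 * c * r * ∫⁻ z in ball v₀ ρ, ENNReal.ofReal (sqSum (n + 1) u z) := by
              gcongr
          _ = _ := by ring
    _ = _ := by simp

/-- In the constant, the factor 2 comes from separating polynomial and remainder, n from squaring a
sum of n terms, and 4 from the remainder. -/
theorem lintegral_enorm_sub_sq_le [CompleteSpace F] {u : E d → F} (hu : ContDiff ℝ ∞ u) {n : ℕ}
    (hn : d < 2 * (n + 1)) {v₀ x : E d} {ρ : ℝ} (hx : x ∈ ball v₀ ρ) :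
    ∫⁻ y in ball v₀ ρ, ‖u x - u y‖ₑ ^ 2 ≤
      2 * (n + 4) * ENNReal.ofReal ((4 * d + 1) ^ (n + 1)) *
        ∑ j ∈ Finset.Icc 1 (n + 1), ENNReal.ofReal (ρ ^ (2 * j)) *
          ∫⁻ z in ball v₀ ρ, ENNReal.ofReal (sqSum j u z) := by
  set c := ENNReal.ofReal ((4 * d + 1) ^ (n + 1)) with hc
  set S : ℕ → ℝ≥0∞ := fun j => ENNReal.ofReal (ρ ^ (2 * j)) *
          ∫⁻ z in ball v₀ ρ, ENNReal.ofReal (sqSum j u z) with hS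
  have hmS : ∀ j, Measurable fun y => ENNReal.ofReal (sqSum j u y) := fun j =>
    (continuous_sqSum hu j).measurable.ennreal_ofReal
  have hsum : ∑ j ∈ Finset.Icc 1 (n + 1), S j = ∑ j ∈ Finset.Icc 1 n, S j + S (n + 1) := by
    rw [Finset.sum_Icc_succ_top (by omega)]
  have hpt : ∀ y ∈ ball v₀ ρ, ‖u x - u y‖ₑ ^ 2 ≤
      2 * (n * ∑ j ∈ Finset.Icc 1 n, c * ENNReal.ofReal (ρ ^ (2 * j)) *
          ENNReal.ofReal (sqSum j u y)) +
        2 * (∫⁻ t in Ioc (0 : ℝ) 1, ENNReal.ofReal (2 * t ^ (2 * n + 1)) *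
        ‖(dirDeriv (y - x))^[n + 1] u (x + t ^ 2 • (y - x))‖ₑ) ^ 2 := by
    intro y hy
    have hyx : ‖y - x‖ ≤ 2 * ρ := by
      rw [← dist_eq_norm]
      have h1 := mem_ball.1 hy
      have h2 := mem_ball'.1 hx
      linarith [dist_triangle y v₀ x]
    refine (pow_le_pow_left' (enorm_sub_le_taylor hu x y n) 2).trans ?_
    refine (ennreal_add_sq_le _ _).trans ?_
    rw [mul_add]
    gcongr
    refine (ennreal_sq_sum_le _ _).trans ?_
    rw [Nat.card_Icc, Nat.add_sub_cancel]
    gcongr with j hj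
    exact enorm_dirDeriv_iterate_sq_le hu hyx (by have := (Finset.mem_Icc.1 hj).2; omega) y
  have hmsum : Measurable fun y => 2 * ((n : ℝ≥0∞) * ∑ j ∈ Finset.Icc 1 n,
      c * ENNReal.ofReal (ρ ^ (2 * j)) * ENNReal.ofReal (sqSum j u y)) :=
    Measurable.const_mul (Measurable.const_mul
      (Finset.measurable_fun_sum _ fun j _ => (hmS j).const_mul _) _) _
  calc ∫⁻ y in ball v₀ ρ, ‖u x - u y‖ₑ ^ 2
      ≤ _ := setLIntegral_mono' measurableSet_ball hpt
    _ = 2 * (n * ∑ j ∈ Finset.Icc 1 n, c * S j) +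
        2 * ∫⁻ y in ball v₀ ρ, (∫⁻ t in Ioc (0 : ℝ) 1, ENNReal.ofReal (2 * t ^ (2 * n + 1)) *
        ‖(dirDeriv (y - x))^[n + 1] u (x + t ^ 2 • (y - x))‖ₑ) ^ 2 := by
        rw [lintegral_add_left hmsum, lintegral_const_mul' _ _ (by norm_num),
          lintegral_const_mul' _ _ (by norm_num), lintegral_const_mul' _ _ (by simp),
          lintegral_finsetSum' _ fun j _ => ((hmS j).const_mul _).aemeasurable]
        congr 3
        refine Finset.sum_congr rfl fun j _ => ?_
        rw [lintegral_const_mul _ (hmS j), mul_assoc]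
    _ ≤ 2 * (n * ∑ j ∈ Finset.Icc 1 n, c * S j) + 2 * (4 * c * S (n + 1)) := by
        gcongr
        exact lintegral_taylor_remainder_le hu hn hx
    _ ≤ 2 * ((n + 4) * ∑ j ∈ Finset.Icc 1 n, c * S j) + 2 * ((n + 4) * c * S (n + 1)) := by
        gcongr
        · exact le_self_add
        · exact le_add_self
    _ = _ := by
        rw [hsum, ← Finset.mul_sum]
        ring

theorem sum_multiIndices (m : ℕ) (f : (Fin d → ℕ) → ℝ≥0∞) :
    ∑ α ∈ multiIndices d m, f α
      = ∑ j ∈ Finset.Icc 1 m, ∑ α ∈ Finset.piAntidiag Finset.univ j, f α := by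
  rw [multiIndices, Finset.sum_biUnion]
  intro a _ b _ hab
  simp only [Function.onFun]
  rw [Finset.disjoint_left]
  intro α h1 h2
  simp only [Finset.mem_piAntidiag] at h1 h2
  exact hab (h1.1.symm.trans h2.1)

/-- A scale invariant Sobolev inequality for the oscillation on a ball. -/
theorem exists_oscillation_bound [CompleteSpace F] {m : ℕ} (hm : d < 2 * m) :
    ∃ K : ℝ≥0∞, K ≠ ⊤ ∧ ∀ u : E d → F, ContDiff ℝ ∞ u → ∀ (v₀ : E d) (ρ : ℝ), 0 < ρ →
      ∀ x ∈ ball v₀ ρ, ∀ x' ∈ ball v₀ ρ,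
        ENNReal.ofReal (ρ ^ d) * ‖u x - u x'‖ₑ ^ 2 ≤ K * ∑ α ∈ multiIndices d m,
          ENNReal.ofReal (ρ ^ (2 * order α)) * ∫⁻ z in ball v₀ ρ, ‖multiDeriv α u z‖ₑ ^ 2 := by
  obtain ⟨n, rfl⟩ : ∃ n, m = n + 1 := ⟨m - 1, by omega⟩
  set c : ℝ≥0∞ := 2 * (n + 4) * ENNReal.ofReal ((4 * d + 1) ^ (n + 1)) with hc
  have hctop : c ≠ ⊤ := by
    refine ENNReal.mul_ne_top (ENNReal.mul_ne_top (by norm_num) ?_) ENNReal.ofReal_ne_top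
    exact ENNReal.add_ne_top.2 ⟨ENNReal.natCast_ne_top n, by norm_num⟩
  set b : ℝ≥0∞ := volume (ball (0 : E d) 1) with hb
  have hb0 : b ≠ 0 := (measure_ball_pos _ _ one_pos).ne'
  have hbtop : b ≠ ⊤ := measure_ball_lt_top.ne
  refine ⟨b⁻¹ * (4 * c), ENNReal.mul_ne_top (ENNReal.inv_ne_top.2 hb0)
    (ENNReal.mul_ne_top (by norm_num) hctop), ?_⟩
  intro u hu v₀ ρ hρ x hx x' hx'
  have hS : ∑ j ∈ Finset.Icc 1 (n + 1), ENNReal.ofReal (ρ ^ (2 * j)) *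
          ∫⁻ z in ball v₀ ρ, ENNReal.ofReal (sqSum j u z)
      = ∑ α ∈ multiIndices d (n + 1),
          ENNReal.ofReal (ρ ^ (2 * order α)) * ∫⁻ z in ball v₀ ρ, ‖multiDeriv α u z‖ₑ ^ 2 := by
    rw [sum_multiIndices]
    refine Finset.sum_congr rfl fun j _ => ?_
    have h1 : ∀ z, ENNReal.ofReal (sqSum j u z)
        = ∑ α ∈ Finset.piAntidiag Finset.univ j, ‖multiDeriv α u z‖ₑ ^ 2 := by
      intro z
      rw [sqSum, ENNReal.ofReal_sum_of_nonneg fun _ _ => by positivity]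
      exact Finset.sum_congr rfl fun α _ => (enorm_sq_eq_ofReal _).symm
    simp only [h1]
    rw [lintegral_finsetSum _ fun α _ =>
      ((contDiff_multiDeriv hu α).continuous.enorm.measurable.pow_const 2), Finset.mul_sum]
    refine Finset.sum_congr rfl fun α hα => ?_
    rw [Finset.mem_piAntidiag] at hα
    rw [order, hα.1]
  have hx1 := lintegral_enorm_sub_sq_le hu hm hx
  have hx2 := lintegral_enorm_sub_sq_le hu hm hx'
  rw [hS] at hx1 hx2
  set S := ∑ α ∈ multiIndices d (n + 1),
          ENNReal.ofReal (ρ ^ (2 * order α)) * ∫⁻ z in ball v₀ ρ, ‖multiDeriv α u z‖ₑ ^ 2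
  have hvol : volume (ball v₀ ρ) = ENNReal.ofReal (ρ ^ d) * b := by
    rw [Measure.addHaar_ball_of_pos _ _ hρ, finrank_euclideanSpace_fin]
  -- Both `u x` and `u x'` are compared with `u y`, and the comparison is integrated over the ball,
  -- whose volume is ρ^d times that of the unit ball.
  have hmain : b * (ENNReal.ofReal (ρ ^ d) * ‖u x - u x'‖ₑ ^ 2) ≤ 4 * c * S := by
    calc b * (ENNReal.ofReal (ρ ^ d) * ‖u x - u x'‖ₑ ^ 2)
        = ∫⁻ _y in ball v₀ ρ, ‖u x - u x'‖ₑ ^ 2 := by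
          rw [setLIntegral_const, hvol]
          ring
      _ ≤ ∫⁻ y in ball v₀ ρ, 2 * (‖u x - u y‖ₑ ^ 2 + ‖u x' - u y‖ₑ ^ 2) := by
          refine lintegral_mono fun y => ?_
          refine le_trans ?_ (ennreal_add_sq_le _ _)
          gcongr
          rw [enorm_sub_rev (u x') (u y)]
          have : u x - u x' = (u x - u y) + (u y - u x') := by abel
          rw [this]
          exact enorm_add_le _ _
      _ = 2 * ((∫⁻ y in ball v₀ ρ, ‖u x - u y‖ₑ ^ 2) + ∫⁻ y in ball v₀ ρ, ‖u x' - u y‖ₑ ^ 2) := by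
          have hcont := hu.continuous
          have h1 : Continuous fun y => u x - u y := by fun_prop
          rw [lintegral_const_mul' _ _ (by norm_num), lintegral_add_left]
          exact h1.enorm.measurable.pow_const 2
      _ ≤ 2 * (c * S + c * S) := mul_le_mul' le_rfl (add_le_add hx1 hx2)
      _ = 4 * c * S := by ring
  calc ENNReal.ofReal (ρ ^ d) * ‖u x - u x'‖ₑ ^ 2
      = b⁻¹ * (b * (ENNReal.ofReal (ρ ^ d) * ‖u x - u x'‖ₑ ^ 2)) := by
        rw [← mul_assoc, ENNReal.inv_mul_cancel hb0 hbtop, one_mul]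
    _ ≤ b⁻¹ * (4 * c * S) := by gcongr
    _ = _ := by ring

end Oscillation

/-! ### Limits in `L_2` and weak derivatives -/

section WeakDerivatives

variable {d : ℕ}

theorem eLpNorm_two_sq {α F : Type*} [MeasurableSpace α] [NormedAddCommGroup F] (μ : Measure α)
    (f : α → F) : eLpNorm f 2 μ ^ 2 = ∫⁻ a, ‖f a‖ₑ ^ 2 ∂μ := by
  rw [eLpNorm_eq_lintegral_rpow_enorm_toReal (by norm_num) (by norm_num), ← ENNReal.rpow_natCast,
    ← ENNReal.rpow_mul]
  norm_num

theorem exists_tendsto_eLpNorm_of_cauchy {α F : Type*} [MeasurableSpace α]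
    [NormedAddCommGroup F] [CompleteSpace F] {μ : Measure α} {g : ℕ → α → F}
    (hg : ∀ n, MemLp (g n) 2 μ)
    (hc : ∀ ε : ℝ≥0∞, 0 < ε → ∃ N : ℕ, ∀ p ≥ N, ∀ q ≥ N, eLpNorm (g p - g q) 2 μ < ε) :
    ∃ D : α → F, MemLp D 2 μ ∧ Tendsto (fun n => eLpNorm (g n - D) 2 μ) atTop (𝓝 0) := by
  have hcs : CauchySeq fun n => (hg n).toLp (g n) := by
    rw [EMetric.cauchySeq_iff]
    intro ε hε
    obtain ⟨N, hN⟩ := hc ε hε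
    refine ⟨N, fun p hp q hq => ?_⟩
    rw [Lp.edist_toLp_toLp]
    exact hN p hp q hq
  obtain ⟨L, hL⟩ := cauchySeq_tendsto_of_complete hcs
  refine ⟨L, Lp.memLp L, ?_⟩
  rw [← Lp.tendsto_Lp_iff_tendsto_eLpNorm'' g hg L (Lp.memLp L)]
  simpa using hL

/-- By Hölder's inequality, pairing with a fixed `L_2` function is continuous in `L_2`. This carries
the integration by parts identity to the limit. -/
theorem tendsto_integral_smul_of_eLpNorm {α F : Type*} [MeasurableSpace α]
    [NormedAddCommGroup F] [NormedSpace ℝ F] {μ : Measure α} {η : α → ℝ}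
    (hη : MemLp η 2 μ) {g : ℕ → α → F} (hg : ∀ n, MemLp (g n) 2 μ) {D : α → F}
    (hD : MemLp D 2 μ) (hlim : Tendsto (fun n => eLpNorm (g n - D) 2 μ) atTop (𝓝 0)) :
    Tendsto (fun n => ∫ a, η a • g n a ∂μ) atTop (𝓝 (∫ a, η a • D a ∂μ)) := by
  have hi : ∀ f : α → F, MemLp f 2 μ → Integrable (η • f) μ := fun f hf =>
    memLp_one_iff_integrable.1 (hf.smul hη)
  refine tendsto_integral_of_L1' (η • D) (hi _ hD).aestronglyMeasurable
    (F := fun n => η • g n) (Eventually.of_forall fun n => hi _ (hg n)) ?_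
  have h0 : Tendsto (fun n => eLpNorm η 2 μ * eLpNorm (g n - D) 2 μ) atTop (𝓝 0) := by
    have := ENNReal.Tendsto.const_mul hlim (Or.inr hη.eLpNorm_ne_top)
    rwa [mul_zero] at this
  refine tendsto_of_tendsto_of_tendsto_of_le_of_le tendsto_const_nhds h0 (fun _ => zero_le)
    fun n => ?_
  simp only []
  rw [← smul_sub]
  exact eLpNorm_smul_le_mul_eLpNorm ((hg n).sub hD).aestronglyMeasurable hη.aestronglyMeasurable

theorem memLp_of_contDiff_of_hasCompactSupport {F : Type*} [NormedAddCommGroup F]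
    [NormedSpace ℝ F] {u : E d → F} (hu : ContDiff ℝ ∞ u) (hc : HasCompactSupport u)
    (Ω : Set (E d)) : MemLp u 2 (volume.restrict Ω) :=
  (hu.continuous.memLp_of_hasCompactSupport hc).restrict Ω

/-- An `L_2`-limit of smooth functions whose `α`-th derivatives converge in `L_2` has the limit of
these derivatives as weak derivative. -/
theorem isWeakDeriv_of_tendsto {Ω : Set (E d)} {α : Fin d → ℕ} {u D : E d → ℂ}
    {U : ℕ → E d → ℂ} (hU : ∀ n, ContDiff ℝ ∞ (U n)) (hUc : ∀ n, HasCompactSupport (U n))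
    (hu : MemLp u 2 (volume.restrict Ω)) (hD : MemLp D 2 (volume.restrict Ω))
    (h0 : Tendsto (fun n => eLpNorm (U n - u) 2 (volume.restrict Ω)) atTop (𝓝 0))
    (h1 : Tendsto (fun n => eLpNorm (multiDeriv α (U n) - D) 2 (volume.restrict Ω)) atTop (𝓝 0)) :
    IsWeakDeriv Ω α u D where
  locallyIntegrable_left :=
    locallyIntegrableOn_of_locallyIntegrable_restrict (hu.locallyIntegrable (by norm_num))
  locallyIntegrable_right :=
    locallyIntegrableOn_of_locallyIntegrable_restrict (hD.locallyIntegrable (by norm_num))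
  integral_eq := by
    intro η hη hηc hηΩ
    have hm := fun n => memLp_of_contDiff_of_hasCompactSupport (hU n) (hUc n) Ω
    have hm' := fun n => memLp_of_contDiff_of_hasCompactSupport (contDiff_multiDeriv (hU n) α)
      (hasCompactSupport_multiDeriv (hUc n) α) Ω
    have hηm := memLp_of_contDiff_of_hasCompactSupport hη hηc Ω
    have hηm' := memLp_of_contDiff_of_hasCompactSupport (contDiff_multiDeriv hη α)
      (hasCompactSupport_multiDeriv hηc α) Ω
    have hset : ∀ (a : E d → ℝ) (b : E d → ℂ), tsupport a ⊆ Ω →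
        ∫ v in Ω, a v • b v = ∫ v, a v • b v := by
      intro a b ha
      refine setIntegral_eq_integral_of_forall_compl_eq_zero fun v hv => ?_
      rw [image_eq_zero_of_notMem_tsupport fun h => hv (ha h), zero_smul]
    have hl := tendsto_integral_smul_of_eLpNorm hηm' hm hu h0
    have hr := (tendsto_integral_smul_of_eLpNorm hηm hm' hD h1).const_smul ((-1 : ℝ) ^ order α)
    refine tendsto_nhds_unique hl (hr.congr fun n => ?_)
    rw [hset _ _ hηΩ, hset _ _ ((tsupport_multiDeriv_subset α η).trans hηΩ),
      integral_multiDeriv_smul hη hηc (hU n)]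

/-- Weak derivatives are unique almost everywhere. -/
theorem IsWeakDeriv.ae_eq {Ω : Set (E d)} (hΩ : IsOpen Ω) {α : Fin d → ℕ} {u D D' : E d → ℂ}
    (h : IsWeakDeriv Ω α u D) (h' : IsWeakDeriv Ω α u D') : D =ᵐ[volume.restrict Ω] D' := by
  have hD : ∀ {D : E d → ℂ}, LocallyIntegrableOn D Ω volume → ∀ η : E d → ℝ, ContDiff ℝ ∞ η →
      HasCompactSupport η → tsupport η ⊆ Ω → Integrable (fun v => η v • D v) := by
    intro D hDi η hη hηc hηΩ
    have h1 := (hDi.integrableOn_compact_subset hηΩ hηc).continuousOn_smul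
      hη.continuous.continuousOn hηc
    refine (integrableOn_iff_integrable_of_support_subset ?_).1 h1
    exact (Function.support_smul_subset_left _ _).trans (subset_tsupport η)
  have hz := hΩ.ae_eq_zero_of_integral_contDiff_smul_eq_zero (f := D - D') (μ := volume)
    (h.locallyIntegrable_right.sub h'.locallyIntegrable_right) ?_
  · rw [Filter.EventuallyEq, ae_restrict_iff' hΩ.measurableSet]
    filter_upwards [hz] with v hv hvΩ
    exact sub_eq_zero.1 (hv hvΩ)
  · intro η hη hηc hηΩ
    have hset : ∀ b : E d → ℂ, ∫ v in Ω, η v • b v = ∫ v, η v • b v := by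
      intro b
      refine setIntegral_eq_integral_of_forall_compl_eq_zero fun v hv => ?_
      rw [image_eq_zero_of_notMem_tsupport fun h => hv (hηΩ h), zero_smul]
    have e1 := h.integral_eq η hη hηc hηΩ
    have e2 := h'.integral_eq η hη hηc hηΩ
    rw [e1, hset, hset] at e2
    have e3 := smul_right_injective ℂ (pow_ne_zero (order α) (by norm_num : (-1 : ℝ) ≠ 0)) e2
    simp only [Pi.sub_apply, smul_sub]
    rw [integral_sub (hD h.locallyIntegrable_right η hη hηc hηΩ)
      (hD h'.locallyIntegrable_right η hη hηc hηΩ), e3, sub_self]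

end WeakDerivatives

/-! ### Change of charts and the metric tensor in coordinates -/

section Charts

variable {d : ℕ} {X : Type*} [MetricSpace X] [ChartedSpace (E d) X]

/-- The differential of the inverse of the chart `e`, as a linear map of `ℝ^d`. -/
noncomputable def chartDeriv (e : OpenPartialHomeomorph X (E d)) (v : E d) : E d →L[ℝ] E d :=
  mfderiv (𝓡 d) (𝓡 d) e.symm v

theorem mdifferentiableAt_symm [IsManifold (𝓡 d) ∞ X] {e : OpenPartialHomeomorph X (E d)}
    (he : e ∈ IsManifold.maximalAtlas (𝓡 d) ∞ X) {v : E d} (hv : v ∈ e.target) :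
    MDifferentiableAt (𝓡 d) (𝓡 d) e.symm v :=
  ((contMDiffOn_symm_of_mem_maximalAtlas he).contMDiffAt
    (e.open_target.mem_nhds hv)).mdifferentiableAt (by simp)

theorem mdifferentiableAt_chart [IsManifold (𝓡 d) ∞ X] {e : OpenPartialHomeomorph X (E d)}
    (he : e ∈ IsManifold.maximalAtlas (𝓡 d) ∞ X) {p : X} (hp : p ∈ e.source) :
    MDifferentiableAt (𝓡 d) (𝓡 d) e p :=
  ((contMDiffOn_of_mem_maximalAtlas he).contMDiffAt
    (e.open_source.mem_nhds hp)).mdifferentiableAt (by simp)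

theorem contDiffAt_transition [IsManifold (𝓡 d) ∞ X] {e e' : OpenPartialHomeomorph X (E d)}
    (he : e ∈ IsManifold.maximalAtlas (𝓡 d) ∞ X) (he' : e' ∈ IsManifold.maximalAtlas (𝓡 d) ∞ X)
    {v : E d} (hv : v ∈ e.target) (hv' : e.symm v ∈ e'.source) :
    ContDiffAt ℝ ∞ (fun w => e' (e.symm w)) v := by
  rw [← contMDiffAt_iff_contDiffAt]
  have h1 := (contMDiffOn_symm_of_mem_maximalAtlas he).contMDiffAt (e.open_target.mem_nhds hv)
  have h2 := (contMDiffOn_of_mem_maximalAtlas he').contMDiffAt (e'.open_source.mem_nhds hv')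
  exact h2.comp v h1

theorem chartDeriv_eq_comp [IsManifold (𝓡 d) ∞ X] {e e' : OpenPartialHomeomorph X (E d)}
    (he : e ∈ IsManifold.maximalAtlas (𝓡 d) ∞ X) (he' : e' ∈ IsManifold.maximalAtlas (𝓡 d) ∞ X)
    {v : E d} (hv : v ∈ e.target) (hv' : e.symm v ∈ e'.source) :
    chartDeriv e v = (chartDeriv e' (e' (e.symm v))).comp
      (fderiv ℝ (fun w => e' (e.symm w)) v) := by
  have h1 : (e.symm : E d → X) =ᶠ[𝓝 v] e'.symm ∘ fun w => e' (e.symm w) := by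
    have : ∀ᶠ w in 𝓝 v, e.symm w ∈ e'.source :=
      (e.continuousAt_symm hv) (e'.open_source.mem_nhds hv')
    filter_upwards [this] with w hw
    exact (e'.left_inv hw).symm
  have h2 : mfderiv (𝓡 d) (𝓡 d) e.symm v
      = mfderiv (𝓡 d) (𝓡 d) (e'.symm ∘ fun w => e' (e.symm w)) v := h1.mfderiv_eq
  have hτ : MDifferentiableAt (𝓡 d) (𝓡 d) (fun w => e' (e.symm w)) v :=
    ((contDiffAt_transition he he' hv hv').differentiableAt (by simp)).mdifferentiableAt
  have h3 := mfderiv_comp v (mdifferentiableAt_symm he' (e'.map_source hv')) hτ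
  rw [mfderiv_eq_fderiv] at h3
  exact h2.trans h3

theorem fderiv_transition_comp [IsManifold (𝓡 d) ∞ X] {e e' : OpenPartialHomeomorph X (E d)}
    (he : e ∈ IsManifold.maximalAtlas (𝓡 d) ∞ X) (he' : e' ∈ IsManifold.maximalAtlas (𝓡 d) ∞ X)
    {v : E d} (hv : v ∈ e.target) (hv' : e.symm v ∈ e'.source) :
    (fderiv ℝ (fun w => e (e'.symm w)) (e' (e.symm v))).comp
      (fderiv ℝ (fun w => e' (e.symm w)) v) = ContinuousLinearMap.id ℝ (E d) := by
  have h1 := contDiffAt_transition he he' hv hv'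
  have h2 : ContDiffAt ℝ ∞ (fun w => e (e'.symm w)) (e' (e.symm v)) := by
    refine contDiffAt_transition he' he (e'.map_source hv') ?_
    rw [e'.left_inv hv']
    exact e.map_target hv
  rw [← fderiv_comp v (h2.differentiableAt (by simp)) (h1.differentiableAt (by simp))]
  have h3 : ((fun w => e (e'.symm w)) ∘ fun w => e' (e.symm w)) =ᶠ[𝓝 v] id := by
    have : ∀ᶠ w in 𝓝 v, e.symm w ∈ e'.source :=
      (e.continuousAt_symm hv) (e'.open_source.mem_nhds hv')
    filter_upwards [this, e.open_target.mem_nhds hv] with w hw hw'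
    simp [e'.left_inv hw, e.right_inv hw']
  rw [h3.fderiv_eq, fderiv_id]

variable [RiemannianBundle (fun p : X => TangentSpace (𝓡 d) p)]

/-- The metric tensor at `p`, the tangent space being identified with `ℝ^d`. -/
noncomputable def metricAt (p : X) (ξ η : E d) : ℝ :=
  @inner ℝ (TangentSpace (𝓡 d) p) _ ξ η

/-- The norm on the tangent space at `p`, identified with `ℝ^d`. -/
noncomputable def normAt (p : X) (ξ : E d) : ℝ := @norm (TangentSpace (𝓡 d) p) _ ξ

theorem normAt_nonneg (p : X) (ξ : E d) : 0 ≤ normAt p ξ :=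
  norm_nonneg (E := TangentSpace (𝓡 d) p) ξ

theorem normAt_sq (p : X) (ξ : E d) : normAt p ξ ^ 2 = metricAt p ξ ξ :=
  (real_inner_self_eq_norm_sq (F := TangentSpace (𝓡 d) p) ξ).symm

theorem metricAt_sum (p : X) (A : E d →L[ℝ] E d) (ξ η : E d) :
    metricAt p (A ξ) (A η)
      = ∑ i, ∑ j, ξ i * η j * metricAt p (A (basisVec i)) (A (basisVec j)) := by
  have h : ∀ ζ : E d, A ζ = ∑ i, ζ i • A (basisVec i) := by
    intro ζ
    conv_lhs => rw [← sum_smul_basisVec ζ]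
    simp
  have h1 : metricAt p (A ξ) (A η)
      = metricAt p (∑ i, ξ i • A (basisVec i)) (∑ j, η j • A (basisVec j)) := by rw [← h, ← h]
  rw [h1]
  have h2 := sum_inner (𝕜 := ℝ) (E := TangentSpace (𝓡 d) p) Finset.univ
    (fun i => ξ i • A (basisVec i)) (∑ j, η j • A (basisVec j))
  refine h2.trans (Finset.sum_congr rfl fun i _ => ?_)
  have h3 := inner_sum (𝕜 := ℝ) (E := TangentSpace (𝓡 d) p) Finset.univ
    (fun j => η j • A (basisVec j)) (ξ i • A (basisVec i))
  refine h3.trans (Finset.sum_congr rfl fun j _ => ?_)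
  have h4 := real_inner_smul_left (F := TangentSpace (𝓡 d) p) (A (basisVec i))
    (η j • A (basisVec j)) (ξ i)
  have h5 := real_inner_smul_right (F := TangentSpace (𝓡 d) p) (A (basisVec i))
    (A (basisVec j)) (η j)
  refine h4.trans ?_
  rw [mul_assoc]
  exact congrArg _ h5

theorem metricMatrix_apply (e : OpenPartialHomeomorph X (E d)) (v : E d) (i j : Fin d) :
    metricMatrix e v i j = metricAt (e.symm v) (chartDeriv e v (basisVec i))
      (chartDeriv e v (basisVec j)) := rfl

/-- The metric in the chart `e`. -/
theorem metricAt_chartDeriv (e : OpenPartialHomeomorph X (E d)) (v ξ η : E d) :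
    metricAt (e.symm v) (chartDeriv e v ξ) (chartDeriv e v η)
      = ∑ i, ∑ j, ξ i * η j * metricMatrix e v i j :=
  metricAt_sum _ _ _ _

/-- The chain rule factors the differential of `e.symm` through the Jacobian of the transition map,
and the metric is bilinear. -/
theorem metricMatrix_eq_of_transition [IsManifold (𝓡 d) ∞ X]
    {e e' : OpenPartialHomeomorph X (E d)}
    (he : e ∈ IsManifold.maximalAtlas (𝓡 d) ∞ X) (he' : e' ∈ IsManifold.maximalAtlas (𝓡 d) ∞ X)
    {v : E d} (hv : v ∈ e.target) (hv' : e.symm v ∈ e'.source) :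
    metricMatrix e v = (Matrix.of fun k i => fderiv ℝ (fun w => e' (e.symm w)) v (basisVec i) k).transpose
      * metricMatrix e' (e' (e.symm v)) *
      (Matrix.of fun k i => fderiv ℝ (fun w => e' (e.symm w)) v (basisVec i) k) := by
  ext i j
  rw [metricMatrix_apply, chartDeriv_eq_comp he he' hv hv']
  have h : e.symm v = e'.symm (e' (e.symm v)) := (e'.left_inv hv').symm
  rw [ContinuousLinearMap.comp_apply, ContinuousLinearMap.comp_apply]
  have h2 := metricAt_chartDeriv e' (e' (e.symm v))
    (fderiv ℝ (fun w => e' (e.symm w)) v (basisVec i))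
    (fderiv ℝ (fun w => e' (e.symm w)) v (basisVec j))
  rw [← h] at h2
  rw [h2]
  simp only [Matrix.mul_apply, Matrix.transpose_apply, Matrix.of_apply, Finset.sum_mul]
  rw [Finset.sum_comm]
  refine Finset.sum_congr rfl fun k _ => Finset.sum_congr rfl fun l _ => ?_
  ring

end Charts

/-- Charts and their inverses are controlled only on their domains, so measurability of preimages is
available only after intersecting with the domain. -/
theorem _root_.ContinuousOn.measurableSet_inter_preimage {α β : Type*} [TopologicalSpace α]
    [MeasurableSpace α] [OpensMeasurableSpace α] [TopologicalSpace β] [MeasurableSpace β]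
    [BorelSpace β] {f : α → β} {s : Set α} (hf : ContinuousOn f s) (hs : MeasurableSet s)
    {A : Set β} (hA : MeasurableSet A) : MeasurableSet (s ∩ f ⁻¹' A) := by
  have h : Measurable (s.domRestrict f) :=
    (continuousOn_iff_continuous_domRestrict.1 hf).measurable
  have := (MeasurableEmbedding.subtype_coe hs).measurableSet_image.2 (h hA)
  convert this using 1
  ext v
  simp [Set.domRestrict, and_comm]

theorem measurableSet_target_inter_preimage {d : ℕ} {X : Type*} [MetricSpace X]
    [MeasurableSpace X] [BorelSpace X] (e : OpenPartialHomeomorph X (E d)) {A : Set X}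
    (hA : MeasurableSet A) : MeasurableSet (e.target ∩ e.symm ⁻¹' A) :=
  e.continuousOn_symm.measurableSet_inter_preimage e.open_target.measurableSet hA

theorem aemeasurable_symm {d : ℕ} {X : Type*} [MetricSpace X] [MeasurableSpace X] [BorelSpace X]
    (e : OpenPartialHomeomorph X (E d)) : AEMeasurable e.symm (volume.restrict e.target) :=
  e.continuousOn_symm.aemeasurable e.open_target.measurableSet

/-! ### Smoothness of the metric coefficients -/

section MetricSmooth

variable {d : ℕ} {X : Type*} [MetricSpace X] [ChartedSpace (E d) X]
  [IsManifold (𝓡 d) ∞ X]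

theorem contMDiffOn_coordVec {e : OpenPartialHomeomorph X (E d)}
    (he : e ∈ IsManifold.maximalAtlas (𝓡 d) ∞ X) (i : Fin d) :
    ContMDiffOn (𝓡 d) (𝓡 d).tangent ∞
      (fun v => (⟨e.symm v, coordVec e v i⟩ : TangentBundle (𝓡 d) X)) e.target := by
  have h1 := (contMDiffOn_symm_of_mem_maximalAtlas he).contMDiffOn_tangentMapWithin (m := ∞)
    le_rfl e.open_target.uniqueMDiffOn
  have h2 : ContMDiffOn (𝓡 d) (𝓡 d).tangent ∞
      (fun v : E d => (⟨v, basisVec i⟩ : TangentBundle (𝓡 d) (E d))) e.target :=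
    contMDiffOn_vectorSpace_iff_contDiffOn.2 contDiffOn_const
  refine (h1.comp h2 fun v hv => hv).congr fun v hv => ?_
  simp only [Function.comp_apply, tangentMapWithin, coordVec]
  rw [mfderivWithin_of_isOpen e.open_target hv]

theorem contDiffOn_metricMatrix [RiemannianBundle (fun p : X => TangentSpace (𝓡 d) p)]
    [IsContMDiffRiemannianBundle (𝓡 d) ∞ (E d)
    (fun p : X => TangentSpace (𝓡 d) p)] {e : OpenPartialHomeomorph X (E d)}
    (he : e ∈ IsManifold.maximalAtlas (𝓡 d) ∞ X) (i j : Fin d) :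
    ContDiffOn ℝ ∞ (fun v => metricMatrix e v i j) e.target := by
  rw [← contMDiffOn_iff_contDiffOn]
  exact (contMDiffOn_coordVec he i).inner_bundle (contMDiffOn_coordVec he j)

end MetricSmooth

/-! ### The Riemannian measure in a chart -/

section ChartMeasure

variable {d : ℕ} {X : Type*} [MetricSpace X] [ChartedSpace (E d) X]
  [RiemannianBundle (fun p : X => TangentSpace (𝓡 d) p)]

/-- The density of the Riemannian measure in the chart `e`. -/
noncomputable def volDensity (e : OpenPartialHomeomorph X (E d)) (v : E d) : ℝ≥0∞ :=
  ENNReal.ofReal (Real.sqrt |(metricMatrix e v).det|)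

theorem chartMeasure_apply [MeasurableSpace X] [BorelSpace X]
    (e : OpenPartialHomeomorph X (E d)) {A : Set X} (hA : MeasurableSet A) :
    chartMeasure (d := d) e A = ∫⁻ v in e.target ∩ e.symm ⁻¹' A, volDensity e v := by
  rw [chartMeasure, Measure.map_apply_of_aemeasurable
    ((aemeasurable_symm e).mono_ac (withDensity_absolutelyContinuous _ _)) hA,
    withDensity_apply', Measure.restrict_restrict' e.open_target.measurableSet, inter_comm]
  rfl

variable [IsManifold (𝓡 d) ∞ X]

/-- With J the Jacobian, det(Jᵀ G' J) = (det J)² det G'; the square root produces |det J|, the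
factor in the change of variables formula. -/
theorem volDensity_eq_of_transition {e e' : OpenPartialHomeomorph X (E d)}
    (he : e ∈ IsManifold.maximalAtlas (𝓡 d) ∞ X) (he' : e' ∈ IsManifold.maximalAtlas (𝓡 d) ∞ X)
    {v : E d} (hv : v ∈ e.target) (hv' : e.symm v ∈ e'.source) :
    volDensity e v = ENNReal.ofReal |(fderiv ℝ (fun w => e' (e.symm w)) v).det| *
      volDensity e' (e' (e.symm v)) := by
  set J := fderiv ℝ (fun w => e' (e.symm w)) v with hJ
  have hdet : (Matrix.of fun k i => J (basisVec i) k).det = J.det := by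
    rw [ContinuousLinearMap.det, ← LinearMap.det_toMatrix (EuclideanSpace.basisFun (Fin d) ℝ).toBasis]
    congr 1
  rw [volDensity, metricMatrix_eq_of_transition he he' hv hv', Matrix.det_mul, Matrix.det_mul,
    Matrix.det_transpose, ← hJ, hdet, volDensity, ← ENNReal.ofReal_mul (abs_nonneg _)]
  congr 1
  rw [abs_mul, abs_mul, mul_right_comm, Real.sqrt_mul (by positivity),
    Real.sqrt_mul_self (abs_nonneg _)]

theorem chartMeasure_inter_source [MeasurableSpace X] [BorelSpace X]
    {e e' : OpenPartialHomeomorph X (E d)}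
    (he : e ∈ IsManifold.maximalAtlas (𝓡 d) ∞ X) (he' : e' ∈ IsManifold.maximalAtlas (𝓡 d) ∞ X)
    {A : Set X} (hA : MeasurableSet A) :
    chartMeasure (d := d) e' (A ∩ e.source) = chartMeasure (d := d) e (A ∩ e'.source) := by
  have hs : MeasurableSet (A ∩ e.source) := hA.inter e.open_source.measurableSet
  have hs' : MeasurableSet (A ∩ e'.source) := hA.inter e'.open_source.measurableSet
  rw [chartMeasure_apply _ hs, chartMeasure_apply _ hs']
  set S := e.target ∩ e.symm ⁻¹' (A ∩ e'.source) with hS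
  have himg : e'.target ∩ e'.symm ⁻¹' (A ∩ e.source) = (fun w => e' (e.symm w)) '' S := by
    ext w
    constructor
    · rintro ⟨hw, hwA, hws⟩
      refine ⟨e (e'.symm w), ⟨e.map_source hws, ?_⟩, ?_⟩
      · rw [mem_preimage, e.left_inv hws]
        exact ⟨hwA, e'.map_target hw⟩
      · simp only []
        rw [e.left_inv hws, e'.right_inv hw]
    · rintro ⟨v, ⟨hv, hvA, hvs⟩, rfl⟩
      refine ⟨e'.map_source hvs, ?_⟩
      rw [mem_preimage, e'.left_inv hvs]
      exact ⟨hvA, e.map_target hv⟩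
  have hinj : InjOn (fun w => e' (e.symm w)) S := by
    rintro v ⟨hv, _, hvs⟩ w ⟨hw, _, hws⟩ h
    exact e.symm.injOn hv hw (e'.injOn hvs hws h)
  rw [himg, lintegral_image_eq_lintegral_abs_det_fderiv_mul volume
    (measurableSet_target_inter_preimage e hs')
    (f' := fun v => fderiv ℝ (fun w => e' (e.symm w)) v) _ hinj]
  · refine setLIntegral_congr_fun (measurableSet_target_inter_preimage e hs') fun v hv => ?_
    exact (volDensity_eq_of_transition he he' hv.1 hv.2.2).symm
  · intro v hv
    exact ((contDiffAt_transition he he' hv.1 hv.2.2).differentiableAt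
      (by simp)).hasFDerivAt.hasFDerivWithinAt

/-- On the domain of `e` no other chart measure exceeds that of `e`, by `chartMeasure_inter_source`,
so the supremum is attained there by `e` itself. -/
theorem riemMeasure_apply_of_subset_source [MeasurableSpace X] [BorelSpace X]
    {e : OpenPartialHomeomorph X (E d)} (he : e ∈ IsManifold.maximalAtlas (𝓡 d) ∞ X)
    {A : Set X} (hA : MeasurableSet A) (hAe : A ⊆ e.source) :
    riemMeasure d X A = chartMeasure (d := d) e A := by
  refine le_antisymm ?_ ?_
  -- An upper bound for all chart measures at once: the measure of `e` on its domain, and infinite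
  -- mass on every nonempty measurable set outside it.
  · set ν : Measure X := chartMeasure (d := d) e + (⊤ : Measure X).restrict e.sourceᶜ with hν
    have hle : riemMeasure d X ≤ ν := by
      refine iSup₂_le fun e' he' => Measure.le_iff.2 fun B hB => ?_
      rw [← measure_inter_add_sdiff B e.open_source.measurableSet,
        chartMeasure_inter_source he he' hB, hν, Measure.add_apply]
      refine add_le_add (measure_mono inter_subset_left) ?_
      rw [Measure.restrict_apply hB, ← sdiff_eq]
      exact Measure.le_iff'.1 le_top _
    refine (hle A).trans ?_
    rw [hν, Measure.add_apply, Measure.restrict_apply hA]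
    have : A ∩ e.sourceᶜ = ∅ := by
      rw [← sdiff_eq]
      exact sdiff_eq_empty.2 hAe
    simp [this]
  · exact (le_iSup₂ (f := fun e (_ : e ∈ IsManifold.maximalAtlas (𝓡 d) ∞ X) =>
      chartMeasure (d := d) e) e he) A

theorem continuousOn_volDensity
    [IsContMDiffRiemannianBundle (𝓡 d) ∞ (E d) (fun p : X => TangentSpace (𝓡 d) p)]
    {e : OpenPartialHomeomorph X (E d)}
    (he : e ∈ IsManifold.maximalAtlas (𝓡 d) ∞ X) : ContinuousOn (volDensity e) e.target := by
  have h : ContinuousOn (fun v => (metricMatrix e v).det) e.target := by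
    have : ContinuousOn (fun v => metricMatrix e v) e.target :=
      continuousOn_pi.2 fun i => continuousOn_pi.2 fun j =>
        (contDiffOn_metricMatrix he i j).continuousOn
    exact Continuous.comp_continuousOn continuous_id.matrix_det this
  exact ENNReal.continuous_ofReal.comp_continuousOn (h.abs.sqrt)

variable [MeasurableSpace X] [BorelSpace X]

/-- The Riemannian measure on the domain of a chart, transported to `ℝ^d`. -/
theorem map_chart_riemMeasure {e : OpenPartialHomeomorph X (E d)}
    (he : e ∈ IsManifold.maximalAtlas (𝓡 d) ∞ X) :
    Measure.map e ((riemMeasure d X).restrict e.source)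
      = (volume.restrict e.target).withDensity (volDensity e) := by
  have hem : AEMeasurable e ((riemMeasure d X).restrict e.source) :=
    e.continuousOn.aemeasurable e.open_source.measurableSet
  ext B hB
  have hpre : MeasurableSet (e.source ∩ e ⁻¹' B) :=
    e.continuousOn.measurableSet_inter_preimage e.open_source.measurableSet hB
  rw [Measure.map_apply_of_aemeasurable hem hB,
    Measure.restrict_apply' e.open_source.measurableSet, inter_comm,
    riemMeasure_apply_of_subset_source he hpre inter_subset_left, chartMeasure_apply e hpre,
    withDensity_apply _ hB, Measure.restrict_restrict hB, inter_comm B]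
  congr 2
  ext v
  constructor
  · rintro ⟨hv, _, h⟩
    rw [mem_preimage, e.right_inv hv] at h
    exact ⟨hv, h⟩
  · rintro ⟨hv, h⟩
    refine ⟨hv, e.map_target hv, ?_⟩
    rwa [mem_preimage, e.right_inv hv]

/-- Almost everywhere measurability of `f` is all that is asked, because `f` will be built from weak
derivatives, which are defined only up to null sets. -/
theorem setLIntegral_riemMeasure_chart
    [IsContMDiffRiemannianBundle (𝓡 d) ∞ (E d) (fun p : X => TangentSpace (𝓡 d) p)]
    {e : OpenPartialHomeomorph X (E d)}
    (he : e ∈ IsManifold.maximalAtlas (𝓡 d) ∞ X) {f : E d → ℝ≥0∞}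
    (hf : AEMeasurable f (volume.restrict e.target)) {A : Set X} (hA : MeasurableSet A)
    (hAe : A ⊆ e.source) :
    ∫⁻ p in A, f (e p) ∂(riemMeasure d X)
      = ∫⁻ v in e.target ∩ e.symm ⁻¹' A, volDensity e v * f v := by
  set S := e.target ∩ e.symm ⁻¹' A with hS
  have hSm : MeasurableSet S := measurableSet_target_inter_preimage e hA
  have hem : AEMeasurable e ((riemMeasure d X).restrict e.source) :=
    e.continuousOn.aemeasurable e.open_source.measurableSet
  have hdens : AEMeasurable (volDensity e) (volume.restrict e.target) :=
    (continuousOn_volDensity he).aemeasurable e.open_target.measurableSet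
  have hfS : AEMeasurable (S.indicator f) (volume.restrict e.target) := hf.indicator hSm
  have hac : (volume.restrict e.target).withDensity (volDensity e) ≪ volume.restrict e.target :=
    withDensity_absolutelyContinuous _ _
  calc ∫⁻ p in A, f (e p) ∂(riemMeasure d X)
      = ∫⁻ p in e.source, S.indicator f (e p) ∂(riemMeasure d X) := by
        rw [← Measure.restrict_restrict_of_subset hAe, ← lintegral_indicator hA]
        refine setLIntegral_congr_fun e.open_source.measurableSet fun p hp => ?_
        have : e p ∈ S ↔ p ∈ A := by
          rw [hS, mem_inter_iff, mem_preimage, e.left_inv hp]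
          exact ⟨fun h => h.2, fun h => ⟨e.map_source hp, h⟩⟩
        by_cases hpA : p ∈ A
        · simp only [indicator_of_mem hpA, indicator_of_mem (this.2 hpA)]
        · simp only [indicator_of_notMem hpA, indicator_of_notMem (fun h => hpA (this.1 h))]
    _ = ∫⁻ v, S.indicator f v ∂((volume.restrict e.target).withDensity (volDensity e)) := by
        rw [← map_chart_riemMeasure he, lintegral_map' _ hem]
        rw [map_chart_riemMeasure he]
        exact hfS.mono_ac hac
    _ = ∫⁻ v in e.target, S.indicator (fun v => volDensity e v * f v) v := by
        rw [lintegral_withDensity_eq_lintegral_mul₀' hdens (hfS.mono_ac hac)]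
        refine lintegral_congr fun v => ?_
        by_cases hv : v ∈ S <;> simp [hv]
    _ = _ := by
        rw [lintegral_indicator hSm, Measure.restrict_restrict hSm, inter_eq_left.2 inter_subset_left]

end ChartMeasure

/-! ### Charts with uniformly bounded length distortion -/

section Elliptic

variable {d : ℕ} {X : Type*} [MetricSpace X] [ChartedSpace (E d) X]
  [RiemannianBundle (fun p : X => TangentSpace (𝓡 d) p)]

/-- In the chart `e`, the Riemannian norm and the Euclidean norm of `ℝ^d` are equivalent with
constant `Λ`. -/
structure IsElliptic (Λ : ℝ) (e : OpenPartialHomeomorph X (E d)) : Prop where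
  norm_le : ∀ v ∈ e.target, ∀ ξ : E d, normAt (e.symm v) (chartDeriv e v ξ) ≤ Λ * ‖ξ‖
  le_norm : ∀ v ∈ e.target, ∀ ξ : E d, ‖ξ‖ ≤ Λ * normAt (e.symm v) (chartDeriv e v ξ)

theorem isHermitian_metricMatrix (e : OpenPartialHomeomorph X (E d)) (v : E d) :
    (metricMatrix e v).IsHermitian := by
  ext i j
  exact real_inner_comm (F := TangentSpace (𝓡 d) (e.symm v)) _ _

/-- An eigenvalue of the metric matrix is the squared Riemannian length of the image of a unit
eigenvector, which ellipticity bounds from both sides. The determinant, as a product of `d`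
eigenvalues, is then bounded too. -/
theorem IsElliptic.eigenvalues_mem {Λ : ℝ} (hΛ : 1 ≤ Λ) {e : OpenPartialHomeomorph X (E d)}
    (h : IsElliptic Λ e) {v : E d} (hv : v ∈ e.target) (i : Fin d) :
    (isHermitian_metricMatrix e v).eigenvalues i ∈ Icc ((Λ ^ 2)⁻¹) (Λ ^ 2) := by
  set hG := isHermitian_metricMatrix e v
  set b : E d := hG.eigenvectorBasis i with hb
  have hnorm : ‖b‖ = 1 := hG.eigenvectorBasis.orthonormal.1 i
  have heq : hG.eigenvalues i = normAt (e.symm v) (chartDeriv e v b) ^ 2 := by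
    rw [hG.eigenvalues_eq, normAt_sq, metricAt_chartDeriv]
    simp only [star_trivial, RCLike.re_to_real, dotProduct, Matrix.mulVec, Finset.mul_sum, ← hb]
    refine Finset.sum_congr rfl fun k _ => Finset.sum_congr rfl fun l _ => ?_
    ring
  have h1 := h.norm_le v hv b
  have h2 := h.le_norm v hv b
  have h0 := normAt_nonneg (e.symm v) (chartDeriv e v b)
  rw [hnorm] at h1 h2
  rw [heq, mem_Icc]
  constructor
  · rw [inv_le_iff_one_le_mul₀ (by positivity), ← mul_pow, mul_comm]
    exact one_le_pow₀ h2
  · exact pow_le_pow_left₀ h0 (by linarith) 2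

theorem IsElliptic.sqrt_det_mem {Λ : ℝ} (hΛ : 1 ≤ Λ) {e : OpenPartialHomeomorph X (E d)}
    (h : IsElliptic Λ e) {v : E d} (hv : v ∈ e.target) :
    Real.sqrt |(metricMatrix e v).det| ∈ Icc ((Λ ^ d)⁻¹) (Λ ^ d) := by
  have hΛ0 : 0 < Λ := by linarith
  have hdet := (isHermitian_metricMatrix e v).det_eq_prod_eigenvalues
  simp only [RCLike.ofReal_real_eq_id, id_eq] at hdet
  have hmem := fun i => h.eigenvalues_mem hΛ hv i
  have hlow : ((Λ ^ d)⁻¹) ^ 2 ≤ (metricMatrix e v).det := by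
    rw [hdet]
    calc ((Λ ^ d)⁻¹) ^ 2 = ∏ _i : Fin d, (Λ ^ 2)⁻¹ := by
          simp only [Finset.prod_const, Finset.card_univ, Fintype.card_fin]
          rw [inv_pow, inv_pow, ← pow_mul, ← pow_mul, mul_comm]
      _ ≤ _ := Finset.prod_le_prod (fun _ _ => by positivity) fun i _ => (hmem i).1
  have hup : (metricMatrix e v).det ≤ (Λ ^ d) ^ 2 := by
    rw [hdet]
    calc _ ≤ ∏ _i : Fin d, Λ ^ 2 :=
          Finset.prod_le_prod (fun i _ => le_trans (by positivity) (hmem i).1) fun i _ => (hmem i).2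
      _ = (Λ ^ d) ^ 2 := by
          simp only [Finset.prod_const, Finset.card_univ, Fintype.card_fin]
          rw [← pow_mul, ← pow_mul, mul_comm]
  rw [abs_of_nonneg (le_trans (by positivity) hlow)]
  exact ⟨Real.le_sqrt_of_sq_le hlow, Real.sqrt_le_iff.2 ⟨by positivity, hup⟩⟩

theorem IsElliptic.volDensity_le {Λ : ℝ} (hΛ : 1 ≤ Λ) {e : OpenPartialHomeomorph X (E d)}
    (h : IsElliptic Λ e) {v : E d} (hv : v ∈ e.target) :
    volDensity e v ≤ ENNReal.ofReal (Λ ^ d) :=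
  ENNReal.ofReal_le_ofReal (h.sqrt_det_mem hΛ hv).2

theorem IsElliptic.one_le_volDensity {Λ : ℝ} (hΛ : 1 ≤ Λ) {e : OpenPartialHomeomorph X (E d)}
    (h : IsElliptic Λ e) {v : E d} (hv : v ∈ e.target) :
    1 ≤ ENNReal.ofReal (Λ ^ d) * volDensity e v := by
  have hΛ0 : 0 < Λ ^ d := by positivity
  rw [volDensity, ← ENNReal.ofReal_mul hΛ0.le, ENNReal.one_le_ofReal]
  calc (1 : ℝ) = Λ ^ d * (Λ ^ d)⁻¹ := (mul_inv_cancel₀ hΛ0.ne').symm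
    _ ≤ _ := by gcongr; exact (h.sqrt_det_mem hΛ hv).1

/-! ### Comparison of Riemannian and Lebesgue integrals -/

section Measure

variable [IsManifold (𝓡 d) ∞ X] [MeasurableSpace X] [BorelSpace X]
  [IsContMDiffRiemannianBundle (𝓡 d) ∞ (E d) (fun p : X => TangentSpace (𝓡 d) p)]

theorem IsElliptic.setLIntegral_riemMeasure_le {Λ : ℝ} (hΛ : 1 ≤ Λ)
    {e : OpenPartialHomeomorph X (E d)} (h : IsElliptic Λ e)
    (he : e ∈ IsManifold.maximalAtlas (𝓡 d) ∞ X) {f : E d → ℝ≥0∞}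
    (hf : AEMeasurable f (volume.restrict e.target)) {A : Set X} (hA : MeasurableSet A)
    (hAe : A ⊆ e.source) :
    ∫⁻ p in A, f (e p) ∂(riemMeasure d X)
      ≤ ENNReal.ofReal (Λ ^ d) * ∫⁻ v in e.target ∩ e.symm ⁻¹' A, f v := by
  rw [setLIntegral_riemMeasure_chart he hf hA hAe, ← lintegral_const_mul' _ _ ENNReal.ofReal_ne_top]
  refine setLIntegral_mono' (measurableSet_target_inter_preimage e hA) fun v hv => ?_
  gcongr
  exact h.volDensity_le hΛ hv.1

theorem IsElliptic.setLIntegral_volume_le {Λ : ℝ} (hΛ : 1 ≤ Λ)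
    {e : OpenPartialHomeomorph X (E d)} (h : IsElliptic Λ e)
    (he : e ∈ IsManifold.maximalAtlas (𝓡 d) ∞ X) {f : E d → ℝ≥0∞}
    (hf : AEMeasurable f (volume.restrict e.target)) {A : Set X} (hA : MeasurableSet A)
    (hAe : A ⊆ e.source) :
    ∫⁻ v in e.target ∩ e.symm ⁻¹' A, f v
      ≤ ENNReal.ofReal (Λ ^ d) * ∫⁻ p in A, f (e p) ∂(riemMeasure d X) := by
  rw [setLIntegral_riemMeasure_chart he hf hA hAe, ← lintegral_const_mul' _ _ ENNReal.ofReal_ne_top]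
  refine setLIntegral_mono' (measurableSet_target_inter_preimage e hA) fun v hv => ?_
  rw [← mul_assoc]
  exact le_mul_of_one_le_left' (h.one_le_volDensity hΛ hv.1)

end Measure

/-! ### Comparison of Riemannian and Euclidean distances -/

section Distance

/-- The velocity of the curve `γ`, the tangent spaces being identified with `ℝ^d`. -/
noncomputable def velocity (γ : ℝ → X) (t : ℝ) : E d :=
  mfderiv 𝓘(ℝ, ℝ) (𝓡 d) γ t (1 : ℝ)

theorem pathELength_eq_lintegral_normAt (γ : ℝ → X) (a b : ℝ) :
    Manifold.pathELength (𝓡 d) γ a b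
      = ∫⁻ t in Icc a b, ENNReal.ofReal (normAt (γ t) (velocity (d := d) γ t)) := by
  rw [Manifold.pathELength_eq_lintegral_mfderiv_Icc]
  exact lintegral_congr fun t => (ofReal_norm _).symm

theorem edist_le_pathELength [IsRiemannianManifold (𝓡 d) X] {γ : ℝ → X} {a b : ℝ} (hab : a ≤ b)
    (hγ : ContMDiffOn 𝓘(ℝ, ℝ) (𝓡 d) 1 γ (Icc a b)) :
    edist (γ a) (γ b) ≤ Manifold.pathELength (𝓡 d) γ a b := by
  rw [IsRiemannianManifold.out (I := 𝓡 d) (γ a) (γ b)]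
  exact Manifold.riemannianEDist_le_pathELength hγ rfl rfl hab

theorem exists_path_of_edist_lt [IsRiemannianManifold (𝓡 d) X] {p q : X} {s : ℝ≥0∞}
    (h : edist p q < s) : ∃ γ : ℝ → X, γ 0 = p ∧ γ 1 = q ∧ ContMDiff 𝓘(ℝ, ℝ) (𝓡 d) 1 γ ∧
      Manifold.pathELength (𝓡 d) γ 0 1 < s := by
  rw [IsRiemannianManifold.out (I := 𝓡 d) p q] at h
  obtain ⟨γ, h0, h1, hγ, hlen, _⟩ :=
    Manifold.exists_lt_locally_constant_of_riemannianEDist_lt h zero_lt_one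
  exact ⟨γ, h0, h1, hγ, hlen⟩

/-- A point at distance less than `a + b` can be reached through an intermediate point. -/
theorem exists_dist_lt_dist_lt [IsRiemannianManifold (𝓡 d) X] {p q : X} {a b : ℝ} (ha : 0 < a)
    (hb : 0 < b) (h : dist p q < a + b) : ∃ z : X, dist p z < a ∧ dist z q < b := by
  by_cases hqa : dist p q < a
  · exact ⟨q, hqa, by simpa using hb⟩
  push Not at hqa
  obtain ⟨L, hL, hLab⟩ := exists_between h
  have hedist : edist p q < ENNReal.ofReal L := by
    rw [edist_dist]
    exact (ENNReal.ofReal_lt_ofReal_iff (dist_nonneg.trans_lt hL)).2 hL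
  obtain ⟨γ, h0, h1, hγ, hlen⟩ := exists_path_of_edist_lt (d := d) hedist
  have hcont : ContinuousOn (fun t => dist p (γ t)) (Icc 0 1) :=
    (continuous_const.dist hγ.continuous).continuousOn
  -- The point is sought on a path of length less than `L`, at a distance from `p` strictly between
  -- max(0, L - b) and `a`; the remaining part of the path is then shorter than `b`.
  have hmax : max 0 (L - b) < a := max_lt ha (by linarith)
  have hmem : (max 0 (L - b) + a) / 2 ∈ Icc (dist p (γ 0)) (dist p (γ 1)) := by
    rw [h0, h1, dist_self]
    have := le_max_left 0 (L - b)
    exact ⟨by linarith, by linarith⟩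
  obtain ⟨t, ht, hdt⟩ := intermediate_value_Icc zero_le_one hcont hmem
  simp only [] at hdt
  refine ⟨γ t, by rw [hdt]; linarith, ?_⟩
  have hsum : edist p (γ t) + edist (γ t) q ≤ Manifold.pathELength (𝓡 d) γ 0 1 := by
    rw [← Manifold.pathELength_add ht.1 ht.2, ← h0, ← h1]
    exact add_le_add (edist_le_pathELength ht.1 hγ.contMDiffOn)
      (edist_le_pathELength ht.2 hγ.contMDiffOn)
  have hsum' : dist p (γ t) + dist (γ t) q < L := by
    rw [edist_dist, edist_dist, ← ENNReal.ofReal_add dist_nonneg dist_nonneg] at hsum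
    exact (ENNReal.ofReal_lt_ofReal_iff (dist_nonneg.trans_lt hL)).1 (hsum.trans_lt hlen)
  have := le_max_right 0 (L - b)
  linarith

/-- Chaining: oscillation bounds at the scale `s` give oscillation bounds on larger balls. -/
theorem enorm_sub_le_of_chain [IsRiemannianManifold (𝓡 d) X] {F : Type*} [NormedAddCommGroup F]
    {f : X → F} {x : X} {s : ℝ} (hs : 0 < s) {n : ℕ} {M : ℝ≥0∞}
    (hM : ∀ p ∈ ball x (n * s), ∀ q ∈ ball x (n * s), dist p q < s → ‖f p - f q‖ₑ ≤ M) :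
    ∀ p ∈ ball x (n * s), ‖f x - f p‖ₑ ≤ n * M := by
  have key : ∀ k : ℕ, k ≤ n → ∀ p ∈ ball x (k * s), ‖f x - f p‖ₑ ≤ k * M := by
    intro k
    induction k with
    | zero => intro _ p hp; simp at hp
    | succ k ih =>
      intro hk p hp
      have hsub : ∀ j : ℕ, j ≤ n → ball x (j * s) ⊆ ball x (n * s) := fun j hj =>
        ball_subset_ball (by gcongr)
      -- The intermediate point exists only for positive radii, so the first link of the chain is
      -- treated directly.
      rcases Nat.eq_zero_or_pos k with rfl | hkpos
      · have hx : x ∈ ball x (n * s) := mem_ball_self (by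
          have : (1 : ℝ) ≤ n := by exact_mod_cast hk
          positivity)
        have := hM x hx p (hsub _ hk hp) (by rw [mem_ball'] at hp; simpa using hp)
        simpa using this
      · rw [mem_ball', Nat.cast_succ, add_mul, one_mul] at hp
        obtain ⟨z, hz1, hz2⟩ := exists_dist_lt_dist_lt (d := d) (by positivity) hs hp
        have hz : z ∈ ball x (k * s) := mem_ball'.2 hz1
        have hp' : p ∈ ball x (n * s) := hsub (k + 1) hk (by
          rw [mem_ball', Nat.cast_succ, add_mul, one_mul]; exact hp)
        have h1 := ih (by omega) z hz
        have h2 := hM z (hsub k (by omega) hz) p hp' hz2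
        calc ‖f x - f p‖ₑ = ‖(f x - f z) + (f z - f p)‖ₑ := by congr 1; abel
          _ ≤ ‖f x - f z‖ₑ + ‖f z - f p‖ₑ := enorm_add_le _ _
          _ ≤ k * M + M := add_le_add h1 h2
          _ = _ := by push_cast; ring
  exact key n le_rfl

variable [IsManifold (𝓡 d) ∞ X]

/-- The image of the Euclidean segment is an admissible path, and its speed is at most Λ‖w - v‖. -/
theorem IsElliptic.edist_symm_le [IsRiemannianManifold (𝓡 d) X] {Λ : ℝ}
    {e : OpenPartialHomeomorph X (E d)} (h : IsElliptic Λ e)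
    (he : e ∈ IsManifold.maximalAtlas (𝓡 d) ∞ X) {v w : E d} (hvw : segment ℝ v w ⊆ e.target) :
    edist (e.symm v) (e.symm w) ≤ ENNReal.ofReal (Λ * ‖w - v‖) := by
  set c : ℝ → E d := fun t => v + t • (w - v) with hc
  have hcmem : ∀ t ∈ Icc (0 : ℝ) 1, c t ∈ e.target := by
    intro t ht
    apply hvw
    rw [segment_eq_image']
    exact ⟨t, ht, rfl⟩
  have hcd : ∀ t, HasDerivAt c (w - v) t := by
    intro t
    exact (((hasDerivAt_id t).smul_const (w - v)).const_add v).congr_deriv (one_smul _ _)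
  have hcs : ContDiff ℝ 1 c := by fun_prop
  have hγ : ContMDiffOn 𝓘(ℝ, ℝ) (𝓡 d) 1 (fun t => e.symm (c t)) (Icc 0 1) :=
    ((contMDiffOn_symm_of_mem_maximalAtlas he).of_le (by simp)).comp
      hcs.contMDiff.contMDiffOn hcmem
  have h1 := edist_le_pathELength zero_le_one hγ
  have hc0 : c 0 = v := by simp [hc]
  have hc1 : c 1 = w := by simp [hc]
  simp only [hc0, hc1] at h1
  refine h1.trans ?_
  rw [pathELength_eq_lintegral_normAt]
  have hder : ∀ t ∈ Icc (0 : ℝ) 1, velocity (d := d) (fun t => e.symm (c t)) t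
      = chartDeriv e (c t) (w - v) := by
    intro t ht
    have := mfderiv_comp t (mdifferentiableAt_symm he (hcmem t ht))
      ((hcd t).differentiableAt.mdifferentiableAt)
    change mfderiv 𝓘(ℝ, ℝ) (𝓡 d) (e.symm ∘ c) t (1 : ℝ) = _
    rw [this, mfderiv_eq_fderiv]
    change chartDeriv e (c t) (fderiv ℝ c t 1) = _
    rw [fderiv_apply_one_eq_deriv, (hcd t).deriv]
  calc _ ≤ ∫⁻ _t in Icc (0 : ℝ) 1, ENNReal.ofReal (Λ * ‖w - v‖) := by
        refine setLIntegral_mono' measurableSet_Icc fun t ht => ?_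
        rw [hder t ht]
        exact ENNReal.ofReal_le_ofReal (h.norm_le _ (hcmem t ht) _)
    _ = _ := by simp

/-- A path from `p` to `q` of length less than `s` cannot leave B(p, s), hence stays in the domain
of the chart. Its coordinate image has length at most Λ times its own. -/
theorem IsElliptic.norm_chart_sub_le [IsRiemannianManifold (𝓡 d) X] {Λ : ℝ} (hΛ : 1 ≤ Λ)
    {e : OpenPartialHomeomorph X (E d)} (h : IsElliptic Λ e)
    (he : e ∈ IsManifold.maximalAtlas (𝓡 d) ∞ X) {p q : X} {s : ℝ} (hpq : dist p q < s)
    (hball : ball p s ⊆ e.source) : ‖e q - e p‖ ≤ Λ * s := by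
  have hs : 0 < s := dist_nonneg.trans_lt hpq
  have hedist : edist p q < ENNReal.ofReal s := by
    rw [edist_dist]
    exact (ENNReal.ofReal_lt_ofReal_iff hs).2 hpq
  obtain ⟨γ, h0, h1, hγ, hlen⟩ := exists_path_of_edist_lt (d := d) hedist
  have hmem : ∀ t ∈ Icc (0 : ℝ) 1, γ t ∈ e.source := by
    intro t ht
    apply hball
    rw [mem_ball', ← ENNReal.ofReal_lt_ofReal_iff hs, ← edist_dist, ← h0]
    exact ((edist_le_pathELength ht.1 hγ.contMDiffOn).trans
      (Manifold.pathELength_mono le_rfl ht.2)).trans_lt hlen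
  have hcmd : ∀ t ∈ Icc (0 : ℝ) 1, ContDiffAt ℝ 1 (fun t => e (γ t)) t := by
    intro t ht
    rw [← contMDiffAt_iff_contDiffAt]
    exact (((contMDiffOn_of_mem_maximalAtlas he).contMDiffAt
      (e.open_source.mem_nhds (hmem t ht))).of_le (by simp)).comp t hγ.contMDiffAt
  have hmain := enorm_sub_le_lintegral_deriv_of_contDiffOn_Icc (f := fun t => e (γ t))
    (fun t ht => (hcmd t ht).contDiffWithinAt) zero_le_one
  simp only [h0, h1] at hmain
  have hder : ∀ t ∈ Icc (0 : ℝ) 1, velocity (d := d) γ t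
      = chartDeriv e (e (γ t)) (deriv (fun t => e (γ t)) t) := by
    intro t ht
    have hloc : γ =ᶠ[𝓝 t] e.symm ∘ fun t => e (γ t) := by
      have : ∀ᶠ t' in 𝓝 t, γ t' ∈ e.source :=
        hγ.continuous.continuousAt (e.open_source.mem_nhds (hmem t ht))
      filter_upwards [this] with t' ht'
      exact (e.left_inv ht').symm
    have hcomp := mfderiv_comp t (mdifferentiableAt_symm he (e.map_source (hmem t ht)))
      (((hcmd t ht).differentiableAt one_ne_zero).mdifferentiableAt)
    rw [mfderiv_eq_fderiv] at hcomp
    have h2 : mfderiv 𝓘(ℝ, ℝ) (𝓡 d) γ t = mfderiv 𝓘(ℝ, ℝ) (𝓡 d) (e.symm ∘ fun t => e (γ t)) t :=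
      hloc.mfderiv_eq
    rw [hcomp] at h2
    have h3 := congrArg (fun A : ℝ →L[ℝ] E d => A 1) h2
    refine h3.trans ?_
    change chartDeriv e (e (γ t)) (fderiv ℝ (fun t => e (γ t)) t 1) = _
    rw [fderiv_apply_one_eq_deriv]
  have hbound : ‖e q - e p‖ₑ ≤ ENNReal.ofReal (Λ * s) := by
    refine hmain.trans ?_
    calc _ ≤ ∫⁻ t in Icc (0 : ℝ) 1, ENNReal.ofReal Λ *
            ENNReal.ofReal (normAt (γ t) (velocity (d := d) γ t)) := by
          refine setLIntegral_mono' measurableSet_Icc fun t ht => ?_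
          have hle := h.le_norm _ (e.map_source (hmem t ht)) (deriv (fun t => e (γ t)) t)
          rw [e.left_inv (hmem t ht), ← hder t ht] at hle
          rw [← ofReal_norm, ← ENNReal.ofReal_mul (by linarith)]
          exact ENNReal.ofReal_le_ofReal hle
      _ = ENNReal.ofReal Λ * Manifold.pathELength (𝓡 d) γ 0 1 := by
          rw [lintegral_const_mul' _ _ ENNReal.ofReal_ne_top,
            pathELength_eq_lintegral_normAt]
      _ ≤ _ := by
          rw [ENNReal.ofReal_mul (by linarith)]
          gcongr
  rw [← ofReal_norm] at hbound
  exact (ENNReal.ofReal_le_ofReal_iff (by positivity)).1 hbound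

/-- In a complete manifold, a small Euclidean ball about the coordinates of a point lies in the
domain of the coordinates. -/
theorem IsElliptic.ball_chart_subset [IsRiemannianManifold (𝓡 d) X] [CompleteSpace X] {Λ : ℝ}
    (hΛ : 1 ≤ Λ) {e : OpenPartialHomeomorph X (E d)} (h : IsElliptic Λ e)
    (he : e ∈ IsManifold.maximalAtlas (𝓡 d) ∞ X) (hconv : Convex ℝ e.target) {p : X} {ρ : ℝ}
    (hp : p ∈ e.source) (hball : closedBall p (Λ * ρ) ⊆ e.source) :
    ball (e p) ρ ⊆ e.target := by
  intro w hw
  by_contra hwt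
  set v := e p with hv
  have hvt : v ∈ e.target := e.map_source hp
  have hwv : ‖w - v‖ < ρ := by rwa [mem_ball, dist_eq_norm] at hw
  set c : ℝ → E d := fun t => v + t • (w - v) with hc
  have hcc : Continuous c := by fun_prop
  set S : Set ℝ := Icc 0 1 ∩ c ⁻¹' e.targetᶜ with hS
  have hSc : IsCompact S :=
    isCompact_Icc.inter_right (e.open_target.isClosed_compl.preimage hcc)
  have hSne : S.Nonempty := ⟨1, ⟨zero_le_one, le_rfl⟩, by simpa [hc] using hwt⟩
  -- The first time at which the segment towards `w` is outside the range of the chart.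
  obtain ⟨t₀, ht₀, hmin⟩ := hSc.exists_isLeast hSne
  have ht₀pos : 0 < t₀ := by
    refine lt_of_le_of_ne ht₀.1.1 fun h => ht₀.2 ?_
    rw [← h]
    simpa [hc] using hvt
  have hmem : ∀ t ∈ Ico 0 t₀, c t ∈ e.target := by
    intro t ht
    by_contra hct
    exact absurd (hmin ⟨⟨ht.1, ht.2.le.trans ht₀.1.2⟩, hct⟩) (not_le.2 ht.2)
  have hdist : ∀ s ∈ Ico 0 t₀, ∀ t ∈ Ico 0 t₀,
      dist (e.symm (c s)) (e.symm (c t)) ≤ Λ * ‖w - v‖ * dist s t := by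
    intro s hs t ht
    have h1 := h.edist_symm_le he (hconv.segment_subset (hmem s hs) (hmem t ht))
    rw [edist_dist, ENNReal.ofReal_le_ofReal_iff (by positivity)] at h1
    have h2 : c t - c s = (t - s) • (w - v) := by
      simp only [hc, sub_smul]
      abel
    rw [h2, norm_smul, ← dist_eq_norm, dist_comm t s] at h1
    linarith
  have hlip : LipschitzOnWith (Real.toNNReal (Λ * ‖w - v‖)) (fun t => e.symm (c t)) (Ico 0 t₀) := by
    refine LipschitzOnWith.of_dist_le_mul fun s hs t ht => ?_
    rw [Real.coe_toNNReal _ (by positivity)]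
    exact hdist s hs t ht
  have hle : 𝓝[<] t₀ ≤ 𝓟 (Ico 0 t₀) := le_principal_iff.2 (Ico_mem_nhdsLT ht₀pos)
  -- The lifted segment is Lipschitz before `t₀`, so completeness gives it a limit in X. The limit
  -- lies in the closed ball inside the domain of `e`, hence its coordinates, which are `c t₀`, lie
  -- in the range: a contradiction.
  have hcau : Cauchy (map (fun t => e.symm (c t)) (𝓝[<] t₀)) :=
    (cauchy_nhds.mono nhdsWithin_le_nhds).map_of_le hlip.uniformContinuousOn hle
  obtain ⟨x, hx⟩ := CompleteSpace.complete hcau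
  have hxt : Tendsto (fun t => e.symm (c t)) (𝓝[<] t₀) (𝓝 x) := hx
  have hev : ∀ᶠ t in 𝓝[<] t₀, t ∈ Ico 0 t₀ := hle (mem_principal_self _)
  have hxs : x ∈ e.source := by
    apply hball
    refine isClosed_closedBall.mem_of_tendsto hxt ?_
    filter_upwards [hev] with t ht
    have h0 := hdist t ht 0 ⟨le_rfl, ht₀pos⟩
    have hc0 : e.symm (c 0) = p := by simp [hc, hv, e.left_inv hp]
    rw [hc0, Real.dist_eq, sub_zero, abs_of_nonneg ht.1] at h0
    refine mem_closedBall.2 (h0.trans ?_)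
    have : t ≤ 1 := ht.2.le.trans ht₀.1.2
    calc Λ * ‖w - v‖ * t ≤ Λ * ‖w - v‖ * 1 := by gcongr
      _ ≤ Λ * ρ := by rw [mul_one]; gcongr
  have h1 : Tendsto (fun t => e (e.symm (c t))) (𝓝[<] t₀) (𝓝 (e x)) :=
    (e.continuousAt hxs).tendsto.comp hxt
  have h2 : Tendsto c (𝓝[<] t₀) (𝓝 (c t₀)) := (hcc.tendsto t₀).mono_left nhdsWithin_le_nhds
  have h3 : c t₀ = e x := by
    refine tendsto_nhds_unique (h2.congr' ?_) h1
    filter_upwards [hev] with t ht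
    exact (e.right_inv (hmem t ht)).symm
  exact ht₀.2 (h3 ▸ e.map_source hxs)

end Distance

end Elliptic

/-! ### Uniform ellipticity under bounded geometry -/

section BoundedGeometry

variable {d : ℕ} {X : Type*} [MetricSpace X] [ChartedSpace (E d) X]
  [RiemannianBundle (fun p : X => TangentSpace (𝓡 d) p)]

theorem GeodesicChart.symm_zero {y : X} {ρ : ℝ} (hρ : 0 < ρ) (θ : GeodesicChart d y ρ) :
    θ.chart.symm 0 = y := by
  have hy : y ∈ θ.chart.source := by
    rw [θ.source_eq]
    exact mem_ball_self hρ
  rw [← θ.map_center, θ.chart.left_inv hy]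

/-- The differential of geodesic coordinates at the centre is isometric. -/
theorem GeodesicChart.normAt_center {y : X} {ρ : ℝ} (hρ : 0 < ρ) (θ : GeodesicChart d y ρ)
    (ξ : E d) : normAt y (chartDeriv θ.chart 0 ξ) = ‖ξ‖ := by
  have h := metricAt_chartDeriv θ.chart 0 ξ ξ
  rw [θ.orthonormal, θ.symm_zero hρ, ← normAt_sq] at h
  have h2 : normAt y (chartDeriv θ.chart 0 ξ) ^ 2 = ‖ξ‖ ^ 2 := by
    rw [h, EuclideanSpace.norm_sq_eq]
    refine Finset.sum_congr rfl fun i _ => ?_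
    rw [Finset.sum_eq_single i]
    · simp [sq]
    · intro j _ hj
      simp [hj.symm]
    · simp
  exact (pow_left_inj₀ (normAt_nonneg _ _) (norm_nonneg _) two_ne_zero).1 h2

theorem norm_clm_le_of_basis {C : ℝ} {A : E d →L[ℝ] E d} (h : ∀ i, ‖A (basisVec i)‖ ≤ C)
    (ξ : E d) : ‖A ξ‖ ≤ d * C * ‖ξ‖ := by
  conv_lhs => rw [← sum_smul_basisVec ξ]
  rw [map_sum]
  calc ‖∑ i, A (ξ i • basisVec i)‖ ≤ ∑ i, ‖A (ξ i • basisVec i)‖ := norm_sum_le _ _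
    _ ≤ ∑ _i : Fin d, C * ‖ξ‖ := by
        refine Finset.sum_le_sum fun i _ => ?_
        rw [map_smul, norm_smul, mul_comm]
        exact mul_le_mul (h i) (PiLp.norm_apply_le ξ i) (norm_nonneg _)
          ((norm_nonneg _).trans (h i))
    _ = _ := by simp; ring

/-- The strict margin provides coordinates on a ball larger than `lam`, in whose range the closed
ball of radius `lam` is compact. -/
theorem exists_geodesicChart_of_lt_injRadius {lam : ℝ}
    (hinj : ENNReal.ofReal lam < injRadius d X) : ∃ lam' : ℝ, lam < lam' ∧
      ∀ s : ℝ, 0 < s → s ≤ lam' → ∀ y : X, Nonempty (GeodesicChart d y s) := by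
  rw [injRadius] at hinj
  obtain ⟨ρ, hρ⟩ := lt_iSup_iff.1 hinj
  obtain ⟨h, hlt⟩ := lt_iSup_iff.1 hρ
  exact ⟨ρ,  lt_of_not_ge fun hle => absurd hlt (not_lt.2 (ENNReal.ofReal_le_ofReal hle)), h⟩

/-- The Riemannian norm at a point w is the Euclidean norm in geodesic coordinates centred at w.
Hence the distortion of any other geodesic chart at w is that of the Jacobian of a transition map,
in one direction or the other, and both are bounded by the first order case of the hypothesis. -/
theorem exists_isElliptic_of_hasBoundedGeometry [IsManifold (𝓡 d) ∞ X]
    (hX : HasBoundedGeometry d X) {lam : ℝ} (hlam : 0 < lam)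
    (hinj : ENNReal.ofReal lam < injRadius d X) :
    ∃ Λ : ℝ, 1 ≤ Λ ∧ ∀ (y : X) (θ : GeodesicChart d y lam), IsElliptic Λ θ.chart := by
  obtain ⟨C, hC⟩ := hX.transition_bound lam hlam hinj 1
  obtain ⟨lam', hlam', hne⟩ := exists_geodesicChart_of_lt_injRadius hinj
  have hjac : ∀ (x y : X) (θx : GeodesicChart d x lam) (θy : GeodesicChart d y lam),
      ∀ v ∈ ball (0 : E d) lam, θy.chart.symm v ∈ ball x lam → ∀ ξ : E d,
        ‖fderiv ℝ (fun w => θx.chart (θy.chart.symm w)) v ξ‖ ≤ max 1 (d * C) * ‖ξ‖ := by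
    intro x y θx θy v hv hvx ξ
    refine (norm_clm_le_of_basis (C := C) (fun i => ?_) ξ).trans
      (mul_le_mul_of_nonneg_right (le_max_right _ _) (norm_nonneg _))
    have := hC x y θx θy v hv hvx (Pi.single i 1) (order_single i).le
    rwa [multiDeriv_single] at this
  refine ⟨max 1 (d * C), le_max_left _ _, fun y θ => ?_⟩
  have key : ∀ v ∈ θ.chart.target, ∀ ξ : E d,
      normAt (θ.chart.symm v) (chartDeriv θ.chart v ξ) ≤ max 1 (d * C) * ‖ξ‖ ∧
        ‖ξ‖ ≤ max 1 (d * C) * normAt (θ.chart.symm v) (chartDeriv θ.chart v ξ) := by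
    intro v hv ξ
    set w := θ.chart.symm v with hw
    obtain ⟨θw⟩ := hne lam hlam hlam'.le w
    have hwθ : w ∈ θw.chart.source := by
      rw [θw.source_eq]
      exact mem_ball_self hlam
    have hv' : v ∈ ball (0 : E d) lam := by rwa [← θ.target_eq]
    have hnorm : normAt w (chartDeriv θ.chart v ξ)
        = ‖fderiv ℝ (fun z => θw.chart (θ.chart.symm z)) v ξ‖ := by
      rw [chartDeriv_eq_comp θ.smooth θw.smooth hv hwθ, ContinuousLinearMap.comp_apply, ← hw,
        θw.map_center]
      exact θw.normAt_center hlam _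
    rw [hnorm]
    refine ⟨hjac w y θw θ v hv' (mem_ball_self hlam) ξ, ?_⟩
    -- The lower bound is the upper bound for the inverse transition map, taken at the origin of the
    -- chart centred at `w`.
    have hcomp := fderiv_transition_comp θ.smooth θw.smooth hv hwθ
    have hξ := congrArg (fun A : E d →L[ℝ] E d => A ξ) hcomp
    simp only [ContinuousLinearMap.comp_apply, ContinuousLinearMap.id_apply, ← hw,
      θw.map_center] at hξ
    conv_lhs => rw [← hξ]
    refine hjac y w θ θw 0 (mem_ball_self hlam) ?_ _
    rw [θw.symm_zero hlam, ← θ.source_eq]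
    exact θ.chart.map_target hv
  exact ⟨fun v hv ξ => (key v hv ξ).1, fun v hv ξ => (key v hv ξ).2⟩

end BoundedGeometry

/-! ### Smoothness of the Christoffel symbols -/

section Christoffel

variable {d : ℕ} {X : Type*} [MetricSpace X] [ChartedSpace (E d) X]

theorem injective_chartDeriv [IsManifold (𝓡 d) ∞ X] {e : OpenPartialHomeomorph X (E d)}
    (he : e ∈ IsManifold.maximalAtlas (𝓡 d) ∞ X) {v : E d} (hv : v ∈ e.target) :
    Function.Injective (chartDeriv e v) := by
  have h1 : mfderiv (𝓡 d) (𝓡 d) (e ∘ e.symm) v = ContinuousLinearMap.id ℝ (E d) := by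
    have : (e ∘ e.symm : E d → E d) =ᶠ[𝓝 v] id := by
      filter_upwards [e.open_target.mem_nhds hv] with w hw
      exact e.right_inv hw
    rw [this.mfderiv_eq]
    exact mfderiv_id
  have h2 := mfderiv_comp v (mdifferentiableAt_chart he (e.map_target hv))
    (mdifferentiableAt_symm he hv)
  rw [h1] at h2
  refine Function.LeftInverse.injective
    (g := fun ζ : E d => (mfderiv (𝓡 d) (𝓡 d) e (e.symm v) : E d → E d) ζ) fun ξ => ?_
  exact (congrArg (fun A : E d →L[ℝ] E d => A ξ) h2).symm

variable [RiemannianBundle (fun p : X => TangentSpace (𝓡 d) p)]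

theorem normAt_chartDeriv_pos [IsManifold (𝓡 d) ∞ X] {e : OpenPartialHomeomorph X (E d)}
    (he : e ∈ IsManifold.maximalAtlas (𝓡 d) ∞ X) {v : E d} (hv : v ∈ e.target) {ξ : E d}
    (hξ : ξ ≠ 0) : 0 < normAt (e.symm v) (chartDeriv e v ξ) := by
  have h : chartDeriv e v ξ ≠ 0 := fun h =>
    hξ (injective_chartDeriv he hv (h.trans (map_zero _).symm))
  exact norm_pos_iff (E := TangentSpace (𝓡 d) (e.symm v)).2 h

/-- A vector in the kernel of the metric matrix would have length zero, although the differential of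
a chart is injective and the metric is positive definite. -/
theorem det_metricMatrix_ne_zero [IsManifold (𝓡 d) ∞ X] {e : OpenPartialHomeomorph X (E d)}
    (he : e ∈ IsManifold.maximalAtlas (𝓡 d) ∞ X) {v : E d} (hv : v ∈ e.target) :
    (metricMatrix e v).det ≠ 0 := by
  intro h
  obtain ⟨ξ, hξ, h0⟩ := Matrix.exists_mulVec_eq_zero_iff.2 h
  have hξ' : WithLp.toLp 2 ξ ≠ 0 := fun h => hξ (congrArg WithLp.ofLp h)
  have hpos := normAt_chartDeriv_pos he hv hξ'
  have h1 := metricAt_chartDeriv e v (WithLp.toLp 2 ξ) (WithLp.toLp 2 ξ)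
  rw [← normAt_sq] at h1
  have h2 : ∑ i, ∑ j, ξ i * ξ j * metricMatrix e v i j = ∑ i, ξ i * (metricMatrix e v).mulVec ξ i := by
    refine Finset.sum_congr rfl fun i _ => ?_
    rw [Matrix.mulVec, dotProduct, Finset.mul_sum]
    exact Finset.sum_congr rfl fun j _ => by ring
  have h3 : normAt (e.symm v) (chartDeriv e v (WithLp.toLp 2 ξ)) ^ 2 = 0 := by
    rw [h1]
    refine h2.trans ?_
    simp [h0]
  nlinarith

theorem contDiffOn_det {F : Type*} [NormedAddCommGroup F] [NormedSpace ℝ F] {s : Set F} {n : ℕ}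
    {M : F → Matrix (Fin n) (Fin n) ℝ} (h : ∀ i j, ContDiffOn ℝ ∞ (fun v => M v i j) s) :
    ContDiffOn ℝ ∞ (fun v => (M v).det) s := by
  simp only [Matrix.det_apply]
  refine ContDiffOn.sum fun σ _ => ContDiffOn.const_smul _ ?_
  exact contDiffOn_prod fun i _ => h _ _

/-- Cramer's rule: the entries of the inverse are determinants divided by the nonvanishing
determinant. -/
theorem contDiffOn_matrix_inv {F : Type*} [NormedAddCommGroup F] [NormedSpace ℝ F] {s : Set F}
    {n : ℕ} {M : F → Matrix (Fin n) (Fin n) ℝ} (h : ∀ i j, ContDiffOn ℝ ∞ (fun v => M v i j) s)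
    (h0 : ∀ v ∈ s, (M v).det ≠ 0) (i j : Fin n) :
    ContDiffOn ℝ ∞ (fun v => (M v)⁻¹ i j) s := by
  simp only [Matrix.inv_def, Matrix.smul_apply, smul_eq_mul, Ring.inverse_eq_inv']
  refine ((contDiffOn_det h).inv h0).mul ?_
  simp only [Matrix.adjugate_apply]
  refine contDiffOn_det fun k l => ?_
  by_cases hk : k = j
  · subst hk
    simp only [Matrix.updateRow_self]
    exact contDiffOn_const
  · simp only [Matrix.updateRow_ne hk]
    exact h k l

theorem contDiffOn_partialDeriv {F : Type*} [NormedAddCommGroup F] [NormedSpace ℝ F]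
    {s : Set (E d)} (hs : IsOpen s) {u : E d → F} (hu : ContDiffOn ℝ ∞ u s) (i : Fin d) :
    ContDiffOn ℝ ∞ (partialDeriv i u) s :=
  (hu.fderiv_of_isOpen hs (m := ∞) le_rfl).clm_apply contDiffOn_const

theorem contDiffOn_christoffel [IsManifold (𝓡 d) ∞ X] [IsContMDiffRiemannianBundle (𝓡 d) ∞ (E d)
    (fun p : X => TangentSpace (𝓡 d) p)] {e : OpenPartialHomeomorph X (E d)}
    (he : e ∈ IsManifold.maximalAtlas (𝓡 d) ∞ X) (k i j : Fin d) :
    ContDiffOn ℝ ∞ (fun v => christoffel e v k i j) e.target := by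
  have hg := contDiffOn_metricMatrix he
  have hpd := fun a i j => contDiffOn_partialDeriv e.open_target (hg i j) a
  have hinv := contDiffOn_matrix_inv hg fun v hv => det_metricMatrix_ne_zero he hv
  unfold christoffel
  refine contDiffOn_const.mul (ContDiffOn.sum fun l _ => (hinv k l).mul ?_)
  exact ((hpd i j l).add (hpd j i l)).sub (hpd l i j)

end Christoffel

/-! ### Uniqueness of geodesics and of geodesic coordinates -/

section Geodesics

variable {d : ℕ} {X : Type*} [MetricSpace X] [ChartedSpace (E d) X]
  [RiemannianBundle (fun p : X => TangentSpace (𝓡 d) p)]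

/-- The geodesic spray in the chart `e`. -/
noncomputable def geodesicField (e : OpenPartialHomeomorph X (E d)) (z : E d × E d) : E d × E d :=
  (z.2, WithLp.toLp 2 fun k => -∑ i, ∑ j, christoffel e z.1 k i j * z.2 i * z.2 j)

theorem deriv_euclidean_apply {c : ℝ → E d} {t : ℝ} (hc : DifferentiableAt ℝ c t) (k : Fin d) :
    deriv (fun s => c s k) t = deriv c t k :=
  ((EuclideanSpace.proj (𝕜 := ℝ) k).hasFDerivAt.comp_hasDerivAt t hc.hasDerivAt).deriv

theorem IsGeodesicOn.contDiffAt_chart {e : OpenPartialHomeomorph X (E d)}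
    (he : e ∈ IsManifold.maximalAtlas (𝓡 d) ∞ X) {γ : ℝ → X} {J : Set ℝ} (hJ : IsOpen J)
    (hγ : IsGeodesicOn (d := d) γ J) {t : ℝ} (ht : t ∈ J) (hs : γ t ∈ e.source) :
    ContDiffAt ℝ ∞ (fun s => e (γ s)) t := by
  rw [← contMDiffAt_iff_contDiffAt]
  exact ((contMDiffOn_of_mem_maximalAtlas he).contMDiffAt (e.open_source.mem_nhds hs)).comp t
    (hγ.1.contMDiffAt (hJ.mem_nhds ht))

/-- Position and velocity together solve a first order system, to which uniqueness for ordinary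
differential equations applies. -/
theorem IsGeodesicOn.hasDerivAt {e : OpenPartialHomeomorph X (E d)}
    (he : e ∈ IsManifold.maximalAtlas (𝓡 d) ∞ X) {γ : ℝ → X} {J : Set ℝ} (hJ : IsOpen J)
    (hγ : IsGeodesicOn (d := d) γ J) {t : ℝ} (ht : t ∈ J) (hs : γ t ∈ e.source) :
    HasDerivAt (fun s => (e (γ s), deriv (fun s => e (γ s)) s))
      (geodesicField e (e (γ t), deriv (fun s => e (γ s)) t)) t := by
  set c : ℝ → E d := fun s => e (γ s) with hc
  have hcd : ContDiffAt ℝ ∞ c t := hγ.contDiffAt_chart he hJ ht hs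
  have hdiff : ∀ᶠ s in 𝓝 t, DifferentiableAt ℝ c s := by
    have h1 : ContDiffAt ℝ 1 c t := hcd.of_le (by simp)
    filter_upwards [h1.eventually (by simp)] with s hs
    exact hs.differentiableAt one_ne_zero
  have hdc : DifferentiableAt ℝ (deriv c) t := by
    have h2 : ContDiffAt ℝ ∞ (fderiv ℝ c) t := hcd.fderiv_right (m := ∞) le_rfl
    exact (h2.differentiableAt (by simp)).clm_apply (differentiableAt_const (1 : ℝ))
  have hfield : deriv (deriv c) t = (geodesicField e (c t, deriv c t)).2 := by
    ext k
    have h1 := hγ.2 e he t ht hs k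
    have h2 : deriv (deriv fun s => e (γ s) k) t = deriv (deriv c) t k := by
      rw [← deriv_euclidean_apply hdc k]
      refine Filter.EventuallyEq.deriv_eq ?_
      filter_upwards [hdiff] with s hs
      exact deriv_euclidean_apply hs k
    have h3 : ∀ i, deriv (fun s => e (γ s) i) t = deriv c t i := fun i =>
      deriv_euclidean_apply hdiff.self_of_nhds i
    simp only [h2, h3] at h1
    change _ = -∑ i, ∑ j, christoffel e (c t) k i j * deriv c t i * deriv c t j
    linarith
  have h := hdiff.self_of_nhds.hasDerivAt.prodMk hdc.hasDerivAt
  rw [hfield] at h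
  exact h

variable [IsManifold (𝓡 d) ∞ X]

theorem contDiffOn_geodesicField [IsContMDiffRiemannianBundle (𝓡 d) ∞ (E d)
    (fun p : X => TangentSpace (𝓡 d) p)] {e : OpenPartialHomeomorph X (E d)}
    (he : e ∈ IsManifold.maximalAtlas (𝓡 d) ∞ X) :
    ContDiffOn ℝ ∞ (geodesicField e) (e.target ×ˢ univ) := by
  refine contDiffOn_snd.prodMk ?_
  rw [contDiffOn_euclidean]
  intro k
  have hcoord : ∀ i : Fin d, ContDiffOn ℝ ∞ (fun z : E d × E d => z.2 i) (e.target ×ˢ univ) :=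
    fun i => contDiffOn_euclidean.1 contDiffOn_snd i
  refine ContDiffOn.neg (ContDiffOn.sum fun i _ => ContDiffOn.sum fun j _ => ?_)
  refine (ContDiffOn.mul ?_ (hcoord i)).mul (hcoord j)
  exact (contDiffOn_christoffel he k i j).comp contDiffOn_fst fun z hz => hz.1

/-- Geodesics with the same initial data agree. -/
theorem IsGeodesicOn.eq_of_initial [IsContMDiffRiemannianBundle (𝓡 d) ∞ (E d)
    (fun p : X => TangentSpace (𝓡 d) p)] {e : OpenPartialHomeomorph X (E d)}
    (he : e ∈ IsManifold.maximalAtlas (𝓡 d) ∞ X) {R : ℝ} (htarget : e.target = ball 0 R)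
    {γ γ' : ℝ → X} {J J' : Set ℝ} (hJ : IsOpen J) (hJ' : IsOpen J')
    (hγ : IsGeodesicOn (d := d) γ J) (hγ' : IsGeodesicOn (d := d) γ' J')
    (hIJ : Icc 0 1 ⊆ J) (hIJ' : Icc 0 1 ⊆ J') (hs : ∀ t ∈ Icc (0 : ℝ) 1, γ t ∈ e.source)
    (hs' : ∀ t ∈ Icc (0 : ℝ) 1, γ' t ∈ e.source) (h0 : γ 0 = γ' 0)
    (h1 : deriv (fun s => e (γ s)) 0 = deriv (fun s => e (γ' s)) 0) : γ 1 = γ' 1 := by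
  set z : ℝ → E d × E d := fun s => (e (γ s), deriv (fun s => e (γ s)) s) with hz
  set z' : ℝ → E d × E d := fun s => (e (γ' s), deriv (fun s => e (γ' s)) s) with hz'
  have hd : ∀ t ∈ Icc (0 : ℝ) 1, HasDerivAt z (geodesicField e (z t)) t := fun t ht =>
    hγ.hasDerivAt he hJ (hIJ ht) (hs t ht)
  have hd' : ∀ t ∈ Icc (0 : ℝ) 1, HasDerivAt z' (geodesicField e (z' t)) t := fun t ht =>
    hγ'.hasDerivAt he hJ' (hIJ' ht) (hs' t ht)
  have hzc : ContinuousOn z (Icc 0 1) := fun t ht => (hd t ht).continuousAt.continuousWithinAt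
  have hzc' : ContinuousOn z' (Icc 0 1) := fun t ht => (hd' t ht).continuousAt.continuousWithinAt
  -- Uniqueness needs a set on which the field is Lipschitz and which neither solution leaves. Over
  -- the compact time interval the positions stay in a strictly smaller ball and the velocities are
  -- bounded, so a product of closed balls, compact and convex, will serve.
  have hcomp : ∀ (z : ℝ → E d × E d), ContinuousOn z (Icc 0 1) →
      (∀ t ∈ Icc (0 : ℝ) 1, (z t).1 ∈ ball (0 : E d) R) →
      ∃ s < R, ∃ S, ∀ t ∈ Icc (0 : ℝ) 1, z t ∈ closedBall (0 : E d) s ×ˢ closedBall (0 : E d) S := by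
    intro z hz hzR
    obtain ⟨t₁, ht₁, hmax⟩ := isCompact_Icc.exists_isMaxOn
      (nonempty_Icc.2 (zero_le_one (α := ℝ))) (continuous_fst.comp_continuousOn hz).norm
    obtain ⟨S, hS⟩ := isCompact_Icc.exists_bound_of_continuousOn
      (continuous_snd.comp_continuousOn hz)
    refine ⟨‖(z t₁).1‖, by simpa using hzR t₁ ht₁, S, fun t ht => ⟨?_, ?_⟩⟩
    · simpa using hmax ht
    · simpa using hS t ht
  obtain ⟨s, hsR, S, hS⟩ := hcomp z hzc fun t ht => htarget ▸ e.map_source (hs t ht)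
  obtain ⟨s', hsR', S', hS'⟩ := hcomp z' hzc' fun t ht => htarget ▸ e.map_source (hs' t ht)
  set K : Set (E d × E d) := closedBall 0 (max s s') ×ˢ closedBall 0 (max S S') with hK
  have hKc : IsCompact K := (isCompact_closedBall _ _).prod (isCompact_closedBall _ _)
  have hKconv : Convex ℝ K := (convex_closedBall _ _).prod (convex_closedBall _ _)
  have hKsub : K ⊆ e.target ×ˢ univ := by
    refine prod_mono ?_ (subset_univ _)
    rw [htarget]
    exact closedBall_subset_ball (max_lt hsR hsR')
  obtain ⟨L, hL⟩ := ((contDiffOn_geodesicField he).mono hKsub).exists_lipschitzOnWith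
    (by simp) hKconv hKc
  have hzK : ∀ t ∈ Icc (0 : ℝ) 1, z t ∈ K := fun t ht =>
    prod_mono (closedBall_subset_closedBall (le_max_left _ _))
      (closedBall_subset_closedBall (le_max_left _ _)) (hS t ht)
  have hzK' : ∀ t ∈ Icc (0 : ℝ) 1, z' t ∈ K := fun t ht =>
    prod_mono (closedBall_subset_closedBall (le_max_right _ _))
      (closedBall_subset_closedBall (le_max_right _ _)) (hS' t ht)
  have huniq := ODE_solution_unique_of_mem_Icc_right (v := fun _ => geodesicField e)
    (s := fun _ => K) (K := L) (fun _ _ => hL) hzc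
    (fun t ht => (hd t (Ico_subset_Icc_self ht)).hasDerivWithinAt)
    (fun t ht => hzK t (Ico_subset_Icc_self ht)) hzc'
    (fun t ht => (hd' t (Ico_subset_Icc_self ht)).hasDerivWithinAt)
    (fun t ht => hzK' t (Ico_subset_Icc_self ht)) (by simp only [hz, hz', h0, h1])
  have hend := congrArg Prod.fst (huniq (right_mem_Icc.2 zero_le_one))
  exact e.injOn (hs 1 (right_mem_Icc.2 zero_le_one)) (hs' 1 (right_mem_Icc.2 zero_le_one)) hend

/-- Geodesic coordinates about the same point differ by a linear isometry. -/
theorem GeodesicChart.exists_isometry [IsContMDiffRiemannianBundle (𝓡 d) ∞ (E d)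
    (fun p : X => TangentSpace (𝓡 d) p)] {x : X} {r R : ℝ} (hr : 0 < r) (hrR : r ≤ R)
    (θ : GeodesicChart d x r) (θ' : GeodesicChart d x R) :
    ∃ A : E d →L[ℝ] E d, (∀ ξ, ‖A ξ‖ = ‖ξ‖) ∧
      ∀ v ∈ ball (0 : E d) r, θ'.chart (θ.chart.symm v) = A v := by
  have hR : 0 < R := hr.trans_le hrR
  set τ : E d → E d := fun w => θ'.chart (θ.chart.symm w) with hτ
  have hsrc : ∀ v ∈ ball (0 : E d) r, θ.chart.symm v ∈ θ'.chart.source := by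
    intro v hv
    rw [θ'.source_eq]
    refine ball_subset_ball hrR ?_
    rw [← θ.source_eq]
    exact θ.chart.map_target (θ.target_eq ▸ hv)
  have h0r : (0 : E d) ∈ ball (0 : E d) r := mem_ball_self hr
  have h0t : (0 : E d) ∈ θ.chart.target := θ.target_eq ▸ h0r
  have hτ0 : τ 0 = 0 := by
    simp only [hτ]
    rw [θ.symm_zero hr, θ'.map_center]
  set A := fderiv ℝ τ 0 with hA
  have hτd : HasFDerivAt τ A 0 := ((contDiffAt_transition θ.smooth θ'.smooth h0t
    (hsrc 0 h0r)).differentiableAt (by simp)).hasFDerivAt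
  have hiso : ∀ ξ, ‖A ξ‖ = ‖ξ‖ := by
    intro ξ
    have h1 := chartDeriv_eq_comp θ.smooth θ'.smooth h0t (hsrc 0 h0r)
    rw [θ.symm_zero hr, θ'.map_center] at h1
    rw [← θ.normAt_center hr ξ, h1, ContinuousLinearMap.comp_apply, θ'.normAt_center hR]
  refine ⟨A, hiso, fun v hv => ?_⟩
  have hball : ∀ {ζ : E d} {ρ : ℝ}, ‖ζ‖ < ρ → ∀ t ∈ Icc (0 : ℝ) 1, ‖t • ζ‖ < ρ := by
    intro ζ ρ hζ t ht
    rw [norm_smul, Real.norm_of_nonneg ht.1]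
    exact (mul_le_of_le_one_left (norm_nonneg _) ht.2).trans_lt hζ
  have hvr : ‖v‖ < r := by simpa using hv
  have hAv : ‖A v‖ < R := by rw [hiso]; linarith
  have hopen : ∀ (ζ : E d) (ρ : ℝ), IsOpen {t : ℝ | ‖t • ζ‖ < ρ} := fun ζ ρ =>
    isOpen_lt (by fun_prop) continuous_const
  have hsrc' : ∀ t ∈ Icc (0 : ℝ) 1, θ'.chart.symm (t • A v) ∈ θ'.chart.source := fun t ht =>
    θ'.chart.map_target (by rw [θ'.target_eq]; simpa using hball hAv t ht)
  have hline : ∀ ζ : E d, HasDerivAt (fun t : ℝ => t • ζ) ζ 0 := fun ζ => by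
    simpa using (hasDerivAt_id (0 : ℝ)).smul_const ζ
  have hd1 : deriv (fun s : ℝ => θ'.chart (θ.chart.symm (s • v))) 0 = A v := by
    have h2 : HasFDerivAt τ A ((0 : ℝ) • v) := by rwa [zero_smul]
    exact (h2.comp_hasDerivAt (0 : ℝ) (hline v)).deriv
  have hd2 : deriv (fun s : ℝ => θ'.chart (θ'.chart.symm (s • A v))) 0 = A v := by
    have : (fun s : ℝ => θ'.chart (θ'.chart.symm (s • A v))) =ᶠ[𝓝 0] fun s => s • A v := by
      have hmem : {t : ℝ | ‖t • A v‖ < R} ∈ 𝓝 (0 : ℝ) := (hopen _ _).mem_nhds (by simpa using hR)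
      filter_upwards [hmem] with s hs
      refine θ'.chart.right_inv ?_
      rw [θ'.target_eq]
      simpa using hs
    rw [this.deriv_eq, (hline _).deriv]
  -- The curves `θ(tv)` and `θ'(t A v)` are geodesics from `x` whose initial velocity in the
  -- coordinates `θ'` is `A v`; they agree at time 1.
  have hfin := IsGeodesicOn.eq_of_initial θ'.smooth θ'.target_eq (hopen v r) (hopen (A v) R)
    (θ.geodesic v) (θ'.geodesic (A v)) (hball hvr) (hball hAv)
    (fun t ht => hsrc _ (by simpa using hball hvr t ht)) hsrc'
    (by simp only [zero_smul]; rw [θ.symm_zero hr, θ'.symm_zero hR]) (hd1.trans hd2.symm)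
  simp only [one_smul] at hfin
  rw [hfin, θ'.chart.right_inv]
  rw [θ'.target_eq]
  simpa using hAv

end Geodesics

/-! ### Uniform ellipticity on homogeneous manifolds -/

section Transport

variable {d : ℕ} {X : Type*} [MetricSpace X] [ChartedSpace (E d) X]

/-- The differential of a diffeomorphism, the tangent spaces being identified with `ℝ^d`. -/
noncomputable def diffDeriv (Φ : Diffeomorph (𝓡 d) (𝓡 d) X X ∞) (p : X) : E d →L[ℝ] E d :=
  mfderiv (𝓡 d) (𝓡 d) Φ p

theorem diffDeriv_symm_apply (Φ : Diffeomorph (𝓡 d) (𝓡 d) X X ∞) (p : X) (ξ : E d) :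
    diffDeriv Φ (Φ.symm p) (diffDeriv Φ.symm p ξ) = ξ := by
  have h1 := mfderiv_comp p (Φ.contMDiff.mdifferentiable (by simp) (Φ.symm p))
    (Φ.symm.contMDiff.mdifferentiable (by simp) p)
  have h2 : (Φ ∘ Φ.symm : X → X) = id := by
    funext q
    simp
  rw [h2] at h1
  exact (congrArg (fun A : E d →L[ℝ] E d => A ξ) (h1.symm.trans mfderiv_id))

/-- The chart `e ∘ Φ`. -/
noncomputable def pullChart (Φ : Diffeomorph (𝓡 d) (𝓡 d) X X ∞)
    (e : OpenPartialHomeomorph X (E d)) : OpenPartialHomeomorph X (E d) :=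
  Φ.toHomeomorph.toOpenPartialHomeomorph.trans e

theorem pullChart_apply (Φ : Diffeomorph (𝓡 d) (𝓡 d) X X ∞) (e : OpenPartialHomeomorph X (E d))
    (p : X) : pullChart Φ e p = e (Φ p) := rfl

theorem pullChart_symm_apply (Φ : Diffeomorph (𝓡 d) (𝓡 d) X X ∞)
    (e : OpenPartialHomeomorph X (E d)) (v : E d) :
    (pullChart Φ e).symm v = Φ.symm (e.symm v) := rfl

theorem pullChart_source (Φ : Diffeomorph (𝓡 d) (𝓡 d) X X ∞) (e : OpenPartialHomeomorph X (E d)) :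
    (pullChart Φ e).source = Φ ⁻¹' e.source := by
  simp [pullChart]

theorem pullChart_target (Φ : Diffeomorph (𝓡 d) (𝓡 d) X X ∞) (e : OpenPartialHomeomorph X (E d)) :
    (pullChart Φ e).target = e.target := by
  simp [pullChart]

section Metric

variable [RiemannianBundle (fun p : X => TangentSpace (𝓡 d) p)]

/-- The diffeomorphism `Φ` preserves the metric tensor. -/
def PreservesMetric (Φ : Diffeomorph (𝓡 d) (𝓡 d) X X ∞) : Prop :=
  ∀ (p : X) (ξ η : E d), metricAt (Φ p) (diffDeriv Φ p ξ) (diffDeriv Φ p η) = metricAt p ξ η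

theorem PreservesMetric.symm {Φ : Diffeomorph (𝓡 d) (𝓡 d) X X ∞} (h : PreservesMetric Φ) :
    PreservesMetric Φ.symm := by
  intro p ξ η
  rw [← h, diffDeriv_symm_apply, diffDeriv_symm_apply, Φ.apply_symm_apply]

theorem PreservesMetric.normAt {Φ : Diffeomorph (𝓡 d) (𝓡 d) X X ∞} (h : PreservesMetric Φ)
    (p : X) (ξ : E d) : normAt (Φ p) (diffDeriv Φ p ξ) = normAt p ξ := by
  rw [← pow_left_inj₀ (normAt_nonneg _ _) (normAt_nonneg _ _) two_ne_zero, normAt_sq, normAt_sq, h]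

theorem IsHomogeneous.exists_preservesMetric (hX : IsHomogeneous d X) (x y : X) :
    ∃ Φ : Diffeomorph (𝓡 d) (𝓡 d) X X ∞, Φ x = y ∧ PreservesMetric Φ := by
  obtain ⟨Φ, h1, h2⟩ := hX x y
  exact ⟨Φ, h1, h2⟩

/-- The diffeomorphism preserves the length of every path, and the distance is the infimum of
lengths. -/
theorem PreservesMetric.edist_le [IsRiemannianManifold (𝓡 d) X]
    {Φ : Diffeomorph (𝓡 d) (𝓡 d) X X ∞} (h : PreservesMetric Φ) (p q : X) :
    edist (Φ p) (Φ q) ≤ edist p q := by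
  refine le_of_forall_gt fun s hs => ?_
  obtain ⟨γ, h0, h1, hγ, hlen⟩ := exists_path_of_edist_lt (d := d) hs
  have hcomp : ContMDiff 𝓘(ℝ, ℝ) (𝓡 d) 1 (fun t => Φ (γ t)) :=
    (Φ.contMDiff.of_le (by simp)).comp hγ
  have h2 := edist_le_pathELength zero_le_one hcomp.contMDiffOn
  rw [h0, h1] at h2
  refine h2.trans_lt (lt_of_eq_of_lt ?_ hlen)
  rw [pathELength_eq_lintegral_normAt, pathELength_eq_lintegral_normAt]
  refine lintegral_congr fun t => ?_
  have hv : velocity (d := d) (fun t => Φ (γ t)) t = diffDeriv Φ (γ t) (velocity (d := d) γ t) := by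
    have h3 := mfderiv_comp t (Φ.contMDiff.mdifferentiable (by simp) (γ t))
      (hγ.mdifferentiable one_ne_zero t)
    exact congrArg (fun A : ℝ →L[ℝ] E d => A 1) h3
  rw [hv, h.normAt]

theorem PreservesMetric.isometry [IsRiemannianManifold (𝓡 d) X]
    {Φ : Diffeomorph (𝓡 d) (𝓡 d) X X ∞} (h : PreservesMetric Φ) : Isometry Φ := by
  intro p q
  refine le_antisymm (h.edist_le p q) ?_
  have := h.symm.edist_le (Φ p) (Φ q)
  rwa [Φ.symm_apply_apply, Φ.symm_apply_apply] at this

/-- By homogeneity, if one closed ball of radius ε is compact then so are all closed balls of radius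
ε, since metric preserving diffeomorphisms are isometries. The tail of a Cauchy sequence lies in one
of them. -/
theorem IsHomogeneous.completeSpace [IsRiemannianManifold (𝓡 d) X] (hX : IsHomogeneous d X) :
    CompleteSpace X := by
  refine Metric.complete_of_cauchySeq_tendsto fun u hu => ?_
  have : LocallyCompactSpace X := ChartedSpace.locallyCompactSpace (E d) X
  obtain ⟨ε, hε, hc⟩ : ∃ ε > 0, IsCompact (closedBall (u 0) ε) := by
    obtain ⟨K, hK, hKn⟩ := exists_compact_mem_nhds (u 0)
    obtain ⟨ε, hε, hsub⟩ := Metric.nhds_basis_closedBall.mem_iff.1 hKn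
    exact ⟨ε, hε, hK.of_isClosed_subset isClosed_closedBall hsub⟩
  obtain ⟨N, hN⟩ := Metric.cauchySeq_iff'.1 hu ε hε
  obtain ⟨Φ, hΦ, hm⟩ := hX.exists_preservesMetric (u 0) (u N)
  have himg : IsCompact (closedBall (u N) ε) := by
    have : closedBall (u N) ε = Φ '' closedBall (u 0) ε := by
      ext q
      rw [Φ.image_eq_preimage_symm, mem_preimage, mem_closedBall, mem_closedBall,
        ← hm.isometry.dist_eq (Φ.symm q) (u 0), Φ.apply_symm_apply, hΦ]
    rw [this]
    exact hc.image Φ.continuous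
  obtain ⟨x, -, hx⟩ := cauchySeq_tendsto_of_isComplete himg.isComplete
    (u := fun n => u (n + N)) (fun n => (hN (n + N) (by omega)).le)
    ((cauchySeq_shift N).2 hu)
  exact ⟨x, (tendsto_add_atTop_iff_nat N).1 hx⟩

end Metric

variable [IsManifold (𝓡 d) ∞ X]

theorem pullChart_mem_maximalAtlas (Φ : Diffeomorph (𝓡 d) (𝓡 d) X X ∞)
    {e : OpenPartialHomeomorph X (E d)} (he : e ∈ IsManifold.maximalAtlas (𝓡 d) ∞ X) :
    pullChart Φ e ∈ IsManifold.maximalAtlas (𝓡 d) ∞ X := by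
  refine OpenPartialHomeomorph.mem_maximalAtlas_of_contMDiffOn _ ?_ ?_
  · rw [pullChart_source]
    exact (contMDiffOn_of_mem_maximalAtlas he).comp Φ.contMDiff.contMDiffOn fun p hp => hp
  · rw [pullChart_target]
    exact Φ.symm.contMDiff.comp_contMDiffOn (contMDiffOn_symm_of_mem_maximalAtlas he)

theorem chartDeriv_pullChart (Φ : Diffeomorph (𝓡 d) (𝓡 d) X X ∞)
    {e : OpenPartialHomeomorph X (E d)} (he : e ∈ IsManifold.maximalAtlas (𝓡 d) ∞ X) {v : E d}
    (hv : v ∈ e.target) (ξ : E d) :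
    chartDeriv (pullChart Φ e) v ξ = diffDeriv Φ.symm (e.symm v) (chartDeriv e v ξ) := by
  have h := mfderiv_comp v (Φ.symm.contMDiff.mdifferentiable (by simp) (e.symm v))
    (mdifferentiableAt_symm he hv)
  exact congrArg (fun A : E d →L[ℝ] E d => A ξ) h

variable [RiemannianBundle (fun p : X => TangentSpace (𝓡 d) p)]

theorem PreservesMetric.metricMatrix_pullChart {Φ : Diffeomorph (𝓡 d) (𝓡 d) X X ∞}
    (h : PreservesMetric Φ) {e : OpenPartialHomeomorph X (E d)}
    (he : e ∈ IsManifold.maximalAtlas (𝓡 d) ∞ X) {v : E d} (hv : v ∈ e.target) :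
    metricMatrix (pullChart Φ e) v = metricMatrix e v := by
  ext i j
  rw [metricMatrix_apply, metricMatrix_apply, chartDeriv_pullChart Φ he hv,
    chartDeriv_pullChart Φ he hv, pullChart_symm_apply]
  exact h.symm _ _ _

theorem PreservesMetric.christoffel_pullChart {Φ : Diffeomorph (𝓡 d) (𝓡 d) X X ∞}
    (h : PreservesMetric Φ) {e : OpenPartialHomeomorph X (E d)}
    (he : e ∈ IsManifold.maximalAtlas (𝓡 d) ∞ X) {v : E d} (hv : v ∈ e.target) (k i j : Fin d) :
    christoffel (pullChart Φ e) v k i j = christoffel e v k i j := by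
  have hpd : ∀ a b c : Fin d, partialDeriv a (fun w => metricMatrix (pullChart Φ e) w b c) v
      = partialDeriv a (fun w => metricMatrix e w b c) v := by
    intro a b c
    refine (partialDeriv_congr ?_ a).self_of_nhds
    filter_upwards [e.open_target.mem_nhds hv] with w hw
    rw [h.metricMatrix_pullChart he hw]
  simp only [christoffel, hpd, h.metricMatrix_pullChart he hv]

/-- The equation for Φ ∘ γ in a chart `e` is the equation for γ in the chart `e` ∘ Φ, where the
metric has the same coefficients and so the same Christoffel symbols. -/
theorem PreservesMetric.isGeodesicOn {Φ : Diffeomorph (𝓡 d) (𝓡 d) X X ∞}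
    (h : PreservesMetric Φ) {γ : ℝ → X} {J : Set ℝ} (hγ : IsGeodesicOn (d := d) γ J) :
    IsGeodesicOn (d := d) (fun t => Φ (γ t)) J := by
  refine ⟨Φ.contMDiff.comp_contMDiffOn hγ.1, fun e he t ht hs k => ?_⟩
  have h1 := hγ.2 (pullChart Φ e) (pullChart_mem_maximalAtlas Φ he) t ht
    (by rw [pullChart_source]; exact hs) k
  simp only [pullChart_apply] at h1
  rw [← h1]
  congr 1
  refine Finset.sum_congr rfl fun i _ => Finset.sum_congr rfl fun j _ => ?_
  rw [h.christoffel_pullChart he (e.map_source hs)]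

/-- A metric preserving diffeomorphism transports geodesic coordinates. -/
noncomputable def PreservesMetric.geodesicChart [IsRiemannianManifold (𝓡 d) X]
    {Φ : Diffeomorph (𝓡 d) (𝓡 d) X X ∞} (h : PreservesMetric Φ) {y : X} {ρ : ℝ} (hρ : 0 < ρ)
    (θ : GeodesicChart d y ρ) : GeodesicChart d (Φ y) ρ where
  chart := pullChart Φ.symm θ.chart
  smooth := pullChart_mem_maximalAtlas _ θ.smooth
  source_eq := by
    rw [pullChart_source, θ.source_eq]
    ext p
    rw [mem_preimage, mem_ball, mem_ball, ← h.isometry.dist_eq, Φ.apply_symm_apply]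
  target_eq := by rw [pullChart_target, θ.target_eq]
  map_center := by rw [pullChart_apply, Φ.symm_apply_apply, θ.map_center]
  orthonormal := by
    rw [h.symm.metricMatrix_pullChart θ.smooth, θ.orthonormal]
    rw [θ.target_eq]
    exact mem_ball_self hρ
  geodesic v := h.isGeodesicOn (θ.geodesic v)

theorem PreservesMetric.normAt_pullChart {Φ : Diffeomorph (𝓡 d) (𝓡 d) X X ∞}
    (h : PreservesMetric Φ) {e : OpenPartialHomeomorph X (E d)}
    (he : e ∈ IsManifold.maximalAtlas (𝓡 d) ∞ X) {v : E d} (hv : v ∈ e.target) (ξ : E d) :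
    LocalPoincare.normAt ((pullChart Φ e).symm v) (chartDeriv (pullChart Φ e) v ξ)
      = LocalPoincare.normAt (e.symm v) (chartDeriv e v ξ) := by
  rw [chartDeriv_pullChart Φ he hv, pullChart_symm_apply]
  exact h.symm.normAt _ _

/-- On compact subsets of its domain, a chart is elliptic. -/
theorem exists_norm_bounds_of_isCompact [IsContMDiffRiemannianBundle (𝓡 d) ∞ (E d)
    (fun p : X => TangentSpace (𝓡 d) p)] {e : OpenPartialHomeomorph X (E d)}
    (he : e ∈ IsManifold.maximalAtlas (𝓡 d) ∞ X) {K : Set (E d)} (hK : IsCompact K)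
    (hKe : K ⊆ e.target) : ∃ Λ : ℝ, 1 ≤ Λ ∧ ∀ v ∈ K, ∀ ξ : E d,
      LocalPoincare.normAt (e.symm v) (chartDeriv e v ξ) ≤ Λ * ‖ξ‖ ∧
        ‖ξ‖ ≤ Λ * LocalPoincare.normAt (e.symm v) (chartDeriv e v ξ) := by
  set q : E d × E d → ℝ := fun z => ∑ i, ∑ j, z.2 i * z.2 j * metricMatrix e z.1 i j with hq
  have hqeq : ∀ v ξ, q (v, ξ) = LocalPoincare.normAt (e.symm v) (chartDeriv e v ξ) ^ 2 := by
    intro v ξ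
    rw [normAt_sq, metricAt_chartDeriv]
  set S : Set (E d × E d) := K ×ˢ sphere 0 1 with hS
  have hSc : IsCompact S := hK.prod (isCompact_sphere _ _)
  have hqc : ContinuousOn q S := by
    refine continuousOn_finsetSum _ fun i _ => continuousOn_finsetSum _ fun j _ => ?_
    have h2 : ContinuousOn (fun z : E d × E d => z.2 i * z.2 j) S := by fun_prop
    refine h2.mul ((contDiffOn_metricMatrix he i j).continuousOn.comp continuousOn_fst ?_)
    exact fun z hz => hKe hz.1
  have hqpos : ∀ z ∈ S, 0 < q z := by
    rintro ⟨v, ξ⟩ ⟨hv, hξ⟩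
    rw [hqeq]
    refine pow_pos (normAt_chartDeriv_pos he (hKe hv) ?_) 2
    rintro rfl
    simp at hξ
  obtain ⟨C, hC⟩ := hSc.exists_bound_of_continuousOn hqc
  obtain ⟨C', hC'⟩ := hSc.exists_bound_of_continuousOn (hqc.inv₀ fun z hz => (hqpos z hz).ne')
  -- The constants bound the quadratic form and its inverse over unit vectors. Because `M` is at
  -- least 1, it bounds the norm and its inverse as well, without square roots.
  set M : ℝ := max 1 (max C C') with hM
  have hM1 : 1 ≤ M := le_max_left _ _
  have hCM : C ≤ M := (le_max_left _ _).trans (le_max_right _ _)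
  have hCM' : C' ≤ M := (le_max_right _ _).trans (le_max_right _ _)
  have hunit : ∀ v ∈ K, ∀ ξ : E d, ‖ξ‖ = 1 →
      LocalPoincare.normAt (e.symm v) (chartDeriv e v ξ) ≤ M ∧
        1 ≤ M * LocalPoincare.normAt (e.symm v) (chartDeriv e v ξ) := by
    intro v hv ξ hξ
    have hz : (v, ξ) ∈ S := ⟨hv, by simpa using hξ⟩
    have h1 := hC _ hz
    have h2 := hC' _ hz
    have hp := hqpos _ hz
    have hN0 := normAt_nonneg (e.symm v) (chartDeriv e v ξ)
    rw [Real.norm_of_nonneg hp.le] at h1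
    rw [Pi.inv_apply, Real.norm_of_nonneg (inv_nonneg.2 hp.le), inv_le_iff_one_le_mul₀ hp] at h2
    rw [hqeq] at h1 h2 hp
    set N := LocalPoincare.normAt (e.symm v) (chartDeriv e v ξ)
    constructor
    · by_contra hlt
      push Not at hlt
      nlinarith
    · by_contra hlt
      push Not at hlt
      have h3 : 1 ≤ M * N ^ 2 := h2.trans (by gcongr)
      nlinarith
  refine ⟨M, hM1, fun v hv ξ => ?_⟩
  by_cases hξ : ξ = 0
  · subst hξ
    have : LocalPoincare.normAt (e.symm v) (chartDeriv e v 0) ^ 2 = 0 := by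
      rw [← hqeq]
      simp [hq]
    have h0 : LocalPoincare.normAt (e.symm v) (chartDeriv e v 0) = 0 := by simpa using this
    rw [h0]
    simp
  have hpos : 0 < ‖ξ‖ := norm_pos_iff.2 hξ
  have hscale : LocalPoincare.normAt (e.symm v) (chartDeriv e v ξ)
      = ‖ξ‖ * LocalPoincare.normAt (e.symm v) (chartDeriv e v (‖ξ‖⁻¹ • ξ)) := by
    have hξ' : ξ = ‖ξ‖ • (‖ξ‖⁻¹ • ξ) := by rw [smul_inv_smul₀ hpos.ne']
    conv_lhs => rw [hξ', map_smul]
    have := norm_smul (β := TangentSpace (𝓡 d) (e.symm v)) ‖ξ‖ (chartDeriv e v (‖ξ‖⁻¹ • ξ))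
    rw [norm_norm] at this
    exact this
  obtain ⟨h1, h2⟩ := hunit v hv (‖ξ‖⁻¹ • ξ) (by
    rw [norm_smul, norm_inv, norm_norm, inv_mul_cancel₀ hpos.ne'])
  rw [hscale]
  constructor
  · rw [mul_comm]
    gcongr
  · nlinarith

/-- Fixed coordinates at `x₀` on a ball of radius `R` > `lam` have bounded distortion on the compact
closed ball of radius `lam`. Any geodesic chart of radius `lam` can be moved to `x₀` without
altering its distortion, and there it equals the fixed chart up to a linear isometry. -/
theorem IsHomogeneous.exists_isElliptic [IsRiemannianManifold (𝓡 d) X]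
    [IsContMDiffRiemannianBundle (𝓡 d) ∞ (E d) (fun p : X => TangentSpace (𝓡 d) p)]
    (hX : IsHomogeneous d X) {lam : ℝ} (hlam : 0 < lam)
    (hinj : ENNReal.ofReal lam < injRadius d X) :
    ∃ Λ : ℝ, 1 ≤ Λ ∧ ∀ (y : X) (θ : GeodesicChart d y lam), IsElliptic Λ θ.chart := by
  rcases isEmpty_or_nonempty X with hXe | ⟨⟨x₀⟩⟩
  · exact ⟨1, le_rfl, fun y => (hXe.false y).elim⟩
  obtain ⟨R, hR, hne⟩ := exists_geodesicChart_of_lt_injRadius hinj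
  obtain ⟨θ₀⟩ := hne R (hlam.trans hR) le_rfl x₀
  obtain ⟨Λ, hΛ, hbound⟩ := exists_norm_bounds_of_isCompact θ₀.smooth
    (isCompact_closedBall (0 : E d) lam)
    (by rw [θ₀.target_eq]; exact closedBall_subset_ball hR)
  refine ⟨Λ, hΛ, fun y θ => ?_⟩
  obtain ⟨Φ, hΦ, hm⟩ := hX.exists_preservesMetric y x₀
  subst hΦ
  set θ₁ := hm.geodesicChart hlam θ with hθ₁
  obtain ⟨A, hA, hAeq⟩ := θ₁.exists_isometry hlam hR.le θ₀
  have key : ∀ v ∈ θ.chart.target, ∀ ξ : E d,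
      LocalPoincare.normAt (θ.chart.symm v) (chartDeriv θ.chart v ξ) ≤ Λ * ‖ξ‖ ∧
        ‖ξ‖ ≤ Λ * LocalPoincare.normAt (θ.chart.symm v) (chartDeriv θ.chart v ξ) := by
    intro v hv ξ
    have hv' : v ∈ ball (0 : E d) lam := θ.target_eq ▸ hv
    have hv₁ : v ∈ θ₁.chart.target := by rwa [θ₁.target_eq]
    have hs : θ₁.chart.symm v ∈ θ₀.chart.source := by
      rw [θ₀.source_eq]
      refine ball_subset_ball hR.le ?_
      rw [← θ₁.source_eq]
      exact θ₁.chart.map_target hv₁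
    have h1 : LocalPoincare.normAt (θ.chart.symm v) (chartDeriv θ.chart v ξ)
        = LocalPoincare.normAt (θ₁.chart.symm v) (chartDeriv θ₁.chart v ξ) :=
      (hm.symm.normAt_pullChart θ.smooth hv ξ).symm
    -- The transition map is linear, so its derivative is the isometry `A` at every point, not only
    -- at the origin.
    have hder : fderiv ℝ (fun w => θ₀.chart (θ₁.chart.symm w)) v = A := by
      have : (fun w => θ₀.chart (θ₁.chart.symm w)) =ᶠ[𝓝 v] A := by
        filter_upwards [isOpen_ball.mem_nhds hv'] with w hw
        exact hAeq w hw
      rw [this.fderiv_eq, A.fderiv]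
    have hsymm : θ₁.chart.symm v = θ₀.chart.symm (A v) := by
      rw [← hAeq v hv', θ₀.chart.left_inv hs]
    have h2 : LocalPoincare.normAt (θ₁.chart.symm v) (chartDeriv θ₁.chart v ξ)
        = LocalPoincare.normAt (θ₀.chart.symm (A v)) (chartDeriv θ₀.chart (A v) (A ξ)) := by
      rw [chartDeriv_eq_comp θ₁.smooth θ₀.smooth hv₁ hs, hder, hAeq v hv', hsymm]
      rfl
    have h3 := hbound (A v) (by rw [mem_closedBall, dist_zero_right, hA]; exact (mem_ball_zero_iff.1 hv').le) (A ξ)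
    rw [h1, h2]
    rwa [hA] at h3
  exact ⟨fun v hv ξ => (key v hv ξ).1, fun v hv ξ => (key v hv ξ).2⟩

theorem completeSpace_and_exists_isElliptic [IsRiemannianManifold (𝓡 d) X]
    [IsContMDiffRiemannianBundle (𝓡 d) ∞ (E d) (fun p : X => TangentSpace (𝓡 d) p)]
    (hX : IsHomogeneous d X ∨ HasBoundedGeometry d X) {lam : ℝ} (hlam : 0 < lam)
    (hinj : ENNReal.ofReal lam < injRadius d X) :
    CompleteSpace X ∧
      ∃ Λ : ℝ, 1 ≤ Λ ∧ ∀ (y : X) (θ : GeodesicChart d y lam), IsElliptic Λ θ.chart := by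
  rcases hX with hX | hX
  · exact ⟨hX.completeSpace, hX.exists_isElliptic hlam hinj⟩
  · exact ⟨hX.complete, exists_isElliptic_of_hasBoundedGeometry hX hlam hinj⟩

end Transport

/-! ### Functions on the manifold as functions on `ℝ^d` -/

section ChartExtension

variable {d : ℕ} {X : Type*} [MetricSpace X]

/-- The function `G` in the coordinates of the chart `e`, extended by zero. -/
noncomputable def chartExt (e : OpenPartialHomeomorph X (E d)) (G : X → ℂ) : E d → ℂ :=
  e.target.indicator fun v => G (e.symm v)

theorem chartExt_sub (e : OpenPartialHomeomorph X (E d)) (G H : X → ℂ) :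
    chartExt e (G - H) = chartExt e G - chartExt e H := by
  funext v
  by_cases hv : v ∈ e.target <;> simp [chartExt, hv]

theorem chartExt_eventuallyEq {e : OpenPartialHomeomorph X (E d)} {v : E d} (hv : v ∈ e.target)
    (G : X → ℂ) : chartExt e G =ᶠ[𝓝 v] fun w => G (e.symm w) := by
  filter_upwards [e.open_target.mem_nhds hv] with w hw
  exact indicator_of_mem hw _

theorem isCompact_image_tsupport {e : OpenPartialHomeomorph X (E d)} {G : X → ℂ}
    (hc : HasCompactSupport G) (hG : tsupport G ⊆ e.source) : IsCompact (e '' tsupport G) :=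
  IsCompact.image_of_continuousOn hc (e.continuousOn.mono hG)

theorem tsupport_chartExt_subset {e : OpenPartialHomeomorph X (E d)} {G : X → ℂ}
    (hc : HasCompactSupport G) (hG : tsupport G ⊆ e.source) :
    tsupport (chartExt e G) ⊆ e '' tsupport G := by
  refine closure_minimal (fun v hv => ?_) (isCompact_image_tsupport hc hG).isClosed
  have hvt : v ∈ e.target := by
    by_contra h
    exact hv (indicator_of_notMem h _)
  have h2 : G (e.symm v) ≠ 0 := by
    have h1 : chartExt e G v ≠ 0 := hv
    rwa [chartExt, indicator_of_mem hvt] at h1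
  exact ⟨e.symm v, subset_tsupport G h2, e.right_inv hvt⟩

theorem hasCompactSupport_chartExt {e : OpenPartialHomeomorph X (E d)} {G : X → ℂ}
    (hc : HasCompactSupport G) (hG : tsupport G ⊆ e.source) :
    HasCompactSupport (chartExt e G) :=
  (isCompact_image_tsupport hc hG).of_isClosed_subset (isClosed_tsupport _)
    (tsupport_chartExt_subset hc hG)

/-- Outside the range of the chart the extension vanishes near every point, because its support lies
in the compact, hence closed, image of the support of `G`. -/
theorem contDiff_chartExt [ChartedSpace (E d) X] [IsManifold (𝓡 d) ∞ X] {e : OpenPartialHomeomorph X (E d)}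
    (he : e ∈ IsManifold.maximalAtlas (𝓡 d) ∞ X) {G : X → ℂ}
    (hGs : ContMDiff (𝓡 d) 𝓘(ℝ, ℂ) ∞ G) (hc : HasCompactSupport G) (hG : tsupport G ⊆ e.source) :
    ContDiff ℝ ∞ (chartExt e G) := by
  rw [contDiff_iff_contDiffAt]
  intro v
  by_cases hv : v ∈ e.target
  · refine ContDiffAt.congr_of_eventuallyEq ?_ (chartExt_eventuallyEq hv G)
    rw [← contMDiffAt_iff_contDiffAt]
    exact hGs.contMDiffAt.comp v
      ((contMDiffOn_symm_of_mem_maximalAtlas he).contMDiffAt (e.open_target.mem_nhds hv))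
  · have hv' : v ∉ tsupport (chartExt e G) := by
      intro h
      obtain ⟨p, hp, rfl⟩ := tsupport_chartExt_subset hc hG h
      exact hv (e.map_source (hG hp))
    exact contDiffAt_const.congr_of_eventuallyEq (notMem_tsupport_iff_eventuallyEq.1 hv')

theorem multiDeriv_chartExt {e : OpenPartialHomeomorph X (E d)} {v : E d} (hv : v ∈ e.target)
    (α : Fin d → ℕ) (G : X → ℂ) :
    multiDeriv α (chartExt e G) v = multiDeriv α (fun w => G (e.symm w)) v :=
  (multiDeriv_congr (chartExt_eventuallyEq hv G) α).self_of_nhds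

theorem multiDeriv_chartExt_eq_zero {e : OpenPartialHomeomorph X (E d)} {G : X → ℂ}
    (hc : HasCompactSupport G) (hG : tsupport G ⊆ e.source) {V : Set X} (hV : tsupport G ⊆ V)
    (α : Fin d → ℕ) {v : E d} (hv : v ∉ e.symm ⁻¹' V) :
    multiDeriv α (chartExt e G) v = 0 := by
  refine image_eq_zero_of_notMem_tsupport fun h => hv ?_
  obtain ⟨p, hp, rfl⟩ := tsupport_chartExt_subset hc hG (tsupport_multiDeriv_subset α _ h)
  rw [mem_preimage, e.left_inv (hG hp)]
  exact hV hp

end ChartExtension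

/-! ### Transfer of `L_2` bounds between chart and manifold -/

section Transfer

variable {d : ℕ} {X : Type*} [MetricSpace X] [ChartedSpace (E d) X]
  [RiemannianBundle (fun p : X => TangentSpace (𝓡 d) p)] [IsManifold (𝓡 d) ∞ X]
  [MeasurableSpace X] [BorelSpace X]
  [IsContMDiffRiemannianBundle (𝓡 d) ∞ (E d) (fun p : X => TangentSpace (𝓡 d) p)]
  {Λ : ℝ} {e : OpenPartialHomeomorph X (E d)}

theorem IsElliptic.volume_le (hΛ : 1 ≤ Λ) (h : IsElliptic Λ e)
    (he : e ∈ IsManifold.maximalAtlas (𝓡 d) ∞ X) {A : Set X} (hA : MeasurableSet A)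
    (hAe : A ⊆ e.source) :
    volume (e.target ∩ e.symm ⁻¹' A) ≤ ENNReal.ofReal (Λ ^ d) * riemMeasure d X A := by
  simpa using h.setLIntegral_volume_le hΛ he (f := fun _ => 1) aemeasurable_const hA hAe

theorem IsElliptic.riemMeasure_pos (hΛ : 1 ≤ Λ) (h : IsElliptic Λ e)
    (he : e ∈ IsManifold.maximalAtlas (𝓡 d) ∞ X) {O : Set X} (hO : IsOpen O) (hne : O.Nonempty)
    (hOe : O ⊆ e.source) : 0 < riemMeasure d X O := by
  have hopen : IsOpen (e.target ∩ e.symm ⁻¹' O) := e.isOpen_inter_preimage_symm hO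
  obtain ⟨p, hp⟩ := hne
  have hpos := hopen.measure_pos volume
    ⟨e p, e.map_source (hOe hp), by rwa [mem_preimage, e.left_inv (hOe hp)]⟩
  have := hpos.trans_le (h.volume_le hΛ he hO.measurableSet hOe)
  exact pos_of_ne_zero fun h0 => by simp [h0] at this

/-- Needed to compose almost everywhere classes on X with the inverse chart: the coordinates of a
μ-null set form a Lebesgue null set. -/
theorem IsElliptic.map_symm_absolutelyContinuous (hΛ : 1 ≤ Λ) (h : IsElliptic Λ e)
    (he : e ∈ IsManifold.maximalAtlas (𝓡 d) ∞ X) :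
    Measure.map e.symm (volume.restrict e.target) ≪ riemMeasure d X := by
  refine Measure.AbsolutelyContinuous.mk fun A hA hA0 => ?_
  rw [Measure.map_apply_of_aemeasurable (aemeasurable_symm e) hA,
    Measure.restrict_apply' e.open_target.measurableSet]
  have hsub : e.symm ⁻¹' A ∩ e.target ⊆ e.target ∩ e.symm ⁻¹' (A ∩ e.source) :=
    fun v hv => ⟨hv.2, hv.1, e.map_target hv.2⟩
  refine measure_mono_null hsub (le_antisymm ?_ zero_le)
  refine (h.volume_le hΛ he (hA.inter e.open_source.measurableSet) inter_subset_right).trans ?_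
  rw [measure_mono_null inter_subset_left hA0, mul_zero]

theorem IsElliptic.lintegral_comp_symm_le (hΛ : 1 ≤ Λ) (h : IsElliptic Λ e)
    (he : e ∈ IsManifold.maximalAtlas (𝓡 d) ∞ X) {f : X → ℝ≥0∞}
    (hf : AEMeasurable f (riemMeasure d X)) :
    ∫⁻ v in e.target, f (e.symm v) ≤ ENNReal.ofReal (Λ ^ d) * ∫⁻ p, f p ∂(riemMeasure d X) := by
  have hm : AEMeasurable (fun v => f (e.symm v)) (volume.restrict e.target) :=
    (hf.mono_ac (h.map_symm_absolutelyContinuous hΛ he)).comp_aemeasurable (aemeasurable_symm e)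
  have h1 := h.setLIntegral_volume_le hΛ he hm e.open_source.measurableSet subset_rfl
  have h2 : e.target ∩ e.symm ⁻¹' e.source = e.target :=
    inter_eq_left.2 fun v hv => e.map_target hv
  rw [h2] at h1
  rw [setLIntegral_congr_fun (g := f) e.open_source.measurableSet
    fun p hp => by simp only [e.left_inv hp]] at h1
  exact h1.trans (mul_le_mul_right (setLIntegral_le_lintegral _ _) _)

theorem IsElliptic.eLpNorm_comp_symm_sq_le (hΛ : 1 ≤ Λ) (h : IsElliptic Λ e)
    (he : e ∈ IsManifold.maximalAtlas (𝓡 d) ∞ X) {g : X → ℂ}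
    (hg : AEStronglyMeasurable g (riemMeasure d X)) :
    eLpNorm (fun v => g (e.symm v)) 2 (volume.restrict e.target) ^ 2
      ≤ ENNReal.ofReal (Λ ^ d) * eLpNorm g 2 (riemMeasure d X) ^ 2 := by
  rw [eLpNorm_two_sq, eLpNorm_two_sq]
  exact h.lintegral_comp_symm_le hΛ he (f := fun p => ‖g p‖ₑ ^ 2) (hg.enorm.pow_const 2)

theorem IsElliptic.memLp_comp_symm (hΛ : 1 ≤ Λ) (h : IsElliptic Λ e)
    (he : e ∈ IsManifold.maximalAtlas (𝓡 d) ∞ X) {g : X → ℂ} (hg : MemLp g 2 (riemMeasure d X)) :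
    MemLp (fun v => g (e.symm v)) 2 (volume.restrict e.target) := by
  refine ⟨(hg.1.mono_ac (h.map_symm_absolutelyContinuous hΛ he)).comp_aemeasurable
    (aemeasurable_symm e), ?_⟩
  refine (ENNReal.pow_lt_top_iff (n := 2)).1 ?_ |>.resolve_right two_ne_zero
  exact (h.eLpNorm_comp_symm_sq_le hΛ he hg.1).trans_lt
    (ENNReal.mul_lt_top ENNReal.ofReal_lt_top (ENNReal.pow_lt_top hg.2))

theorem IsElliptic.memLp_comp_chart (hΛ : 1 ≤ Λ) (h : IsElliptic Λ e)
    (he : e ∈ IsManifold.maximalAtlas (𝓡 d) ∞ X) {D : E d → ℂ}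
    (hD : MemLp D 2 (volume.restrict e.target)) :
    MemLp (fun p => D (e p)) 2 ((riemMeasure d X).restrict e.source) := by
  have hac : Measure.map e ((riemMeasure d X).restrict e.source) ≪ volume.restrict e.target := by
    rw [map_chart_riemMeasure he]
    exact withDensity_absolutelyContinuous _ _
  refine ⟨(hD.1.mono_ac hac).comp_aemeasurable
    (e.continuousOn.aemeasurable e.open_source.measurableSet), ?_⟩
  refine (ENNReal.pow_lt_top_iff (n := 2)).1 ?_ |>.resolve_right two_ne_zero
  rw [eLpNorm_two_sq]
  refine (h.setLIntegral_riemMeasure_le hΛ he (f := fun v => ‖D v‖ₑ ^ 2) (hD.1.enorm.pow_const 2)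
    e.open_source.measurableSet subset_rfl).trans_lt (ENNReal.mul_lt_top ENNReal.ofReal_lt_top ?_)
  refine (lintegral_mono_set inter_subset_left).trans_lt ?_
  rw [← eLpNorm_two_sq]
  exact ENNReal.pow_lt_top hD.2

/-- The Sobolev norm integrates over the smaller ball only, the set `V` in the application; as the
support lies in `V`, nothing is lost on the rest of the range. -/
theorem IsElliptic.lintegral_multiDeriv_chartExt_le (hΛ : 1 ≤ Λ) (h : IsElliptic Λ e)
    (he : e ∈ IsManifold.maximalAtlas (𝓡 d) ∞ X) {G : X → ℂ}
    (hGs : ContMDiff (𝓡 d) 𝓘(ℝ, ℂ) ∞ G) (hc : HasCompactSupport G) {V : Set X}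
    (hV : MeasurableSet V) (hVe : V ⊆ e.source) (hG : tsupport G ⊆ V) (α : Fin d → ℕ) :
    ∫⁻ v in e.target, ‖multiDeriv α (chartExt e G) v‖ₑ ^ 2
      ≤ ENNReal.ofReal (Λ ^ d) * ∫⁻ p in V,
        ‖multiDeriv α (fun w => G (e.symm w)) (e p)‖ₑ ^ 2 ∂(riemMeasure d X) := by
  have hsm := contDiff_multiDeriv (contDiff_chartExt he hGs hc (hG.trans hVe)) α
  have h1 := h.setLIntegral_volume_le hΛ he
    (f := fun v => ‖multiDeriv α (chartExt e G) v‖ₑ ^ 2)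
    (hsm.continuous.enorm.measurable.pow_const 2).aemeasurable hV hVe
  have h2 : ∫⁻ v in e.target ∩ e.symm ⁻¹' V, ‖multiDeriv α (chartExt e G) v‖ₑ ^ 2
      = ∫⁻ v in e.target, ‖multiDeriv α (chartExt e G) v‖ₑ ^ 2 := by
    have hB := measurableSet_target_inter_preimage e hV
    rw [← lintegral_inter_add_sdiff _ e.target hB, inter_eq_right.2 inter_subset_left]
    rw [setLIntegral_eq_zero (s := _ \ _) (e.open_target.measurableSet.diff hB), add_zero]
    intro v hv
    simp [multiDeriv_chartExt_eq_zero hc (hG.trans hVe) hG α fun hv' => hv.2 ⟨hv.1, hv'⟩]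
  rw [← h2]
  refine h1.trans_eq ?_
  congr 1
  refine setLIntegral_congr_fun hV fun p hp => ?_
  simp only [multiDeriv_chartExt (e.map_source (hVe hp))]

end Transfer

/-! ### Weak derivatives of Sobolev limits -/

section SobolevLimits

variable {d : ℕ} {X : Type*} [MetricSpace X] [ChartedSpace (E d) X]
  [RiemannianBundle (fun p : X => TangentSpace (𝓡 d) p)] [IsManifold (𝓡 d) ∞ X]
  [MeasurableSpace X] [BorelSpace X]
  [IsContMDiffRiemannianBundle (𝓡 d) ∞ (E d) (fun p : X => TangentSpace (𝓡 d) p)]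
  {Λ : ℝ} {e : OpenPartialHomeomorph X (E d)}

theorem tendsto_zero_of_sq_le {a b : ℕ → ℝ≥0∞} {c : ℝ≥0∞} (hc : c ≠ ⊤)
    (hab : ∀ n, a n ^ 2 ≤ c * b n ^ 2) (hb : Tendsto b atTop (𝓝 0)) : Tendsto a atTop (𝓝 0) := by
  have h1 : Tendsto (fun n => c * b n ^ 2) atTop (𝓝 0) := by
    have := ENNReal.Tendsto.const_mul ((ENNReal.continuous_pow 2).tendsto 0 |>.comp hb)
      (Or.inr hc)
    simpa using this
  have h2 := tendsto_of_tendsto_of_tendsto_of_le_of_le tendsto_const_nhds h1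
    (fun _ => zero_le) hab
  have h3 := (ENNReal.continuous_rpow_const (y := (1 / 2 : ℝ))).tendsto 0 |>.comp h2
  rw [ENNReal.zero_rpow_of_pos (by norm_num)] at h3
  refine h3.congr fun n => ?_
  simp only [Function.comp_apply]
  rw [← ENNReal.rpow_natCast, ← ENNReal.rpow_mul]
  norm_num

/-- Smooth functions converging in `L_2` whose derivatives in the chart `e` are Cauchy in `L_2`:
the limit has weak derivatives, the `L_2`-limits of the derivatives. -/
theorem IsElliptic.exists_isWeakDeriv_of_cauchy (hΛ : 1 ≤ Λ) (h : IsElliptic Λ e)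
    (he : e ∈ IsManifold.maximalAtlas (𝓡 d) ∞ X) {V : Set X} (hV : MeasurableSet V)
    (hVe : V ⊆ e.source) {G : ℕ → X → ℂ} (hGs : ∀ n, ContMDiff (𝓡 d) 𝓘(ℝ, ℂ) ∞ (G n))
    (hc : ∀ n, HasCompactSupport (G n)) (hG : ∀ n, tsupport (G n) ⊆ V) {g : X → ℂ}
    (hg : MemLp g 2 (riemMeasure d X))
    (hlim : Tendsto (fun n => eLpNorm (G n - g) 2 (riemMeasure d X)) atTop (𝓝 0))
    {α : Fin d → ℕ}
    (hcau : ∀ ε : ℝ≥0∞, 0 < ε → ∃ N : ℕ, ∀ p ≥ N, ∀ q ≥ N, ∫⁻ x in V,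
      ‖multiDeriv α (fun w => (G p - G q) (e.symm w)) (e x)‖ₑ ^ 2 ∂(riemMeasure d X) < ε) :
    ∃ D : E d → ℂ, MemLp D 2 (volume.restrict e.target) ∧
      Tendsto (fun n => eLpNorm (multiDeriv α (chartExt e (G n)) - D) 2
        (volume.restrict e.target)) atTop (𝓝 0) ∧
      IsWeakDeriv e.target α (fun v => g (e.symm v)) D := by
  have hsm := fun n => contDiff_chartExt he (hGs n) (hc n) ((hG n).trans hVe)
  have hcs := fun n => hasCompactSupport_chartExt (hc n) ((hG n).trans hVe)
  have hmem := fun n => memLp_of_contDiff_of_hasCompactSupport (contDiff_multiDeriv (hsm n) α)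
    (hasCompactSupport_multiDeriv (hcs n) α) e.target
  have hΛ0 : ENNReal.ofReal (Λ ^ d) ≠ 0 := (ENNReal.ofReal_pos.2 (by positivity)).ne'
  obtain ⟨D, hD, hDlim⟩ := exists_tendsto_eLpNorm_of_cauchy hmem (by
    intro ε hε
    -- The Sobolev condition concerns squared norms on X, and the passage to the chart costs the
    -- factor Λ^d.
    obtain ⟨N, hN⟩ := hcau (ε ^ 2 / ENNReal.ofReal (Λ ^ d))
      (ENNReal.div_pos (ENNReal.pow_pos hε 2).ne' ENNReal.ofReal_ne_top)
    refine ⟨N, fun p hp q hq => ?_⟩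
    rw [← multiDeriv_sub (hsm p) (hsm q), ← chartExt_sub]
    refine lt_of_not_ge fun hle => absurd (pow_le_pow_left' hle 2) (not_le.2 ?_)
    rw [eLpNorm_two_sq]
    have hts : tsupport (G p - G q) ⊆ V :=
      (tsupport_sub (G p) (G q)).trans (union_subset (hG p) (hG q))
    refine (h.lintegral_multiDeriv_chartExt_le hΛ he ((hGs p).sub (hGs q)) ((hc p).sub (hc q))
      hV hVe hts α).trans_lt ?_
    rw [mul_comm]
    exact (ENNReal.lt_div_iff_mul_lt (Or.inl hΛ0) (Or.inl ENNReal.ofReal_ne_top)).1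
      (hN p hp q hq))
  refine ⟨D, hD, hDlim, ?_⟩
  refine isWeakDeriv_of_tendsto hsm hcs (h.memLp_comp_symm hΛ he hg) hD ?_ hDlim
  refine tendsto_zero_of_sq_le (c := ENNReal.ofReal (Λ ^ d)) ENNReal.ofReal_ne_top (fun n => ?_) hlim
  have hcongr : eLpNorm (chartExt e (G n) - fun v => g (e.symm v)) 2 (volume.restrict e.target)
      = eLpNorm (fun v => (G n - g) (e.symm v)) 2 (volume.restrict e.target) := by
    refine eLpNorm_congr_ae ?_
    filter_upwards [ae_restrict_mem e.open_target.measurableSet] with v hv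
    simp [chartExt, hv]
  rw [hcongr]
  refine h.eLpNorm_comp_symm_sq_le hΛ he (AEStronglyMeasurable.sub ?_ hg.1)
  exact ((hGs n).continuous.stronglyMeasurable_of_hasCompactSupport (hc n)).aestronglyMeasurable

end SobolevLimits

theorem _root_.ENNReal.rpow_half_sq (a : ℝ≥0∞) : (a ^ (1 / 2 : ℝ)) ^ 2 = a := by
  rw [← ENNReal.rpow_natCast, ← ENNReal.rpow_mul]
  norm_num

theorem _root_.ENNReal.le_of_sq_le_sq {a b : ℝ≥0∞} (h : a ^ 2 ≤ b ^ 2) : a ≤ b :=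
  (ENNReal.pow_le_pow_left_iff two_ne_zero).1 h

/-! ### Oscillation on Riemannian balls by chaining -/

section Oscillation

variable {d : ℕ} {X : Type*} [MetricSpace X] [ChartedSpace (E d) X]
  [RiemannianBundle (fun p : X => TangentSpace (𝓡 d) p)] [IsManifold (𝓡 d) ∞ X]
  [IsRiemannianManifold (𝓡 d) X] [CompleteSpace X]

variable (X) in
/-- The oscillation bound of `exists_oscillation_bound` on Riemannian balls. -/
theorem exists_oscillation_bound_of_isElliptic {m : ℕ} (hm : d < 2 * m) {Λ : ℝ} (hΛ : 1 ≤ Λ) :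
    ∃ K : ℝ≥0∞, K ≠ ⊤ ∧ ∀ e ∈ IsManifold.maximalAtlas (𝓡 d) ∞ X, IsElliptic Λ e →
      Convex ℝ e.target → ∀ (c : X) (r : ℝ), 0 < r → ball c r ⊆ e.source →
      ∀ G : X → ℂ, ContDiff ℝ ∞ (chartExt e G) →
      ∀ p ∈ ball c (r / 2), ∀ q ∈ ball c (r / 2),
        ENNReal.ofReal (r ^ d) * ‖G p - G q‖ₑ ^ 2 ≤ K * ∑ α ∈ multiIndices d m,
          ENNReal.ofReal (r ^ (2 * order α)) *
            ∫⁻ z in e.target ∩ e.symm ⁻¹' ball c r, ‖multiDeriv α (chartExt e G) z‖ₑ ^ 2 := by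
  obtain ⟨K, hK, hosc⟩ := exists_oscillation_bound (F := ℂ) hm
  -- The half ball of radius r/2 is reached by `N` steps of size s = r/(2N). With ρ = r/(5Λ), the
  -- choice N ≥ 4Λ² gives Λs ≤ r/(8Λ) < ρ, so a step stays within a Euclidean ball of radius ρ.
  -- Moreover Λρ = r/5 < r/2, so such a ball about a point of the half ball corresponds to a subset
  -- of B(c, r).
  obtain ⟨N, hN⟩ := exists_nat_ge (4 * Λ ^ 2)
  have hΛ0 : 0 < Λ := by linarith
  have hN4 : (4 : ℝ) ≤ N := by nlinarith
  refine ⟨4 * N ^ 2 * (ENNReal.ofReal ((5 * Λ) ^ d) * K), by finiteness, ?_⟩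
  intro e he h hconv c r hr hball G hG
  set W := e.target ∩ e.symm ⁻¹' ball c r with hW
  set S := ∑ α ∈ multiIndices d m, ENNReal.ofReal (r ^ (2 * order α)) *
    ∫⁻ z in W, ‖multiDeriv α (chartExt e G) z‖ₑ ^ 2 with hS
  set s : ℝ := r / (2 * N) with hs
  set ρ : ℝ := r / (5 * Λ) with hρ
  have hs0 : 0 < s := by positivity
  have hρ0 : 0 < ρ := by positivity
  have hNs : N * s = r / 2 := by
    rw [hs]
    field_simp
  have hsr : s ≤ r / 8 := by
    rw [hs]
    gcongr
    linarith
  have hΛρ : Λ * ρ = r / 5 := by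
    rw [hρ]
    field_simp
  have hρr : ρ ≤ r := by nlinarith
  have hΛs : Λ * s < ρ := by
    rw [hs, hρ, mul_div_assoc', div_lt_div_iff₀ (by positivity) (by positivity)]
    nlinarith
  have hb0 : ENNReal.ofReal (ρ ^ d) ≠ 0 := (ENNReal.ofReal_pos.2 (by positivity)).ne'
  have hscale : ENNReal.ofReal (r ^ d) = ENNReal.ofReal ((5 * Λ) ^ d) * ENNReal.ofReal (ρ ^ d) := by
    rw [← ENNReal.ofReal_mul (by positivity), ← mul_pow]
    congr 2
    rw [hρ]
    field_simp
  -- The Euclidean estimate at radius ρ bounds the squared oscillation of one step by `T`; `M` is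
  -- its square root.
  set T := K * S / ENNReal.ofReal (ρ ^ d) with hT
  have hTb : ENNReal.ofReal (ρ ^ d) * T = K * S :=
    ENNReal.mul_div_cancel hb0 ENNReal.ofReal_ne_top
  set M := T ^ (1 / 2 : ℝ) with hM
  have hM2 : M ^ 2 = T := ENNReal.rpow_half_sq T
  have hstep : ∀ p ∈ ball c (N * s), ∀ q ∈ ball c (N * s), dist p q < s → ‖G p - G q‖ₑ ≤ M := by
    rw [hNs]
    intro p hp q hq hpq
    rw [mem_ball] at hp hq
    have hpr : p ∈ ball c r := mem_ball.2 (by linarith)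
    have hqr : q ∈ ball c r := mem_ball.2 (by linarith)
    have hclose : ‖e q - e p‖ ≤ Λ * s :=
      h.norm_chart_sub_le hΛ he hpq ((ball_subset_ball' (by linarith)).trans hball)
    have hsub : ball (e p) ρ ⊆ e.target := by
      refine h.ball_chart_subset hΛ he hconv (hball hpr) ?_
      refine (closedBall_subset_ball' ?_).trans hball
      linarith
    have hsubW : ball (e p) ρ ⊆ W := by
      intro v hv
      refine ⟨hsub hv, ?_⟩
      have hseg : segment ℝ (e p) v ⊆ e.target :=
        ((convex_ball (e p) ρ).segment_subset (mem_ball_self hρ0) hv).trans hsub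
      have h1 := h.edist_symm_le he hseg
      rw [e.left_inv (hball hpr), edist_dist, ENNReal.ofReal_le_ofReal_iff (by positivity)] at h1
      rw [mem_ball, dist_eq_norm] at hv
      have h2 : Λ * ‖v - e p‖ ≤ Λ * ρ := by gcongr
      have h3 := dist_triangle_left (e.symm v) c p
      exact mem_ball.2 (by linarith)
    have hGe : ∀ z ∈ ball c r, chartExt e G (e z) = G z := by
      intro z hz
      rw [chartExt, indicator_of_mem (e.map_source (hball hz)), e.left_inv (hball hz)]
    have hmain := hosc (chartExt e G) hG (e p) ρ hρ0 (e p) (mem_ball_self hρ0) (e q)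
      (by rw [mem_ball, dist_eq_norm]; linarith)
    rw [hGe p hpr, hGe q hqr] at hmain
    refine ENNReal.le_of_sq_le_sq ?_
    rw [hM2, hT, ENNReal.le_div_iff_mul_le (Or.inl hb0) (Or.inl ENNReal.ofReal_ne_top), mul_comm]
    refine hmain.trans ?_
    rw [hS]
    gcongr
  have hchain := enorm_sub_le_of_chain (d := d) hs0 hstep
  rw [hNs] at hchain
  intro p hp q hq
  have hpq : ‖G p - G q‖ₑ ≤ 2 * N * M := by
    calc ‖G p - G q‖ₑ = ‖(G c - G q) - (G c - G p)‖ₑ := by congr 1; abel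
      _ ≤ ‖G c - G q‖ₑ + ‖G c - G p‖ₑ := enorm_sub_le
      _ ≤ N * M + N * M := add_le_add (hchain q hq) (hchain p hp)
      _ = 2 * N * M := by ring
  calc ENNReal.ofReal (r ^ d) * ‖G p - G q‖ₑ ^ 2
      ≤ ENNReal.ofReal (r ^ d) * (2 * N * M) ^ 2 := by gcongr
    _ = 4 * N ^ 2 * (ENNReal.ofReal ((5 * Λ) ^ d) * (ENNReal.ofReal (ρ ^ d) * T)) := by
        rw [hscale, ← hM2]
        ring
    _ = _ := by
        rw [hTb]
        ring

end Oscillation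

/-! ### Passage to the limit and weighted averages -/

section Limit

variable {d : ℕ} {X : Type*}

/-- The oscillation bound passes to limits in `L_2`. -/
theorem ae_oscillation_bound_of_tendsto [MeasurableSpace X] {μ : Measure X} {G : ℕ → X → ℂ}
    {g : X → ℂ} (hGm : ∀ n, AEStronglyMeasurable (G n) μ) (hg : AEStronglyMeasurable g μ)
    (hlim : Tendsto (fun n => eLpNorm (G n - g) 2 μ) atTop (𝓝 0))
    {W T : Set (E d)} (hWT : W ⊆ T) {ι : Type*} {A : Finset ι} {U : ℕ → ι → E d → ℂ}
    {D : ι → E d → ℂ} (hU : ∀ n, ∀ α ∈ A, MemLp (U n α) 2 (volume.restrict T))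
    (hD : ∀ α ∈ A, MemLp (D α) 2 (volume.restrict T))
    (hDlim : ∀ α ∈ A, Tendsto (fun n => eLpNorm (U n α - D α) 2 (volume.restrict T)) atTop (𝓝 0))
    {Y : Set X} {a K : ℝ≥0∞} (ha : a ≠ ⊤) (hK : K ≠ ⊤) {b : ι → ℝ≥0∞} (hb : ∀ α, b α ≠ ⊤)
    (hosc : ∀ n, ∀ p ∈ Y, ∀ q ∈ Y, a * ‖G n p - G n q‖ₑ ^ 2
      ≤ K * ∑ α ∈ A, b α * ∫⁻ z in W, ‖U n α z‖ₑ ^ 2) :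
    ∀ᵐ p ∂μ, p ∈ Y → ∀ᵐ q ∂μ, q ∈ Y →
      a * ‖g p - g q‖ₑ ^ 2 ≤ K * ∑ α ∈ A, b α * ∫⁻ z in W, ‖D α z‖ₑ ^ 2 := by
  -- Convergence in `L_2` gives convergence almost everywhere along a subsequence, which suffices
  -- for a pointwise bound.
  obtain ⟨ns, hns, hae⟩ := (tendstoInMeasure_of_tendsto_eLpNorm two_ne_zero hGm hg
    hlim).exists_seq_tendsto_ae
  have key : ∀ p, Tendsto (fun i => G (ns i) p) atTop (𝓝 (g p)) → p ∈ Y →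
      ∀ q, Tendsto (fun i => G (ns i) q) atTop (𝓝 (g q)) → q ∈ Y →
      a * ‖g p - g q‖ₑ ^ 2 ≤ K * ∑ α ∈ A, b α * ∫⁻ z in W, ‖D α z‖ₑ ^ 2 := by
    intro p hp hpY q hq hqY
    have hl : Tendsto (fun i => a * ‖G (ns i) p - G (ns i) q‖ₑ ^ 2) atTop
        (𝓝 (a * ‖g p - g q‖ₑ ^ 2)) :=
      ENNReal.Tendsto.const_mul ((ENNReal.continuous_pow 2).tendsto _ |>.comp (hp.sub hq).enorm)
        (Or.inr ha)
    -- The derivative norms over `W` are majorised by Minkowski's inequality, with the error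
    -- measured over the larger set where `L_2` convergence is known.
    have hsum : Tendsto (fun i => K * ∑ α ∈ A, b α *
        (eLpNorm (D α) 2 (volume.restrict W) + eLpNorm (U (ns i) α - D α) 2 (volume.restrict T)) ^ 2)
        atTop (𝓝 (K * ∑ α ∈ A, b α * (eLpNorm (D α) 2 (volume.restrict W) + 0) ^ 2)) := by
      refine ENNReal.Tendsto.const_mul (tendsto_finsetSum _ fun α hα => ?_) (Or.inr hK)
      refine ENNReal.Tendsto.const_mul ?_ (Or.inr (hb α))
      exact (ENNReal.continuous_pow 2).tendsto _ |>.comp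
        (tendsto_const_nhds.add ((hDlim α hα).comp hns.tendsto_atTop))
    simp only [add_zero] at hsum
    simp only [← eLpNorm_two_sq]
    refine le_of_tendsto_of_tendsto' hl hsum fun i => (hosc (ns i) p hpY q hqY).trans ?_
    refine mul_le_mul_right (Finset.sum_le_sum fun α hα => mul_le_mul_right ?_ _) _
    rw [← eLpNorm_two_sq]
    refine pow_le_pow_left' ?_ 2
    have hsplit : U (ns i) α = D α + (U (ns i) α - D α) := by abel
    have hmono := Measure.restrict_mono_set (volume : Measure (E d)) hWT
    conv_lhs => rw [hsplit]
    refine (eLpNorm_add_le ((hD α hα).1.mono_measure hmono)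
      (((hU (ns i) α hα).sub (hD α hα)).1.mono_measure hmono) one_le_two).trans ?_
    gcongr
  filter_upwards [hae] with p hp hpY
  filter_upwards [hae] with q hq hqY
  exact key p hp hpY q hq hqY

/-- A function whose oscillation is bounded differs from its weighted averages by at most this
bound. -/
theorem lintegral_enorm_sub_average_sq_le [MeasurableSpace X] {ν : Measure X} {ψ : X → ℝ}
    (hψ : Integrable ψ ν) (hψ0 : ∀ p, 0 ≤ ψ p) (hpos : 0 < ∫ p, ψ p ∂ν) {g : X → ℂ}
    (hψg : Integrable (fun p => ψ p • g p) ν) {T : ℝ≥0∞}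
    (hosc : ∀ᵐ p ∂ν, ∀ᵐ q ∂ν, ‖g p - g q‖ₑ ^ 2 ≤ T) :
    ∫⁻ p, ‖g p - (∫ q, ψ q ∂ν)⁻¹ • ∫ q, ψ q • g q ∂ν‖ₑ ^ 2 ∂ν ≤ T * ν univ := by
  rw [← lintegral_const]
  refine lintegral_mono_ae ?_
  filter_upwards [hosc] with p hp
  set I := ∫ q, ψ q ∂ν with hI
  -- As ψ divided by its integral has total mass one, `g p` can be moved inside the average.
  have hdiff : g p - I⁻¹ • ∫ q, ψ q • g q ∂ν = I⁻¹ • ∫ q, ψ q • (g p - g q) ∂ν := by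
    simp only [smul_sub]
    rw [integral_sub (hψ.smul_const _) hψg, integral_smul_const, smul_sub, ← hI,
      inv_smul_smul₀ hpos.ne']
  have hle : ‖∫ q, ψ q • (g p - g q) ∂ν‖ₑ ≤ ‖I‖ₑ * T ^ (1 / 2 : ℝ) := by
    calc _ ≤ ∫⁻ q, ‖ψ q • (g p - g q)‖ₑ ∂ν := enorm_integral_le_lintegral_enorm _
      _ ≤ ∫⁻ q, ‖ψ q‖ₑ * T ^ (1 / 2 : ℝ) ∂ν := by
          refine lintegral_mono_ae ?_
          filter_upwards [hp] with q hq
          rw [enorm_smul]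
          refine mul_le_mul_right (ENNReal.le_of_sq_le_sq ?_) _
          rwa [ENNReal.rpow_half_sq]
      _ = _ := by
          rw [lintegral_mul_const'' _ hψ.1.enorm, Real.enorm_eq_ofReal hpos.le, hI,
            ofReal_integral_eq_lintegral_ofReal hψ (Eventually.of_forall hψ0)]
          simp only [fun q => Real.enorm_eq_ofReal (hψ0 q)]
  rw [hdiff, enorm_smul]
  calc _ ≤ (‖I⁻¹‖ₑ * (‖I‖ₑ * T ^ (1 / 2 : ℝ))) ^ 2 := by gcongr
    _ = T := by
        rw [← mul_assoc, ← enorm_mul, inv_mul_cancel₀ hpos.ne', enorm_one, one_mul,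
          ENNReal.rpow_half_sq]

end Limit

theorem cell_subset_ball {X : Type*} [MetricSpace X] {ι : Type*} [LinearOrder ι] [WellFoundedLT ι] (r : ℝ) (x : ι → X)
    (k : ι) : cell r x k ⊆ ball (x k) (r / 2) := by
  rw [cell_eq]
  exact sdiff_subset

/-! ### The estimate on a single ball -/

section LocalEstimate

variable {d : ℕ} {X : Type*} [MetricSpace X] [ChartedSpace (E d) X]
  [RiemannianBundle (fun p : X => TangentSpace (𝓡 d) p)] [IsManifold (𝓡 d) ∞ X]
  [MeasurableSpace X] [BorelSpace X]
  [IsContMDiffRiemannianBundle (𝓡 d) ∞ (E d) (fun p : X => TangentSpace (𝓡 d) p)]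

/-- In the chart the ball lies in a Euclidean ball of radius Λr, and the density is at most Λ^d. The
power r^d obtained here cancels the r^d of the oscillation bound. -/
theorem IsElliptic.riemMeasure_ball_le [IsRiemannianManifold (𝓡 d) X] {Λ : ℝ} (hΛ : 1 ≤ Λ)
    {e : OpenPartialHomeomorph X (E d)} (h : IsElliptic Λ e)
    (he : e ∈ IsManifold.maximalAtlas (𝓡 d) ∞ X) {c : X} {r : ℝ} (hr : 0 < r)
    (hball : ball c r ⊆ e.source) :
    riemMeasure d X (ball c r)
      ≤ ENNReal.ofReal ((Λ ^ 2) ^ d) * volume (ball (0 : E d) 1) * ENNReal.ofReal (r ^ d) := by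
  have h1 := h.setLIntegral_riemMeasure_le hΛ he (f := fun _ => 1) aemeasurable_const
    measurableSet_ball hball
  simp only [lintegral_const, one_mul, Measure.restrict_apply_univ] at h1
  have hsub : e.target ∩ e.symm ⁻¹' ball c r ⊆ closedBall (e c) (Λ * r) := by
    rintro v ⟨hv, hvc⟩
    have h2 := h.norm_chart_sub_le hΛ he (mem_ball'.1 hvc) hball
    rwa [e.right_inv hv, ← dist_eq_norm] at h2
  refine (h1.trans (mul_le_mul_right (measure_mono hsub) _)).trans_eq ?_
  rw [Measure.addHaar_closedBall _ _ (by positivity), finrank_euclideanSpace_fin, ← mul_assoc,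
    ← ENNReal.ofReal_mul (by positivity), mul_right_comm (ENNReal.ofReal _),
    ← ENNReal.ofReal_mul (by positivity)]
  congr 2
  ring

/-- The local estimate on one ball `B(c, r)` in the domain of an elliptic chart, from an oscillation
bound on `B(c, r/2)`. -/
theorem IsElliptic.lintegral_sub_weightedAvg_le [IsRiemannianManifold (𝓡 d) X]
    [SecondCountableTopology X] {Λ : ℝ} (hΛ : 1 ≤ Λ)
    {e : OpenPartialHomeomorph X (E d)} (h : IsElliptic Λ e)
    (he : e ∈ IsManifold.maximalAtlas (𝓡 d) ∞ X) {c : X} {r : ℝ} (hr : 0 < r)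
    (hball : ball c r ⊆ e.source) {g : X → ℂ} (hg : MemLp g 2 (riemMeasure d X)) {T : ℝ≥0∞}
    (hosc : ∀ᵐ p ∂(riemMeasure d X), p ∈ ball c (r / 2) → ∀ᵐ q ∂(riemMeasure d X),
      q ∈ ball c (r / 2) → ENNReal.ofReal (r ^ d) * ‖g p - g q‖ₑ ^ 2 ≤ T)
    {U : Set X} (hU : U ⊆ ball c (r / 2)) {ψ : X → ℝ} (hψc : Continuous ψ) (hψU : tsupport ψ ⊆ U)
    (hψ : ∀ p, 0 ≤ ψ p ∧ ψ p ≤ 1) (hψne : ∃ p, ψ p ≠ 0) :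
    ∫⁻ p in U, ‖g p - weightedAvg (riemMeasure d X) U ψ g‖ₑ ^ 2 ∂(riemMeasure d X)
      ≤ ENNReal.ofReal ((Λ ^ 2) ^ d) * volume (ball (0 : E d) 1) * T := by
  set μ := riemMeasure d X with hμ
  have hsub : ball c (r / 2) ⊆ ball c r := ball_subset_ball (by linarith)
  have hμU : μ U ≤
      ENNReal.ofReal ((Λ ^ 2) ^ d) * volume (ball (0 : E d) 1) * ENNReal.ofReal (r ^ d) :=
    (measure_mono (hU.trans hsub)).trans (h.riemMeasure_ball_le hΛ he hr hball)
  have hrd : ENNReal.ofReal (r ^ d) ≠ 0 := (ENNReal.ofReal_pos.2 (by positivity)).ne'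
  have hfin : μ U < ⊤ := hμU.trans_lt (by
    have : volume (ball (0 : E d) 1) < ⊤ := measure_ball_lt_top
    finiteness)
  have : IsFiniteMeasure (μ.restrict U) := ⟨by simpa using hfin⟩
  have hψi : MemLp ψ 2 (μ.restrict U) := by
    refine MemLp.of_bound hψc.aestronglyMeasurable 1 (Eventually.of_forall fun p => ?_)
    rw [Real.norm_of_nonneg (hψ p).1]
    exact (hψ p).2
  have hψg : Integrable (fun p => ψ p • g p) (μ.restrict U) :=
    memLp_one_iff_integrable.1 ((hg.restrict U).smul hψi)
  have hsuppU : Function.support ψ ⊆ U := (subset_tsupport ψ).trans hψU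
  have hpos : 0 < ∫ p in U, ψ p ∂μ := by
    rw [setIntegral_pos_iff_support_of_nonneg_ae (Eventually.of_forall fun p => (hψ p).1)
      (hψi.integrable one_le_two), inter_eq_left.2 hsuppU]
    refine h.riemMeasure_pos hΛ he hψc.isOpen_support hψne ?_
    exact hsuppU.trans (hU.trans (hsub.trans hball))
  -- Measurability of `U` is not available here, so the restriction to `U` is made through the
  -- measurable ball containing it.
  have hosc' : ∀ᵐ p ∂(μ.restrict U), ∀ᵐ q ∂(μ.restrict U),
      ‖g p - g q‖ₑ ^ 2 ≤ T / ENNReal.ofReal (r ^ d) := by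
    refine ae_restrict_of_ae_restrict_of_subset hU ?_
    rw [ae_restrict_iff' measurableSet_ball]
    filter_upwards [hosc] with p hp hpb
    refine ae_restrict_of_ae_restrict_of_subset hU ?_
    rw [ae_restrict_iff' measurableSet_ball]
    filter_upwards [hp hpb] with q hq hqb
    rw [ENNReal.le_div_iff_mul_le (Or.inl hrd) (Or.inl ENNReal.ofReal_ne_top), mul_comm]
    exact hq hqb
  have hmain := lintegral_enorm_sub_average_sq_le (hψi.integrable one_le_two) (fun p => (hψ p).1)
    hpos hψg hosc'
  rw [Measure.restrict_apply_univ] at hmain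
  refine (hmain.trans (mul_le_mul_right hμU _)).trans_eq ?_
  rw [mul_comm, mul_assoc, ENNReal.mul_div_cancel hrd ENNReal.ofReal_ne_top]

end LocalEstimate

/-! ### Smooth approximation of the localized function -/

section Localized

variable {d : ℕ} {X : Type*} [MetricSpace X] [ChartedSpace (E d) X] {κ : Type}
  {φ : SmoothPartitionOfUnity κ (𝓡 d) X univ} {ν : κ}

theorem contMDiff_partition_smul {F : X → ℂ} (hF : ContMDiff (𝓡 d) 𝓘(ℝ, ℂ) ∞ F) :
    ContMDiff (𝓡 d) 𝓘(ℝ, ℂ) ∞ fun p => φ ν p • F p :=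
  (φ ν).contMDiff.smul hF

theorem tsupport_partition_smul_subset (F : X → ℂ) :
    tsupport (fun p => φ ν p • F p) ⊆ tsupport (φ ν) :=
  tsupport_smul_subset_left (φ ν) F

theorem eLpNorm_partition_smul_le [MeasurableSpace X] (μ : Measure X) (f : X → ℂ) :
    eLpNorm (fun p => φ ν p • f p) 2 μ ≤ eLpNorm f 2 μ := by
  refine eLpNorm_mono fun p => ?_
  rw [norm_smul, Real.norm_of_nonneg (φ.nonneg ν p)]
  exact mul_le_of_le_one_left (norm_nonneg _) (φ.le_one ν p)

theorem memLp_partition_smul [MeasurableSpace X] [OpensMeasurableSpace X] {μ : Measure X}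
    {f : X → ℂ} (hf : MemLp f 2 μ) : MemLp (fun p => φ ν p • f p) 2 μ :=
  ⟨((φ ν).contMDiff.continuous.measurable.stronglyMeasurable.aestronglyMeasurable).smul hf.1,
    (eLpNorm_partition_smul_le μ f).trans_lt hf.2⟩

variable [RiemannianBundle (fun p : X => TangentSpace (𝓡 d) p)] [IsManifold (𝓡 d) ∞ X]
  [MeasurableSpace X] [BorelSpace X]
  [IsContMDiffRiemannianBundle (𝓡 d) ∞ (E d) (fun p : X => TangentSpace (𝓡 d) p)]

/-- Approximation of `φ_ν f`, for `f` in the Sobolev space, by smooth functions: the derivatives in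
the geodesic coordinates converge in `L_2` to weak derivatives of `φ_ν f`. -/
theorem MemSobolev.exists_approximation {m : ℕ} {y : κ → X} {lam : ℝ} (hlam : 0 < lam)
    {θ : ∀ ν, GeodesicChart d (y ν) lam} (hφ : IsAdmissible θ φ) {f : X → ℂ}
    (hf : MemSobolev m θ φ f) {Λ : ℝ} (hΛ : 1 ≤ Λ) (h : IsElliptic Λ (θ ν).chart) :
    ∃ (G : ℕ → X → ℂ) (D : (Fin d → ℕ) → E d → ℂ),
      (∀ n, AEStronglyMeasurable (G n) (riemMeasure d X)) ∧
      (∀ n, ContDiff ℝ ∞ (chartExt (θ ν).chart (G n))) ∧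
      (∀ n, HasCompactSupport (chartExt (θ ν).chart (G n))) ∧
      Tendsto (fun n => eLpNorm (G n - fun p => φ ν p • f p) 2 (riemMeasure d X)) atTop (𝓝 0) ∧
      ∀ α ∈ multiIndices d m, MemLp (D α) 2 (volume.restrict (ball 0 lam)) ∧
        Tendsto (fun n => eLpNorm (multiDeriv α (chartExt (θ ν).chart (G n)) - D α) 2
          (volume.restrict (ball 0 lam))) atTop (𝓝 0) ∧
        IsWeakDeriv (ball 0 lam) α (localized θ φ ν f) (D α) := by
  obtain ⟨hfL, F, hF, hlim, hcau⟩ := hf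
  set e := (θ ν).chart with he_def
  have he := (θ ν).smooth
  have hVe : ball (y ν) (lam / 2) ⊆ e.source := by
    rw [(θ ν).source_eq]
    exact ball_subset_ball (by linarith)
  obtain ⟨G, hG⟩ : ∃ G : ℕ → X → ℂ, ∀ n, G n = fun p => φ ν p • F n p := ⟨_, fun _ => rfl⟩
  have hGs : ∀ n, ContMDiff (𝓡 d) 𝓘(ℝ, ℂ) ∞ (G n) := fun n => by
    rw [hG]
    exact contMDiff_partition_smul (hF n).1
  have hGc : ∀ n, HasCompactSupport (G n) := fun n => by
    rw [hG]
    exact IsCompact.of_isClosed_subset (hφ.hasCompactSupport ν) (isClosed_tsupport _)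
      (tsupport_partition_smul_subset (F n))
  have hGV : ∀ n, tsupport (G n) ⊆ ball (y ν) (lam / 2) := fun n => by
    rw [hG]
    exact (tsupport_partition_smul_subset (F n)).trans (hφ.subordinate ν)
  have hGlim : Tendsto (fun n => eLpNorm (G n - fun p => φ ν p • f p) 2 (riemMeasure d X))
      atTop (𝓝 0) := by
    refine tendsto_of_tendsto_of_tendsto_of_le_of_le tendsto_const_nhds hlim
      (fun _ => zero_le) fun n => ?_
    have : (G n - fun p => φ ν p • f p) = fun p => φ ν p • (F n - f) p := by
      funext p
      simp [hG, mul_sub]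
    simp only [this]
    exact eLpNorm_partition_smul_le _ _
  have hex : ∀ α ∈ multiIndices d m, ∃ D : E d → ℂ, MemLp D 2 (volume.restrict e.target) ∧
      Tendsto (fun n => eLpNorm (multiDeriv α (chartExt e (G n)) - D) 2
        (volume.restrict e.target)) atTop (𝓝 0) ∧
      IsWeakDeriv e.target α (fun v => φ ν (e.symm v) • f (e.symm v)) D := by
    intro α hα
    refine h.exists_isWeakDeriv_of_cauchy hΛ he measurableSet_ball hVe hGs hGc hGV
      (memLp_partition_smul hfL) hGlim fun ε hε => ?_
    obtain ⟨N, hN⟩ := hcau ε hε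
    refine ⟨N, fun p hp q hq => lt_of_le_of_lt ?_ (hN p hp q hq)⟩
    have hdiff : (fun w => (G p - G q) (e.symm w)) = localized θ φ ν (F p - F q) := by
      funext w
      simp [hG, localized, mul_sub, he_def]
    rw [hdiff]
    -- The integral for one ν and one α is a single term of the Sobolev norm.
    refine le_trans ?_ (ENNReal.le_tsum ν)
    exact Finset.single_le_sum (f := fun α => ∫⁻ p' in ball (y ν) (lam / 2),
      ‖multiDeriv α (localized θ φ ν (F p - F q)) (e p')‖ₑ ^ 2 ∂(riemMeasure d X))
      (fun _ _ => zero_le) hα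
  choose! D hD using hex
  refine ⟨G, D, fun n => ((hGs n).continuous.stronglyMeasurable_of_hasCompactSupport
    (hGc n)).aestronglyMeasurable, fun n => contDiff_chartExt he (hGs n) (hGc n)
    ((hGV n).trans hVe), fun n => hasCompactSupport_chartExt (hGc n) ((hGV n).trans hVe), hGlim,
    fun α hα => ?_⟩
  rw [← (θ ν).target_eq]
  exact hD α hα

end Localized

end LocalPoincare

/-! ### The local Poincaré inequality -/

theorem mainTheorem4 {d : ℕ} {X : Type*} [MetricSpace X] [ConnectedSpace X]
    [SecondCountableTopology X] [MeasurableSpace X] [BorelSpace X]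
    [ChartedSpace (LocalPoincare.E d) X] [IsManifold (𝓡 d) ∞ X]
    [RiemannianBundle (fun p : X => TangentSpace (𝓡 d) p)]
    [IsContMDiffRiemannianBundle (𝓡 d) ∞ (LocalPoincare.E d)
      (fun p : X => TangentSpace (𝓡 d) p)]
    [IsRiemannianManifold (𝓡 d) X]
    (hX : LocalPoincare.IsHomogeneous d X ∨ LocalPoincare.HasBoundedGeometry d X)
    (m : ℕ) (hm : (d : ℝ) / 2 < (m : ℝ))
    (lam : ℝ) (hlam : 0 < lam) (hinj : ENNReal.ofReal lam < LocalPoincare.injRadius d X) :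
    ∃ C r₀ : ℝ, 0 < C ∧ 0 < r₀ ∧
      ∀ (κ : Type) (y : κ → X) (_ : LocalPoincare.IsLattice lam y)
        (θ : ∀ ν, LocalPoincare.GeodesicChart d (y ν) lam)
        (φ : SmoothPartitionOfUnity κ (𝓡 d) X univ) (_ : LocalPoincare.IsAdmissible θ φ)
        (f : X → ℂ) (_ : LocalPoincare.MemSobolev m θ φ f) (ν : κ),
        (∀ α ∈ LocalPoincare.multiIndices d m, ∃ D : LocalPoincare.E d → ℂ,
          LocalPoincare.IsWeakDeriv (ball 0 lam) α (LocalPoincare.localized θ φ ν f) D ∧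
          MemLp (fun p => D ((θ ν).chart p)) 2
            ((LocalPoincare.riemMeasure d X).restrict (ball (y ν) lam))) ∧
        ∀ D : (Fin d → ℕ) → LocalPoincare.E d → ℂ,
          (∀ α ∈ LocalPoincare.multiIndices d m,
            LocalPoincare.IsWeakDeriv (ball 0 lam) α
              (LocalPoincare.localized θ φ ν f) (D α)) →
          ∀ (ι : Type) [LinearOrder ι] [WellFoundedLT ι] [Countable ι] (r : ℝ) (x : ι → X),
            0 < r → r < r₀ → LocalPoincare.IsLattice r x →
            ∀ (k : ι) (ψ : X → ℝ), ContMDiff (𝓡 d) 𝓘(ℝ, ℝ) ∞ ψ → HasCompactSupport ψ →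
              tsupport ψ ⊆ LocalPoincare.cell r x k → (∀ p, 0 ≤ ψ p ∧ ψ p ≤ 1) →
              (∃ p, ψ p ≠ 0) →
              ∫⁻ p in LocalPoincare.cell r x k,
                  ‖φ ν p • f p - LocalPoincare.weightedAvg (LocalPoincare.riemMeasure d X)
                    (LocalPoincare.cell r x k) ψ (fun q => φ ν q • f q)‖ₑ ^ 2
                  ∂(LocalPoincare.riemMeasure d X)
                ≤ ENNReal.ofReal C * ∑ α ∈ LocalPoincare.multiIndices d m,
                    ENNReal.ofReal (r ^ (2 * LocalPoincare.order α)) *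
                      ∫⁻ p in ball (x k) r ∩ ball (y ν) lam,
                        ‖D α ((θ ν).chart p)‖ₑ ^ 2 ∂(LocalPoincare.riemMeasure d X) := by
  have hm' : d < 2 * m := by
    have : (d : ℝ) < 2 * m := by linarith
    exact_mod_cast this
  obtain ⟨hcomplete, Λ, hΛ, hell⟩ :=
    LocalPoincare.completeSpace_and_exists_isElliptic hX hlam hinj
  obtain ⟨K, hK, hosc⟩ := LocalPoincare.exists_oscillation_bound_of_isElliptic X hm' hΛ
  -- The factors come from the volume of the ball, the oscillation bound, and the return of the
  -- derivative integrals from the chart to X. They depend on X, m and λ through Λ and `K`.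
  set K' : ℝ≥0∞ := ENNReal.ofReal ((Λ ^ 2) ^ d) * volume (ball (0 : LocalPoincare.E d) 1) *
    (K * ENNReal.ofReal (Λ ^ d)) with hK'
  have hK'top : K' ≠ ⊤ := by
    have : volume (ball (0 : LocalPoincare.E d) 1) < ⊤ := measure_ball_lt_top
    finiteness
  -- Adding 1 ensures positivity. The threshold λ/3 guarantees 3r/2 + λ/2 < λ, so that B(x_k, r)
  -- lies in the coordinate ball whenever B(x_k, r/2) meets B(y_ν, λ/2).
  refine ⟨K'.toReal + 1, lam / 3, by positivity, by positivity, ?_⟩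
  intro κ y _ θ φ hφ f hf ν
  have he := (θ ν).smooth
  have h := hell (y ν) (θ ν)
  obtain ⟨G, D₀, hGm, hGs, hGc, hGlim, hD₀⟩ := hf.exists_approximation (ν := ν) hlam hφ hΛ h
  refine ⟨fun α hα => ⟨D₀ α, (hD₀ α hα).2.2, ?_⟩, ?_⟩
  · have h1 := (hD₀ α hα).1
    rw [← (θ ν).target_eq] at h1
    rw [← (θ ν).source_eq]
    exact h.memLp_comp_chart hΛ he h1
  intro D hD ι _ _ _ r x hr hr₀ _ k ψ hψs _ hψU hψ hψne
  have hcell := LocalPoincare.cell_subset_ball r x k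
  -- If the balls are disjoint, φ_ν f vanishes on the cell, and so does its average.
  by_cases hmeet : Disjoint (ball (x k) (r / 2)) (ball (y ν) (lam / 2))
  · have hzero : ∀ p ∈ ball (x k) (r / 2), φ ν p • f p = 0 := by
      intro p hp
      rw [image_eq_zero_of_notMem_tsupport fun hs =>
        disjoint_left.1 hmeet hp (hφ.subordinate ν hs), zero_smul]
    have havg : LocalPoincare.weightedAvg (LocalPoincare.riemMeasure d X)
        (LocalPoincare.cell r x k) ψ (fun q => φ ν q • f q) = 0 := by
      have hint : ∫ p in LocalPoincare.cell r x k, ψ p • φ ν p • f p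
          ∂(LocalPoincare.riemMeasure d X) = 0 :=
        setIntegral_eq_zero_of_forall_eq_zero fun p hp => by rw [hzero p (hcell hp), smul_zero]
      rw [LocalPoincare.weightedAvg, hint, smul_zero]
    refine (lintegral_mono_set hcell).trans ?_
    rw [setLIntegral_eq_zero measurableSet_ball]
    · exact zero_le
    · intro p hp
      rw [havg]
      simp only [hzero p hp]
      simp
  have hball : ball (x k) r ⊆ ball (y ν) lam := by
    obtain ⟨p, hp, hp'⟩ := not_disjoint_iff.1 hmeet
    rw [mem_ball] at hp hp'
    have := dist_triangle_left (x k) (y ν) p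
    exact ball_subset_ball' (by linarith)
  have hball' : ball (x k) r ⊆ (θ ν).chart.source := by rwa [(θ ν).source_eq]
  have htarget := (θ ν).target_eq
  have hconv : Convex ℝ (θ ν).chart.target := by
    rw [htarget]
    exact convex_ball _ _
  have hgL := LocalPoincare.memLp_partition_smul (φ := φ) (ν := ν) hf.1
  set W := (θ ν).chart.target ∩ (θ ν).chart.symm ⁻¹' ball (x k) r with hW
  have hae := LocalPoincare.ae_oscillation_bound_of_tendsto (W := W) hGm hgL.1 hGlim
    (htarget ▸ inter_subset_left)
    (fun n α _ => LocalPoincare.memLp_of_contDiff_of_hasCompactSupport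
      (LocalPoincare.contDiff_multiDeriv (hGs n) α)
      (LocalPoincare.hasCompactSupport_multiDeriv (hGc n) α) _)
    (fun α hα => (hD₀ α hα).1) (fun α hα => (hD₀ α hα).2.1)
    (ENNReal.ofReal_ne_top (r := r ^ d)) hK
    (fun α => ENNReal.ofReal_ne_top (r := r ^ (2 * LocalPoincare.order α)))
    (fun n p hp q hq => hosc _ he h hconv (x k) r hr hball' (G n) (hGs n) p hp q hq)
  have hmain := h.lintegral_sub_weightedAvg_le hΛ he hr hball' hgL hae hcell
    hψs.continuous hψU hψ hψne
  refine hmain.trans ?_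
  set S := ∑ α ∈ LocalPoincare.multiIndices d m,
    ENNReal.ofReal (r ^ (2 * LocalPoincare.order α)) *
      ∫⁻ p in ball (x k) r ∩ ball (y ν) lam,
        ‖D α ((θ ν).chart p)‖ₑ ^ 2 ∂(LocalPoincare.riemMeasure d X) with hS
  have hsum : ∑ α ∈ LocalPoincare.multiIndices d m,
      ENNReal.ofReal (r ^ (2 * LocalPoincare.order α)) * ∫⁻ z in W, ‖D₀ α z‖ₑ ^ 2
        ≤ ENNReal.ofReal (Λ ^ d) * S := by
    rw [hS, Finset.mul_sum]
    refine Finset.sum_le_sum fun α hα => ?_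
    rw [mul_left_comm]
    refine mul_le_mul_right ?_ _
    -- The prescribed weak derivatives agree almost everywhere with the `L_2`-limits, so their
    -- integrals coincide.
    have hDD : D₀ α =ᵐ[volume.restrict W] D α :=
      ae_restrict_of_ae_restrict_of_subset (htarget ▸ inter_subset_left)
        ((hD₀ α hα).2.2.ae_eq isOpen_ball (hD α hα))
    have hDD' : ∫⁻ z in W, ‖D₀ α z‖ₑ ^ 2 = ∫⁻ z in W, ‖D α z‖ₑ ^ 2 :=
      lintegral_congr_ae (hDD.fun_comp fun z => ‖z‖ₑ ^ 2)
    rw [hDD', inter_eq_left.2 hball]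
    refine h.setLIntegral_volume_le hΛ he (f := fun z => ‖D α z‖ₑ ^ 2) ?_ measurableSet_ball hball'
    rw [htarget]
    exact (hD α hα).locallyIntegrable_right.aestronglyMeasurable.enorm.pow_const 2
  calc _ ≤ ENNReal.ofReal ((Λ ^ 2) ^ d) * volume (ball (0 : LocalPoincare.E d) 1) *
        (K * (ENNReal.ofReal (Λ ^ d) * S)) := by gcongr
    _ = K' * S := by rw [hK']; ring
    _ ≤ _ := by
        gcongr
        rw [← ENNReal.ofReal_toReal hK'top]
        exact ENNReal.ofReal_le_ofReal (by simp)
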